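/- Let $N\ge 1$ and let $\mathcal W=(\mathcal W_{ijkl})_{1\le i,j,k,l\le N}$ be a nonzero, completely symmetric real tensor. Viewed as a matrix $\mathcal W_{IJ}$ indexed by pairs $I=(i,j)$, $J=(k,l)$, assume that $\mathcal W$ has nonnegative eigenvalues, and let $\lambda_0^2>0$ be its highest eigenvalue. For $u\in\mathbb C$ with $\operatorname{Re}u\ge 0$ and $J\in\mathbb R^N$ let $$Z(u,J)=\int_{\mathbb R^N}\prod_{i=1}^N d\phi_i\; \exp\Big(-\tfrac12\sum_i\phi_i^2-\tfrac{u}{4!}\sum_{ijkl}\mathcal W_{ijkl}\phi_i\phi_j\phi_k\phi_l+\sum_i J_i\phi_i\Big),\qquad F(u,J)=\ln Z(u,J)$$ (principal branch of the logarithm), and for $n\ge 1$ and $i_1,\dots,i_n\in\{1,\dots,N\}$ let $$G_{i_1,\dots,i_n}(u)=\frac{\partial^n F(u,J)}{\partial J_{i_1}\cdots\partial J_{i_n}}\Big|_{J=0}$$ be the connected correlation functions of the zero-dimensional bosonic quartic model. Then, for all $n\ge1$ and all $i_1,\dots,i_n$: (i) $G_{i_1,\dots,i_n}$ is analytic at least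 in the interior of the cardioid domain $$\Big\{u=\rho e^{i\theta}:\ \theta\in(-\pi,\pi],\ 0\le\rho\le\frac{6}{N\lambda_0^2}\sqrt{\frac e\pi}\,\cos^2\frac\theta2\Big\},$$ in the sense that there is an analytic function on this interior which is equal to $G_{i_1,\dots,i_n}(u)$ at all its points with $\operatorname{Re}u\ge0$. (ii) $G_{i_1,\dots,i_n}$ is Borel summable in $u$: there are $R,K,\sigma>0$ and $(a_k)_{k\ge0}\subset\mathbb C$ such that, in the disk $\operatorname{Re}(u^{-1})>R^{-1}$, $G_{i_1,\dots,i_n}$ is analytic and $$\Big|G_{i_1,\dots,i_n}(u)-\sum_{k=0}^{r-1}a_ku^k\Big|\le K\sigma^r\,r!\,|u|^r\qquad\text{for all } r\ge 0,$$ and such that the Borel transform $\mathcal B(t)=\sum_{k\ge0}\frac{a_k}{k!}t^k$ converges for $|t|<\sigma^{-1}$, has an analytic continuation to $\{t\in\mathbb C:\operatorname{dist}(t,[0,\infty))<\sigma^{-1}\}$ that is bounded there by a constant times $e^{|t|/R}$, and represents $G_{i_1,\dots,i_n}$ by the absolutely convergent integral $$G_{i_1,\dots,i_n}(u)=\frac1u\int_0^\infty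 \mathcal B(t)\,e^{-t/u}\,dt\qquad\text{whenever } \operatorname{Re}(u^{-1})>R^{-1}.$$ -/

import Mathlib

noncomputable section

namespace QuarticVector

/-- A real four-index tensor on `N` flavours. -/
abbrev Tensor4 (N : ℕ) : Type := Fin N → Fin N → Fin N → Fin N → ℝ

/-- Complete symmetry: invariance under the three adjacent transpositions of indices, which
generate all permutations of the four indices. -/
def IsCompletelySymmetric {N : ℕ} (W : Tensor4 N) : Prop :=
  ∀ i j k l, W i j k l = W j i k l ∧ W i j k l = W i k j l ∧ W i j k l = W i j l k

/-- The tensor `W` read as a matrix `W_{IJ}` whose indices are the pairs `I = (i, j)`,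
`J = (k, l)`, so that the quartic form is `∑_{I J} W_{IJ} (φ_i φ_j) (φ_k φ_l)`. -/
def pairMatrix {N : ℕ} (W : Tensor4 N) :
    Matrix (Fin N × Fin N) (Fin N × Fin N) ℝ :=
  Matrix.of fun I J => W I.1 I.2 J.1 J.2

/-- `Λ` is the highest eigenvalue of the real square matrix `M`. -/
def IsHighestEigenvalue {ι : Type*} [Fintype ι] [DecidableEq ι] (M : Matrix ι ι ℝ) (Λ : ℝ) :
    Prop :=
  IsGreatest {μ : ℝ | Module.End.HasEigenvalue (Matrix.toLin' M) μ} Λ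

/-- The quartic form `∑_{ijkl} W_{ijkl} φ_i φ_j φ_k φ_l`. -/
def quarticForm {N : ℕ} (W : Tensor4 N) (φ : Fin N → ℝ) : ℝ :=
  ∑ i, ∑ j, ∑ k, ∑ l, W i j k l * φ i * φ j * φ k * φ l

/-- The sourced partition function with identity covariance,
`Z(u, J) = ∫ dφ exp (-½ ∑ φ_i² - (u / 4!) ∑ W_{ijkl} φ_i φ_j φ_k φ_l + ∑ J_i φ_i)`.
The integral converges absolutely for `0 ≤ Re u` when the quartic form is nonnegative. -/
def partitionFunction {N : ℕ} (W : Tensor4 N) (u : ℂ) (J : Fin N → ℝ) : ℂ :=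
  ∫ φ : Fin N → ℝ,
    Complex.exp (-(1 / 2) * ((∑ i, φ i ^ 2 : ℝ) : ℂ)
      - u / (Nat.factorial 4 : ℂ) * (quarticForm W φ : ℂ) + ((∑ i, J i * φ i : ℝ) : ℂ))

/-- The free energy with sources, `F(u, J) = ln Z(u, J)`. -/
def freeEnergy {N : ℕ} (W : Tensor4 N) (u : ℂ) (J : Fin N → ℝ) : ℂ :=
  Complex.log (partitionFunction W u J)

/-- The connected correlation function
`G_{i_1, …, i_n}(u) = ∂/∂J_{i_1} ⋯ ∂/∂J_{i_n} F(u, J)` at `J = 0`, the derivatives being taken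
with respect to the real sources. -/
def connectedCorrelation {N n : ℕ} (W : Tensor4 N) (idx : Fin n → Fin N) (u : ℂ) : ℂ :=
  iteratedFDeriv ℝ n (freeEnergy W u) 0 fun k => Pi.single (idx k) 1

/-- The cardioid `{ρ e^{iθ} : ρ ≤ r cos² (θ / 2)}`, with `θ ∈ (-π, π]`. -/
def cardioid (r : ℝ) : Set ℂ :=
  {u | ‖u‖ ≤ r * Real.cos (u.arg / 2) ^ 2}

/-- The disk `Re (1 / z) > 1 / R`, tangent to the imaginary axis at the origin. -/
def tangentDisk (R : ℝ) : Set ℂ := {z | R⁻¹ < (z⁻¹).re}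

/-- The points of the complex plane at distance less than `δ` from the half-line `[0, ∞)`. -/
def halfStrip (δ : ℝ) : Set ℂ :=
  {t | Metric.infDist t ((fun x : ℝ => (x : ℂ)) '' Set.Ici 0) < δ}

/-- Taylor expansion `∑ a_k z^k` of `f` at the origin with remainders of factorial type:
`f` is analytic in the disk `Re (1 / z) > 1 / R`, and in that disk
`|f z - ∑_{k < r} a_k z^k| ≤ K σ^r r! |z|^r` with `K` and `σ` independent of `r` (and `z`). -/
def HasFactorialExpansion (f : ℂ → ℂ) (a : ℕ → ℂ) (R K σ : ℝ) : Prop :=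
  AnalyticOnNhd ℂ f (tangentDisk R) ∧
    ∀ r : ℕ, ∀ z ∈ tangentDisk R,
      ‖f z - ∑ k ∈ Finset.range r, a k * z ^ k‖ ≤ K * σ ^ r * (Nat.factorial r : ℝ) * ‖z‖ ^ r

/-- The series `∑ a_k z^k` resums to `f` by the Borel method: the Borel transform
`B(t) = ∑ a_k t^k / k!` converges for `|t| < 1 / σ`, continues analytically to the
`1 / σ`-neighbourhood of `[0, ∞)` with `|B(t)| ≤ C e^{|t| / R}` there, and
`f(z) = (1 / z) ∫_0^∞ B(t) e^{-t / z} dt`, absolutely convergent, in the disk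
`Re (1 / z) > 1 / R`. -/
def IsBorelSum (f : ℂ → ℂ) (a : ℕ → ℂ) (R σ : ℝ) : Prop :=
  ∃ B : ℂ → ℂ,
    (∀ t : ℂ, ‖t‖ < σ⁻¹ → HasSum (fun k : ℕ => a k / (Nat.factorial k : ℂ) * t ^ k) (B t)) ∧
    AnalyticOnNhd ℂ B (halfStrip σ⁻¹) ∧
    (∃ C : ℝ, ∀ t ∈ halfStrip σ⁻¹, ‖B t‖ ≤ C * Real.exp (‖t‖ / R)) ∧
    ∀ z ∈ tangentDisk R,
      MeasureTheory.IntegrableOn (fun t : ℝ => B t * Complex.exp (-(t : ℂ) / z)) (Set.Ioi 0) ∧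
      f z = z⁻¹ * ∫ t in Set.Ioi (0 : ℝ), B t * Complex.exp (-(t : ℂ) / z)

/-- `f` is Borel summable at the origin: it has a Taylor expansion there that satisfies the
conditions of Nevanlinna in some disk `Re (1 / z) > 1 / R`, and `f` is the Borel sum of that
expansion. -/
def BorelSummable (f : ℂ → ℂ) : Prop :=
  ∃ (a : ℕ → ℂ) (R K σ : ℝ), 0 < R ∧ 0 < K ∧ 0 < σ ∧
    HasFactorialExpansion f a R K σ ∧ IsBorelSum f a R σ

end QuarticVector

end

/-!
# Analyticity in a cardioid and Borel summability of the quartic vector model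

The correlation functions `G` are polynomials in the moments of the model at vanishing source and in
the inverse of the partition function `Z(u)`: differentiating with respect to a source `J i` inserts
a field `φ i` in a moment (`iteratedFDeriv_freeEnergy`). Everything is therefore a statement about
moments, and about the zeros of `Z`.

*Analyticity.* The substitution `φ → (u / 3) ^ (-1 / 4) φ` moves the coupling from the quartic term
to the quadratic one, and so continues each moment to the slit plane (`continuedMoment_eq`). It
remains to see that the continued partition function has no zero in the cardioid. In the right
half-plane `Z(u)` is close to `Z(0)`, because the Gaussian expectation of the quartic form is at most
`3 N Λ₀` (`integral_quarticForm_le`). In the left half-plane the spectral decomposition of the pair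
matrix writes the quartic form as a sum of squares of quadratic forms `φ · B_s φ`, with symmetric
`B_s` (`exists_spectral_decomposition`). Linearising the squares by Gaussian variables `σ_s` and
integrating the field leaves the determinant of the random symmetric matrix `H = ∑ σ_s B_s`. Replacing
the determinant by the exponential of the trace of `H` costs a relative error that depends on `tr H²`
only (`norm_integral_quadratic_sub_le`). The main term is then an explicit Gaussian integral, larger
in modulus than the free value, and the error is expressed through `∑ tr B_s² = ∑ (tr B_s)²`, which is
at most `N Λ₀` (`norm_integral_sum_sq_sub_le`). In the cardioid the error is smaller than the main
term (`rotatedMoment_nil_ne_zero`).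

*Borel summability.* For `0 ≤ Re u` the moments have asymptotic expansions in `u` with remainders of
order `r! σ^r |u|^r`, uniformly (`hasGevreyExpansion_sourcedMoment`). Such expansions can be
multiplied, added and inverted, so `G` has one in a disk tangent to the imaginary axis. The theorem of
Nevanlinna and Sokal (`borelSummable_of_hasGevreyExpansion`) concludes. In its proof the derivatives
of the Borel transform are given on `[0, ∞)` by inverse Laplace transforms of rescaled remainders,
which bounds the `m`-th one by a multiple of `σ^m m! e^{ct}` (`isGevreyTower_borelTower`). Hence the
Taylor series at all points of the half-line converge in disks of a common radius, and they glue to the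
analytic extension (`IsGevreyTower.exists_extension`).
-/

noncomputable section

open Complex MeasureTheory Set

namespace QuarticVector

/-! ### Complex Gaussian integrals -/

/-- Changing the coefficient `a` of a one-dimensional complex Gaussian into `a - i l` multiplies the
integral by `exp (i l / (2 a))`, up to a factor whose logarithm is quadratically small in `l`. -/
lemma exists_gaussian_ratio {a : ℂ} (ha : 0 < a.re) (l : ℝ) :
    ∃ ρ : ℂ, ‖ρ‖ ≤ l ^ 2 / (4 * ‖a‖ * a.re) ∧
      (Real.pi / ((a - l * I) / 2)) ^ (1 / 2 : ℂ)
        = (Real.pi / (a / 2)) ^ (1 / 2 : ℂ) * exp (I * l / (2 * a) + ρ) := by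
  have hre : ∀ x : ℝ, (a - x * I).re = a.re := fun x => by simp
  have hne : ∀ x : ℝ, a - x * I ≠ 0 := fun x h => by
    have := hre x; rw [h] at this; simp at this; linarith
  have ha0 : a ≠ 0 := by simpa using hne 0
  have hnorm : ∀ x : ℝ, a.re ≤ ‖a - x * I‖ := fun x => by
    rw [← hre x]; exact re_le_norm _
  have hna : 0 < ‖a‖ := norm_pos_iff.2 ha0
  have hpow : ∀ x : ℝ, (Real.pi / ((a - x * I) / 2)) ^ (1 / 2 : ℂ)
      = exp (1 / 2 * Real.log (2 * Real.pi) - 1 / 2 * log (a - x * I)) := by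
    intro x
    have hw : (Real.pi / ((a - x * I) / 2) : ℂ) = ((2 * Real.pi : ℝ) : ℂ) * (a - x * I)⁻¹ := by
      push_cast; field_simp [hne x]
    rw [hw, cpow_def_of_ne_zero (mul_ne_zero (by exact_mod_cast (by positivity : (2 * Real.pi) ≠ 0))
      (inv_ne_zero (hne x))), log_ofReal_mul (by positivity) (inv_ne_zero (hne x)), log_inv]
    · congr 1; ring
    · intro h
      have := (arg_eq_pi_iff.1 h).1
      rw [hre] at this; linarith
  set r : ℝ → ℂ := fun t => -(1 / 2) * log (a - (t * l : ℝ) * I) + 1 / 2 * log a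
    - I * (t * l : ℝ) / (2 * a) with hr
  have hder : ∀ t : ℝ, HasDerivAt r (-(1 / 2) * (-(l * I) / (a - (t * l : ℝ) * I))
      - I * l / (2 * a)) t := by
    intro t
    have h1 : HasDerivAt (fun t : ℝ => ((t * l : ℝ) : ℂ)) (l : ℂ) t := by
      have := ((hasDerivAt_id t).mul_const l).ofReal_comp
      simpa using this
    have h2 : HasDerivAt (fun t : ℝ => a - (t * l : ℝ) * I) (-(l * I)) t := by
      simpa using (h1.mul_const I).const_sub a
    have h3 : HasDerivAt (fun t : ℝ => log (a - (t * l : ℝ) * I))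
        (-(l * I) / (a - (t * l : ℝ) * I)) t :=
      h2.clog_real (Or.inl (by rw [hre]; exact ha))
    have h4 := ((h3.const_mul (-(1 / 2) : ℂ)).add_const (1 / 2 * log a)).sub
      ((h1.const_mul I).div_const (2 * a))
    exact h4
  refine ⟨r 1, ?_, ?_⟩
  · have key := image_norm_le_of_norm_deriv_right_le_deriv_boundary (f := r) (a := 0) (b := 1)
      (f' := fun t => -(1 / 2) * (-(l * I) / (a - (t * l : ℝ) * I)) - I * l / (2 * a))
      (B := fun t => l ^ 2 / (4 * ‖a‖ * a.re) * t ^ 2)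
      (B' := fun t => l ^ 2 / (4 * ‖a‖ * a.re) * (2 * t))
      (fun t _ => (hder t).continuousAt.continuousWithinAt)
      (fun t _ => (hder t).hasDerivWithinAt) (by simp [hr])
      (fun t => by simpa using (hasDerivAt_pow 2 t).const_mul (l ^ 2 / (4 * ‖a‖ * a.re)))
      (fun t ht => by
        have e : -(1 / 2) * (-(l * I) / (a - (t * l : ℝ) * I)) - I * l / (2 * a)
            = -(l ^ 2 * t) / (2 * a * (a - (t * l : ℝ) * I)) := by
          have hw := hne (t * l)
          obtain ⟨w, hwd⟩ : ∃ w, w = a - (t * l : ℝ) * I := ⟨_, rfl⟩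
          rw [← hwd] at hw ⊢
          field_simp
          rw [hwd]
          push_cast
          linear_combination (l ^ 2 * t : ℂ) * I_sq
        rw [e, norm_div, norm_neg, norm_mul, norm_mul, norm_mul, norm_pow]
        simp only [Complex.norm_real, Complex.norm_ofNat, Real.norm_eq_abs, sq_abs,
          abs_of_nonneg ht.1]
        calc l ^ 2 * t / (2 * ‖a‖ * ‖a - (t * l : ℝ) * I‖) ≤ l ^ 2 * t / (2 * ‖a‖ * a.re) := by
              have := ht.1
              gcongr
              exact hnorm _
          _ = _ := by field_simp; ring)
      (x := 1) (by simp)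
    simpa using key
  · rw [hpow l]
    have h0 := hpow 0
    simp only [ofReal_zero, zero_mul, sub_zero] at h0
    rw [h0, ← exp_add]
    congr 1
    simp only [hr, one_mul]
    ring

lemma norm_exp_sub_one_le_exp_norm_sub_one (z : ℂ) : ‖exp z - 1‖ ≤ Real.exp ‖z‖ - 1 := by
  simpa using norm_exp_sub_sum_le_exp_norm_sub_sum z 1

/-- A complex Gaussian integral perturbed by an oscillating quadratic form `H` is that of the trace
of `H`, up to a relative error governed by the Hilbert–Schmidt norm of `H` alone. -/
lemma norm_integral_quadratic_sub_le {ι : Type*} [Fintype ι] [DecidableEq ι]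
    {H : Matrix ι ι ℝ} (hH : H.IsHermitian) {a : ℂ} (ha : 0 < a.re) :
    ‖(∫ φ : ι → ℝ, exp (-(a / 2) * ∑ i, (φ i : ℂ) ^ 2
          + I / 2 * ((φ ⬝ᵥ H.mulVec φ : ℝ) : ℂ)))
        - ((Real.pi / (a / 2)) ^ (1 / 2 : ℂ)) ^ Fintype.card ι * exp (I * H.trace / (2 * a))‖
      ≤ ‖((Real.pi / (a / 2)) ^ (1 / 2 : ℂ)) ^ Fintype.card ι * exp (I * H.trace / (2 * a))‖
        * (Real.exp ((H * H).trace / (4 * ‖a‖ * a.re)) - 1) := by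
  classical
  set U : Matrix ι ι ℝ := hH.eigenvectorUnitary.1 with hU
  set l := hH.eigenvalues with hl
  have hUU : U.transpose * U = 1 := by
    have := Unitary.coe_star_mul_self hH.eigenvectorUnitary
    rwa [Matrix.star_eq_conjTranspose, Matrix.conjTranspose_eq_transpose_of_trivial] at this
  have hD : U.transpose * H * U = Matrix.diagonal l := by
    have := hH.conjStarAlgAut_star_eigenvectorUnitary
    rw [Unitary.conjStarAlgAut_star_apply, Matrix.star_eq_conjTranspose,
      Matrix.conjTranspose_eq_transpose_of_trivial] at this
    exact this
  have hUU' : U * U.transpose = 1 := mul_eq_one_comm.1 hUU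
  have htr : H.trace = ∑ i, l i := by
    have := hH.trace_eq_sum_eigenvalues
    simpa using this
  have htr2 : (H * H).trace = ∑ i, l i ^ 2 := by
    have h1 : (Matrix.diagonal l * Matrix.diagonal l).trace = (H * H).trace := by
      rw [← hD, show U.transpose * H * U * (U.transpose * H * U)
        = U.transpose * (H * (U * U.transpose) * H * U) by simp only [Matrix.mul_assoc],
        Matrix.trace_mul_comm, hUU', Matrix.mul_one, Matrix.mul_assoc, hUU', Matrix.mul_one]
    rw [← h1, Matrix.diagonal_mul_diagonal, Matrix.trace_diagonal]
    simp [sq]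
  have hdet : |U.det| = 1 := by
    have : U.det * U.det = 1 := by
      have := congrArg Matrix.det hUU
      rwa [Matrix.det_mul, Matrix.det_transpose, Matrix.det_one] at this
    have h2 : |U.det| * |U.det| = 1 := by rw [← abs_mul, this, abs_one]
    nlinarith [abs_nonneg U.det]
  have hdet0 : U.det ≠ 0 := by
    intro h; rw [h] at hdet; simp at hdet
  have hmap : Measure.map (Matrix.toLin' U) (volume : Measure (ι → ℝ)) = volume := by
    rw [Real.map_matrix_volume_pi_eq_smul_volume_pi hdet0, abs_inv, hdet]
    simp
  have hint : (∫ φ : ι → ℝ, exp (-(a / 2) * ∑ i, (φ i : ℂ) ^ 2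
          + I / 2 * ((φ ⬝ᵥ H.mulVec φ : ℝ) : ℂ)))
      = ∏ i, (Real.pi / ((a - l i * I) / 2)) ^ (1 / 2 : ℂ) := by
    have hb : ∀ i, 0 < ((a - l i * I) / 2).re := by
      intro i
      simpa using ha
    have h1 := GaussianFourier.integral_cexp_neg_sum_mul_add hb (fun _ => 0)
    simp only [zero_mul, Finset.sum_const_zero, add_zero, ne_eq, OfNat.ofNat_ne_zero,
      not_false_eq_true, zero_pow, zero_div, exp_zero, mul_one] at h1
    rw [← h1]
    conv_lhs => rw [← hmap]
    rw [integral_map (LinearMap.continuous_of_finiteDimensional _).aemeasurable]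
    · congr 1
      ext ψ
      congr 1
      rw [Matrix.toLin'_apply]
      have e1 : ∑ i, ((U.mulVec ψ) i : ℂ) ^ 2 = ∑ i, (ψ i : ℂ) ^ 2 := by
        have : (U.mulVec ψ) ⬝ᵥ (U.mulVec ψ) = ψ ⬝ᵥ ψ := by
          rw [Matrix.dotProduct_mulVec, Matrix.vecMul_mulVec, hUU, Matrix.vecMul_one]
        simp only [dotProduct, ← sq] at this
        exact_mod_cast this
      have e2 : (U.mulVec ψ) ⬝ᵥ H.mulVec (U.mulVec ψ) = ∑ i, l i * ψ i ^ 2 := by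
        rw [Matrix.dotProduct_mulVec, Matrix.dotProduct_mulVec, Matrix.vecMul_vecMul,
          Matrix.vecMul_mulVec, ← Matrix.dotProduct_mulVec, ← Matrix.mul_assoc, hD]
        simp only [dotProduct, Matrix.mulVec_diagonal]
        exact Finset.sum_congr rfl fun i _ => by ring
      rw [e1, e2]
      push_cast
      rw [Finset.mul_sum, Finset.mul_sum, ← Finset.sum_neg_distrib, ← Finset.sum_add_distrib]
      exact Finset.sum_congr rfl fun i _ => by ring
    · refine Continuous.aestronglyMeasurable ?_
      unfold dotProduct Matrix.mulVec dotProduct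
      fun_prop
  choose ρ hρ hρ' using fun i => exists_gaussian_ratio ha (l i)
  have hprod : ∏ i, (Real.pi / ((a - l i * I) / 2)) ^ (1 / 2 : ℂ)
      = ((Real.pi / (a / 2)) ^ (1 / 2 : ℂ)) ^ Fintype.card ι * exp (I * H.trace / (2 * a))
        * exp (∑ i, ρ i) := by
    simp_rw [hρ']
    rw [Finset.prod_mul_distrib, Finset.prod_const, Finset.card_univ, ← exp_sum,
      Finset.sum_add_distrib, exp_add, ← mul_assoc]
    congr 3
    rw [htr]; push_cast; rw [Finset.mul_sum, Finset.sum_div]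
  rw [hint, hprod, ← mul_sub_one, norm_mul]
  gcongr
  refine (norm_exp_sub_one_le_exp_norm_sub_one _).trans ?_
  gcongr
  rw [htr2, Finset.sum_div]
  exact (norm_sum_le _ _).trans (Finset.sum_le_sum fun i _ => hρ i)

lemma one_sub_sum_le_prod {ι : Type*} (s : Finset ι) {x : ι → ℝ} (h0 : ∀ i, 0 ≤ x i)
    (h1 : ∀ i, x i ≤ 1) : 1 - ∑ i ∈ s, x i ≤ ∏ i ∈ s, (1 - x i) := by
  classical
  induction s using Finset.induction_on with
  | empty => simp
  | insert a s ha ih =>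
    rw [Finset.sum_insert ha, Finset.prod_insert ha]
    have hs : 0 ≤ ∑ i ∈ s, x i := Finset.sum_nonneg fun i _ => h0 i
    nlinarith [h0 a, h1 a]

lemma sqrt_eq_cpow_half {x : ℝ} (hx : 0 ≤ x) : ((Real.sqrt x : ℝ) : ℂ) = (x : ℂ) ^ (1 / 2 : ℂ) := by
  rw [Real.sqrt_eq_rpow, ofReal_cpow hx]; norm_num

lemma integral_gaussian_mul_exp_linear {ι : Type*} [Fintype ι] (c : ι → ℂ) :
    Integrable (fun v : ι → ℝ => exp (-(1 / 2) * ∑ i, (v i : ℂ) ^ 2 + ∑ i, c i * v i)) ∧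
    ∫ v : ι → ℝ, exp (-(1 / 2) * ∑ i, (v i : ℂ) ^ 2 + ∑ i, c i * v i)
      = ((Real.sqrt (2 * Real.pi) ^ Fintype.card ι : ℝ) : ℂ) * exp ((∑ i, c i ^ 2) / 2) := by
  have hb : 0 < (1 / 2 : ℂ).re := by norm_num
  refine ⟨GaussianFourier.integrable_cexp_neg_mul_sum_add hb c, ?_⟩
  rw [GaussianFourier.integral_cexp_neg_mul_sum_add hb c]
  push_cast
  rw [sqrt_eq_cpow_half (by positivity), ← cpow_nat_mul]
  congr 2
  · push_cast; ring
  · ring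
  · ring

lemma integral_rexp_quadratic {ι : Type*} [Fintype ι] {b : ι → ℝ} (hb : ∀ i, 0 < b i) (c : ι → ℝ) :
    Integrable (fun v : ι → ℝ => Real.exp (-∑ i, b i * v i ^ 2 + ∑ i, c i * v i)) ∧
    ∫ v : ι → ℝ, Real.exp (-∑ i, b i * v i ^ 2 + ∑ i, c i * v i)
      = ∏ i, Real.sqrt (Real.pi / b i) * Real.exp (c i ^ 2 / (4 * b i)) := by
  have hb' : ∀ i, 0 < ((b i : ℂ)).re := fun i => by simpa using hb i
  have h1 := GaussianFourier.integrable_cexp_neg_sum_mul_add hb' (fun i => (c i : ℂ))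
  have h2 := GaussianFourier.integral_cexp_neg_sum_mul_add hb' (fun i => (c i : ℂ))
  have e : ∀ v : ι → ℝ, exp (-∑ i, (b i : ℂ) * (v i : ℂ) ^ 2 + ∑ i, (c i : ℂ) * v i)
      = ((Real.exp (-∑ i, b i * v i ^ 2 + ∑ i, c i * v i) : ℝ) : ℂ) := fun v => by push_cast; rfl
  simp_rw [e] at h1 h2
  refine ⟨h1.re.congr (ae_of_all _ fun v => by
    simp only [RCLike.re_to_complex, ofReal_re]), ?_⟩
  rw [integral_complex_ofReal] at h2
  apply ofReal_injective
  rw [h2]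
  push_cast
  refine Finset.prod_congr rfl fun i _ => ?_
  rw [sqrt_eq_cpow_half (div_nonneg Real.pi_pos.le (hb i).le)]
  push_cast; rfl

/-- Expectation of `exp (η ∑ tᵢ vᵢ) (exp (β ∑ μᵢ vᵢ²) - 1)` under independent standard Gaussians,
bounded in terms of `T = ∑ μᵢ = ∑ tᵢ²` only. The weight is not normalised. -/
lemma integral_gaussian_tilted_le {ι : Type*} [Fintype ι] {μ t : ι → ℝ} {T β η : ℝ}
    (hμ : ∀ i, 0 ≤ μ i) (hT : ∑ i, μ i = T) (hT' : ∑ i, t i ^ 2 = T) (hβ : 0 ≤ β)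
    (hβT : 2 * β * T < 1) :
    Integrable (fun v : ι → ℝ => Real.exp (-(1 / 2) * ∑ i, v i ^ 2 + η * ∑ i, v i * t i)
      * (Real.exp (β * ∑ i, μ i * v i ^ 2) - 1)) ∧
    ∫ v : ι → ℝ, Real.exp (-(1 / 2) * ∑ i, v i ^ 2 + η * ∑ i, v i * t i)
      * (Real.exp (β * ∑ i, μ i * v i ^ 2) - 1)
    ≤ Real.sqrt (2 * Real.pi) ^ Fintype.card ι
      * (Real.exp (η ^ 2 * T / 2 / (1 - 2 * β * T)) / Real.sqrt (1 - 2 * β * T)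
        - Real.exp (η ^ 2 * T / 2)) := by
  have hμT : ∀ i, μ i ≤ T := fun i => by
    rw [← hT]; exact Finset.single_le_sum (fun j _ => hμ j) (Finset.mem_univ i)
  have hx : ∀ i, 2 * β * μ i ≤ 2 * β * T := fun i => by gcongr; exact hμT i
  have hpos : ∀ i, 0 < 1 / 2 - β * μ i := fun i => by nlinarith [hx i]
  obtain ⟨i1, e1⟩ := integral_rexp_quadratic hpos (fun i => η * t i)
  obtain ⟨i2, e2⟩ := integral_rexp_quadratic (b := fun _ : ι => (1 / 2 : ℝ)) (by norm_num)
    (fun i => η * t i)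
  have hfun : (fun v : ι → ℝ => Real.exp (-(1 / 2) * ∑ i, v i ^ 2 + η * ∑ i, v i * t i)
      * (Real.exp (β * ∑ i, μ i * v i ^ 2) - 1))
      = fun v => Real.exp (-∑ i, (1 / 2 - β * μ i) * v i ^ 2 + ∑ i, η * t i * v i)
        - Real.exp (-∑ i, 1 / 2 * v i ^ 2 + ∑ i, η * t i * v i) := by
    ext v
    rw [mul_sub_one, ← Real.exp_add]
    congr 2
    · simp only [Finset.mul_sum, ← Finset.sum_neg_distrib, ← Finset.sum_add_distrib]
      exact Finset.sum_congr rfl fun i _ => by ring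
    · simp only [Finset.mul_sum, ← Finset.sum_neg_distrib, ← Finset.sum_add_distrib]
      exact Finset.sum_congr rfl fun i _ => by ring
  rw [hfun]
  refine ⟨i1.sub i2, ?_⟩
  rw [integral_sub i1 i2, e1, e2, mul_sub]
  have hsq : ∀ i, Real.sqrt (Real.pi / (1 / 2 - β * μ i))
      = Real.sqrt (2 * Real.pi) * (Real.sqrt (1 - 2 * β * μ i))⁻¹ := by
    intro i
    rw [← Real.sqrt_inv, ← Real.sqrt_mul (by positivity)]
    congr 1
    have := hpos i
    have h' : 1 - 2 * β * μ i ≠ 0 := by nlinarith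
    field_simp
  have l1 : ∏ i, Real.sqrt (Real.pi / (1 / 2 - β * μ i))
        * Real.exp ((η * t i) ^ 2 / (4 * (1 / 2 - β * μ i)))
      = Real.sqrt (2 * Real.pi) ^ Fintype.card ι
        * ((∏ i, (Real.sqrt (1 - 2 * β * μ i))⁻¹)
          * Real.exp (∑ i, (η * t i) ^ 2 / (4 * (1 / 2 - β * μ i)))) := by
    simp_rw [hsq]
    rw [Finset.prod_mul_distrib, Finset.prod_mul_distrib, Finset.prod_const, Finset.card_univ,
      ← Real.exp_sum, mul_assoc]
  have l2 : ∏ i, Real.sqrt (Real.pi / (1 / 2)) * Real.exp ((η * t i) ^ 2 / (4 * (1 / 2)))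
      = Real.sqrt (2 * Real.pi) ^ Fintype.card ι * Real.exp (η ^ 2 * T / 2) := by
    rw [Finset.prod_mul_distrib, Finset.prod_const, Finset.card_univ, ← Real.exp_sum]
    congr 2
    · norm_num [mul_comm]
    · rw [← hT', Finset.mul_sum, Finset.sum_div]
      exact Finset.sum_congr rfl fun i _ => by ring
  rw [l1, l2]
  refine sub_le_sub_right ?_ _
  have h1 : 1 - 2 * β * T ≤ ∏ i, (1 - 2 * β * μ i) := by
    have := one_sub_sum_le_prod Finset.univ (x := fun i => 2 * β * μ i)
      (fun i => mul_nonneg (by positivity) (hμ i)) (fun i => (hx i).trans hβT.le)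
    rwa [← Finset.mul_sum, hT] at this
  have h2 : ∏ i, (Real.sqrt (1 - 2 * β * μ i))⁻¹ ≤ (Real.sqrt (1 - 2 * β * T))⁻¹ := by
    rw [Finset.prod_inv_distrib, ← Real.sqrt_prod _ (fun i _ => by linarith [hx i])]
    exact inv_anti₀ (Real.sqrt_pos.2 (by linarith)) (Real.sqrt_le_sqrt h1)
  have h3 : ∑ i, (η * t i) ^ 2 / (4 * (1 / 2 - β * μ i)) ≤ η ^ 2 * T / 2 / (1 - 2 * β * T) := by
    rw [← hT']
    rw [Finset.mul_sum, Finset.sum_div, Finset.sum_div, hT']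
    refine Finset.sum_le_sum fun i _ => ?_
    rw [mul_pow, div_div]
    apply div_le_div_of_nonneg_left (by positivity) (by linarith)
    nlinarith [hx i]
  refine mul_le_mul_of_nonneg_left ?_ (by positivity)
  rw [div_eq_inv_mul (Real.exp _)]
  gcongr

/-! ### The Hubbard–Stratonovich estimate -/

/-- Hubbard–Stratonovich estimate. For a quartic form written as a sum of squares of quadratic forms
`B s`, orthogonal in the trace inner product, the Gaussian integral is linearised by independent
Gaussian variables `σ s`; integrating the field first gives the determinant of a random symmetric
matrix, which is compared with the exponential of its trace. The error depends only on
`T = ∑ μ s = ∑ (tr B s) ^ 2`, not on the dimension. -/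
theorem norm_integral_sum_sq_sub_le {N : ℕ} {ι : Type*} [Fintype ι] [DecidableEq ι]
    {B : ι → Matrix (Fin N) (Fin N) ℝ} {μ : ι → ℝ} {T : ℝ} (hB : ∀ s, (B s).IsHermitian)
    (hμ : ∀ s, 0 ≤ μ s) (hBB : ∀ s t, (B s * B t).trace = if s = t then μ s else 0)
    (hT : ∑ s, μ s = T) (hT' : ∑ s, (B s).trace ^ 2 = T) {a : ℂ} (ha : 0 < a.re)
    (hx : T / (2 * ‖a‖ * a.re) < 1) :
    ‖(∫ φ : Fin N → ℝ, exp (-(a / 2) * ∑ i, (φ i : ℂ) ^ 2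
          - ((∑ s, (φ ⬝ᵥ (B s).mulVec φ) ^ 2 : ℝ) : ℂ) / 8))
        - ((Real.pi / (a / 2)) ^ (1 / 2 : ℂ)) ^ N * exp (-T / (8 * a ^ 2))‖
      ≤ ‖((Real.pi / (a / 2)) ^ (1 / 2 : ℂ)) ^ N‖
        * (Real.exp (T * a.im ^ 2 / (8 * ‖a‖ ^ 4) / (1 - T / (2 * ‖a‖ * a.re)))
              / Real.sqrt (1 - T / (2 * ‖a‖ * a.re))
            - Real.exp (T * a.im ^ 2 / (8 * ‖a‖ ^ 4))) := by
  have ha0 : a ≠ 0 := fun h => by rw [h] at ha; simp at ha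
  have hna : 0 < ‖a‖ := norm_pos_iff.2 ha0
  set I0 : ℂ := ((Real.pi / (a / 2)) ^ (1 / 2 : ℂ)) ^ N with hI0
  set K : ℝ := Real.sqrt (2 * Real.pi) ^ Fintype.card ι with hK
  have hKpos : 0 < K := by positivity
  set q : ι → (Fin N → ℝ) → ℝ := fun s φ => φ ⬝ᵥ (B s).mulVec φ with hq
  have hqc : ∀ s, Continuous (q s) := fun s => by
    simp only [hq]; unfold dotProduct Matrix.mulVec dotProduct; fun_prop
  set P : ℂ := ∫ φ : Fin N → ℝ, exp (-(a / 2) * ∑ i, (φ i : ℂ) ^ 2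
          - ((∑ s, (q s φ) ^ 2 : ℝ) : ℂ) / 8) with hP
  -- the random symmetric matrix
  set H : (ι → ℝ) → Matrix (Fin N) (Fin N) ℝ := fun σ => ∑ s, σ s • B s with hH
  have hHH : ∀ σ, (H σ).IsHermitian := fun σ => by
    simp only [hH, Matrix.IsHermitian, Matrix.conjTranspose_sum, Matrix.conjTranspose_smul]
    exact Finset.sum_congr rfl fun s _ => by rw [(hB s).eq]; simp
  have hHq : ∀ σ φ, φ ⬝ᵥ (H σ).mulVec φ = ∑ s, σ s * q s φ := fun σ φ => by
    simp only [hH, hq, Matrix.sum_mulVec, dotProduct_sum, Matrix.smul_mulVec, dotProduct_smul,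
      smul_eq_mul]
  have hHt : ∀ σ, (H σ).trace = ∑ s, σ s * (B s).trace := fun σ => by
    simp only [hH, Matrix.trace_sum, Matrix.trace_smul, smul_eq_mul]
  have hHt2 : ∀ σ, (H σ * H σ).trace = ∑ s, μ s * σ s ^ 2 := fun σ => by
    simp only [hH, Finset.sum_mul, Finset.mul_sum, Matrix.trace_sum, Matrix.smul_mul,
      Matrix.mul_smul, Matrix.trace_smul, smul_eq_mul, hBB]
    refine Finset.sum_congr rfl fun s _ => ?_
    simp
    ring
  -- `β` is the rate of the error in `tr (H σ)²`, `η` that of the growth of the main term in `tr (H σ)`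
  set β : ℝ := 1 / (4 * ‖a‖ * a.re) with hβ
  set η : ℝ := a.im / (2 * ‖a‖ ^ 2) with hη
  have hβT : 2 * β * T = T / (2 * ‖a‖ * a.re) := by rw [hβ]; field_simp; ring
  have hηT : η ^ 2 * T / 2 = T * a.im ^ 2 / (8 * ‖a‖ ^ 4) := by rw [hη]; field_simp; ring
  rw [← hβT, ← hηT]
  rw [← hβT] at hx
  obtain ⟨hint, hle⟩ := integral_gaussian_tilted_le hμ hT hT' (β := β) (η := η) (by positivity) hx
  -- the joint integrand and its two partial integrals
  set F : (ι → ℝ) → (Fin N → ℝ) → ℂ := fun σ φ => exp (-(1 / 2) * ∑ s, (σ s : ℂ) ^ 2)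
    * exp (-(a / 2) * ∑ i, (φ i : ℂ) ^ 2 + I / 2 * ((φ ⬝ᵥ (H σ).mulVec φ : ℝ) : ℂ)) with hF
  have hFint : Integrable (Function.uncurry F) (volume.prod volume) := by
    have h1 := (integral_gaussian_mul_exp_linear (ι := ι) (fun _ => 0)).1.norm
    have h2 := (GaussianFourier.integrable_cexp_neg_mul_sum_add (ι := Fin N)
      (b := a / 2) (by simpa using ha) (fun _ => 0)).norm
    refine (h1.mul_prod h2).mono' ?_ (ae_of_all _ fun z => ?_)
    · refine Continuous.aestronglyMeasurable ?_
      simp only [hF, Function.uncurry_def, hHq]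
      have := fun s => (hqc s).comp (continuous_snd (X := ι → ℝ))
      simp only [Function.comp_def] at this
      fun_prop
    · simp only [Function.uncurry_def, hF, norm_mul, zero_mul, Finset.sum_const_zero, add_zero]
      rw [exp_add, norm_mul]
      refine le_of_eq ?_
      rw [show I / 2 * ((z.2 ⬝ᵥ (H z.1).mulVec z.2 : ℝ) : ℂ)
        = ((z.2 ⬝ᵥ (H z.1).mulVec z.2 / 2 : ℝ) : ℂ) * I by push_cast; ring,
        norm_exp_ofReal_mul_I, mul_one]
  -- integrating out `σ` first restores the quartic weight
  have hswap : ∫ σ, ∫ φ, F σ φ = K * P := by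
    rw [integral_integral_swap hFint, hP, ← integral_const_mul]
    congr 1; ext φ
    have h1 := (integral_gaussian_mul_exp_linear (ι := ι) (fun s => I * q s φ / 2)).2
    have h2 : ∀ σ : ι → ℝ, F σ φ = exp (-(a / 2) * ∑ i, (φ i : ℂ) ^ 2)
        * exp (-(1 / 2) * ∑ s, (σ s : ℂ) ^ 2 + ∑ s, I * q s φ / 2 * σ s) := fun σ => by
      simp only [hF, hHq]
      rw [← exp_add, ← exp_add]
      congr 1
      push_cast
      rw [show ∑ s, I * (q s φ : ℂ) / 2 * (σ s : ℂ) = I / 2 * ∑ s, (σ s : ℂ) * (q s φ : ℂ) by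
        rw [Finset.mul_sum]; exact Finset.sum_congr rfl fun s _ => by ring]
      ring
    simp_rw [h2]
    rw [integral_const_mul, h1, mul_left_comm, ← exp_add]
    congr 2
    push_cast
    rw [sub_eq_add_neg, Finset.sum_div, Finset.sum_div, ← Finset.sum_neg_distrib]
    congr 1
    exact Finset.sum_congr rfl fun s _ => by linear_combination ((q s φ : ℂ) ^ 2 / 8) * I_sq
  -- with each determinant replaced by the exponential of its trace, a Gaussian integral in `σ` is left
  set G : (ι → ℝ) → ℂ := fun σ => exp (-(1 / 2) * ∑ s, (σ s : ℂ) ^ 2)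
    * (I0 * exp (I * (H σ).trace / (2 * a))) with hG
  have hGe : ∀ σ, G σ = I0 * exp (-(1 / 2) * ∑ s, (σ s : ℂ) ^ 2
      + ∑ s, I * (B s).trace / (2 * a) * σ s) := fun σ => by
    simp only [hG, hHt]
    rw [exp_add, mul_left_comm]
    congr 3
    push_cast
    rw [Finset.mul_sum, Finset.sum_div]
    exact Finset.sum_congr rfl fun s _ => by ring
  obtain ⟨g1, g2⟩ := integral_gaussian_mul_exp_linear (ι := ι)
    (fun s => I * (B s).trace / (2 * a))
  have hGint : Integrable G := by
    rw [show G = _ from funext hGe]; exact g1.const_mul I0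
  have hGval : ∫ σ, G σ = K * (I0 * exp (-T / (8 * a ^ 2))) := by
    simp_rw [hGe]
    rw [integral_const_mul, g2, mul_left_comm]
    congr 3
    rw [← hT']
    push_cast
    rw [← Finset.sum_neg_distrib, Finset.sum_div, Finset.sum_div]
    refine Finset.sum_congr rfl fun s _ => ?_
    field_simp
    rw [I_sq]; ring
  have hpt : ∀ σ, ‖(∫ φ, F σ φ) - G σ‖ ≤ ‖I0‖
      * (Real.exp (-(1 / 2) * ∑ i, σ i ^ 2 + η * ∑ i, σ i * (B i).trace)
      * (Real.exp (β * ∑ i, μ i * σ i ^ 2) - 1)) := by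
    intro σ
    simp only [hF, hG]
    rw [integral_const_mul, ← mul_sub, norm_mul]
    have h1 := norm_integral_quadratic_sub_le (hHH σ) ha
    rw [Fintype.card_fin, ← hI0, hHt2] at h1
    refine (mul_le_mul_of_nonneg_left h1 (norm_nonneg _)).trans (le_of_eq ?_)
    rw [norm_mul, norm_exp, norm_exp]
    have e1 : (-(1 / 2) * ∑ s, (σ s : ℂ) ^ 2).re = -(1 / 2) * ∑ i, σ i ^ 2 := by
      rw [show (-(1 / 2) * ∑ s, (σ s : ℂ) ^ 2) = ((-(1 / 2) * ∑ i, σ i ^ 2 : ℝ) : ℂ) by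
        push_cast; rfl, ofReal_re]
    have e2 : (I * ((H σ).trace : ℂ) / (2 * a)).re = η * ∑ i, σ i * (B i).trace := by
      rw [← hHt, hη, ← normSq_eq_norm_sq, show I * ((H σ).trace : ℂ) / (2 * a)
        = (((H σ).trace / 2 : ℝ) : ℂ) * (I / a) by push_cast; field_simp, re_ofReal_mul, div_re]
      simp
      ring
    rw [e1, e2, Real.exp_add, show (∑ i, μ i * σ i ^ 2) / (4 * ‖a‖ * a.re)
      = β * ∑ i, μ i * σ i ^ 2 by rw [hβ]; ring]
    ring
  have hmain : ‖(K : ℂ) * P - K * (I0 * exp (-T / (8 * a ^ 2)))‖ ≤ ‖I0‖ * (K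
      * (Real.exp (η ^ 2 * T / 2 / (1 - 2 * β * T)) / Real.sqrt (1 - 2 * β * T)
        - Real.exp (η ^ 2 * T / 2))) := by
    have hFl : Integrable (fun σ => ∫ φ, F σ φ) := hFint.integral_prod_left
    rw [← hswap, ← hGval, ← integral_sub hFl hGint]
    refine (norm_integral_le_of_norm_le (hint.const_mul _) (ae_of_all _ hpt)).trans ?_
    rw [integral_const_mul]
    gcongr
  rw [← mul_sub, norm_mul, norm_real, Real.norm_of_nonneg hKpos.le, mul_left_comm] at hmain
  exact le_of_mul_le_mul_left hmain hKpos

/-! ### Integrability of field monomials -/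

lemma integrable_gaussian_mul_exp_abs {ι : Type*} [Fintype ι] {a : ℝ} (ha : 0 < a) (k : ℝ) :
    Integrable fun φ : ι → ℝ => Real.exp (-a * ∑ i, φ i ^ 2 + k * ∑ i, |φ i|) := by
  have h1 : Integrable fun x : ℝ => Real.exp (-a * x ^ 2 + k * |x|) := by
    have h2 := (integrable_exp_neg_mul_sq (b := a / 2) (by positivity)).const_mul
      (Real.exp (k ^ 2 / (2 * a)))
    refine h2.mono' (by fun_prop) (ae_of_all _ fun x => ?_)
    rw [Real.norm_of_nonneg (Real.exp_pos _).le, ← Real.exp_add]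
    apply Real.exp_le_exp.2
    rw [← sq_abs x]
    have : k ^ 2 / (2 * a) + -(a / 2) * |x| ^ 2 - (-a * |x| ^ 2 + k * |x|)
        = (a * |x| - k) ^ 2 / (2 * a) := by field_simp; ring
    have h3 : 0 ≤ (a * |x| - k) ^ 2 / (2 * a) := by positivity
    linarith
  have h4 := Integrable.fintype_prod (ι := ι) (f := fun _ x => Real.exp (-a * x ^ 2 + k * |x|))
    (μ := fun _ => volume) (fun _ => h1)
  refine h4.congr (ae_of_all _ fun φ => ?_)
  simp only [← Real.exp_sum]
  rw [Finset.sum_add_distrib, Finset.mul_sum, Finset.mul_sum]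

/-- The `ℓ¹` norm of the field. -/
def absSum {N : ℕ} (φ : Fin N → ℝ) : ℝ := ∑ i, |φ i|

lemma abs_le_absSum {N : ℕ} (φ : Fin N → ℝ) (i : Fin N) : |φ i| ≤ absSum φ :=
  Finset.single_le_sum (f := fun i => |φ i|) (fun _ _ => abs_nonneg _) (Finset.mem_univ i)

@[fun_prop]
lemma continuous_absSum {N : ℕ} : Continuous (absSum (N := N)) := by
  unfold absSum; fun_prop

@[fun_prop]
lemma continuous_quarticForm {N : ℕ} (W : Tensor4 N) : Continuous (quarticForm W) := by
  unfold quarticForm; fun_prop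

/-- The `ℓ¹` norm of the tensor. -/
def tensorNorm {N : ℕ} (W : Tensor4 N) : ℝ := ∑ i, ∑ j, ∑ k, ∑ l, |W i j k l|

lemma tensorNorm_nonneg {N : ℕ} (W : Tensor4 N) : 0 ≤ tensorNorm W := by
  unfold tensorNorm; positivity

lemma abs_quarticForm_le {N : ℕ} (W : Tensor4 N) (φ : Fin N → ℝ) :
    |quarticForm W φ| ≤ tensorNorm W * (∑ i, φ i ^ 2) ^ 2 := by
  have hs : ∀ i, |φ i| ≤ Real.sqrt (∑ i, φ i ^ 2) := fun i => by
    rw [← Real.sqrt_sq_eq_abs]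
    exact Real.sqrt_le_sqrt (Finset.single_le_sum (f := fun i => φ i ^ 2)
      (fun _ _ => sq_nonneg _) (Finset.mem_univ i))
  have h4 : (∑ i, φ i ^ 2) ^ 2 = Real.sqrt (∑ i, φ i ^ 2) ^ 4 := by
    rw [show 4 = 2 * 2 from rfl, pow_mul, Real.sq_sqrt (Finset.sum_nonneg fun _ _ => sq_nonneg _)]
  unfold quarticForm tensorNorm
  rw [h4]
  simp only [Finset.sum_mul]
  refine (Finset.abs_sum_le_sum_abs _ _).trans (Finset.sum_le_sum fun i _ => ?_)
  refine (Finset.abs_sum_le_sum_abs _ _).trans (Finset.sum_le_sum fun j _ => ?_)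
  refine (Finset.abs_sum_le_sum_abs _ _).trans (Finset.sum_le_sum fun k _ => ?_)
  refine (Finset.abs_sum_le_sum_abs _ _).trans (Finset.sum_le_sum fun l _ => ?_)
  rw [abs_mul, abs_mul, abs_mul, abs_mul, mul_assoc, mul_assoc, mul_assoc]
  refine mul_le_mul_of_nonneg_left ?_ (abs_nonneg _)
  rw [show Real.sqrt (∑ i, φ i ^ 2) ^ 4 = Real.sqrt (∑ i, φ i ^ 2) * (Real.sqrt (∑ i, φ i ^ 2)
    * (Real.sqrt (∑ i, φ i ^ 2) * Real.sqrt (∑ i, φ i ^ 2))) by ring]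
  gcongr <;> exact hs _

/-- A monomial in the fields, the product of `φ i` over the list of flavours `l`. -/
def fieldMonomial {N : ℕ} (l : List (Fin N)) (φ : Fin N → ℝ) : ℝ := (l.map φ).prod

@[simp]
lemma fieldMonomial_nil {N : ℕ} (φ : Fin N → ℝ) : fieldMonomial [] φ = 1 := rfl

@[simp]
lemma fieldMonomial_cons {N : ℕ} (i : Fin N) (l : List (Fin N)) (φ : Fin N → ℝ) :
    fieldMonomial (i :: l) φ = φ i * fieldMonomial l φ := by
  simp [fieldMonomial]

@[fun_prop]
lemma continuous_fieldMonomial {N : ℕ} (l : List (Fin N)) : Continuous (fieldMonomial l) := by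
  induction l with
  | nil => exact (continuous_const : Continuous fun _ : Fin N → ℝ => (1 : ℝ))
  | cons i l ih =>
    have : fieldMonomial (i :: l) = fun φ => φ i * fieldMonomial l φ := by ext; simp
    rw [this]; fun_prop

lemma fieldMonomial_smul {N : ℕ} (l : List (Fin N)) (t : ℝ) (φ : Fin N → ℝ) :
    fieldMonomial l (t • φ) = t ^ l.length * fieldMonomial l φ := by
  induction l with
  | nil => simp
  | cons i l ih => simp [ih]; ring

lemma abs_fieldMonomial_le {N : ℕ} (l : List (Fin N)) (φ : Fin N → ℝ) :
    |fieldMonomial l φ| ≤ Real.exp (l.length * absSum φ) := by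
  induction l with
  | nil => simp
  | cons i l ih =>
    rw [fieldMonomial_cons, abs_mul, List.length_cons]
    push_cast
    rw [add_mul, add_comm, Real.exp_add, one_mul]
    have := (abs_le_absSum φ i).trans ((by linarith : absSum φ ≤ absSum φ + 1).trans
      (Real.add_one_le_exp _))
    gcongr

/-- Monomials in the fields, times powers of `∑ φ i ^ 2` and exponentials of `∑ |φ i|`, are
integrable against a Gaussian. -/
lemma integrable_dominating {N : ℕ} {a : ℝ} (ha : 0 < a) (k : ℝ) (l : List (Fin N)) (m : ℕ) :
    Integrable fun φ : Fin N → ℝ => |fieldMonomial l φ| * (∑ i, φ i ^ 2) ^ m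
      * Real.exp (-a * ∑ i, φ i ^ 2 + k * absSum φ) := by
  have h := (integrable_gaussian_mul_exp_abs (ι := Fin N) (a := a / 2) (by positivity)
    (l.length + k)).const_mul ((2 / a) ^ m * m.factorial)
  refine h.mono' (by fun_prop) (ae_of_all _ fun φ => ?_)
  have hs : 0 ≤ ∑ i, φ i ^ 2 := Finset.sum_nonneg fun _ _ => sq_nonneg _
  rw [Real.norm_of_nonneg (by positivity)]
  have h1 := abs_fieldMonomial_le l φ
  have h2 : (∑ i, φ i ^ 2) ^ m ≤ (2 / a) ^ m * m.factorial * Real.exp (a / 2 * ∑ i, φ i ^ 2) := by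
    have := Real.pow_div_factorial_le_exp (a / 2 * ∑ i, φ i ^ 2) (by positivity) m
    rw [div_le_iff₀ (by positivity)] at this
    calc (∑ i, φ i ^ 2) ^ m = (2 / a) ^ m * (a / 2 * ∑ i, φ i ^ 2) ^ m := by
          rw [← mul_pow]; congr 1; field_simp
      _ ≤ (2 / a) ^ m * (Real.exp (a / 2 * ∑ i, φ i ^ 2) * m.factorial) := by gcongr
      _ = _ := by ring
  calc _ ≤ Real.exp (l.length * absSum φ)
        * ((2 / a) ^ m * m.factorial * Real.exp (a / 2 * ∑ i, φ i ^ 2))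
        * Real.exp (-a * ∑ i, φ i ^ 2 + k * absSum φ) := by gcongr
    _ = (2 / a) ^ m * m.factorial * (Real.exp (l.length * absSum φ)
        * Real.exp (a / 2 * ∑ i, φ i ^ 2) * Real.exp (-a * ∑ i, φ i ^ 2 + k * absSum φ)) := by ring
    _ = _ := by
      rw [← Real.exp_add, ← Real.exp_add]
      unfold absSum
      congr 2
      ring

/-! ### Spectral decomposition of the pair matrix -/

/-- The full double trace `∑ W i i j j`, which is both the trace of the pair matrix and its
quadratic form at the identity. -/
def doubleTrace {N : ℕ} (W : Tensor4 N) : ℝ := ∑ i, ∑ j, W i i j j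

lemma sum_sum_sum_mul {ι κ : Type*} [Fintype ι] [Fintype κ] (x : ι → κ → ℝ) :
    ∑ I, ∑ J, ∑ s, x s I * x s J = ∑ s, (∑ I, x s I) ^ 2 := by
  simp_rw [sq, Finset.sum_mul_sum]
  rw [Finset.sum_comm (s := (Finset.univ : Finset ι))]
  exact Finset.sum_congr rfl fun I _ => Finset.sum_comm

lemma quarticForm_eq_sum_sq {N : ℕ} {ι : Type*} [Fintype ι] {W : Tensor4 N}
    {B : ι → Matrix (Fin N) (Fin N) ℝ} (hWB : ∀ i j k l, W i j k l = ∑ s, B s i j * B s k l)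
    (φ : Fin N → ℝ) : quarticForm W φ = ∑ s, (φ ⬝ᵥ (B s).mulVec φ) ^ 2 := by
  have h := sum_sum_sum_mul (fun (s : ι) (I : Fin N × Fin N) => φ I.1 * (B s I.1 I.2 * φ I.2))
  simp only [Fintype.sum_prod_type] at h
  simp only [dotProduct, Matrix.mulVec, Finset.mul_sum]
  rw [← h]
  unfold quarticForm
  refine Finset.sum_congr rfl fun i _ => Finset.sum_congr rfl fun j _ =>
    Finset.sum_congr rfl fun k _ => Finset.sum_congr rfl fun l _ => ?_
  rw [hWB]
  simp only [Finset.sum_mul]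
  exact Finset.sum_congr rfl fun s _ => by ring

/-- Spectral decomposition of the pair matrix, `W = ∑ B s ⊗ B s`, with the eigenvectors read as
`N × N` matrices. Complete symmetry of `W` makes them symmetric. -/
lemma exists_spectral_decomposition {N : ℕ} {W : Tensor4 N} (hsymm : IsCompletelySymmetric W)
    (hpos : (pairMatrix W).PosSemidef) {Λ₀ : ℝ} (hΛ₀ : IsHighestEigenvalue (pairMatrix W) Λ₀) :
    ∃ (B : Fin N × Fin N → Matrix (Fin N) (Fin N) ℝ) (μ : Fin N × Fin N → ℝ),
      (∀ s, (B s).IsHermitian) ∧ (∀ s, 0 ≤ μ s) ∧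
      (∀ s t, (B s * B t).trace = if s = t then μ s else 0) ∧
      (∀ i j k l, W i j k l = ∑ s, B s i j * B s k l) ∧
      ∑ s, μ s = doubleTrace W ∧ ∑ s, (B s).trace ^ 2 = doubleTrace W ∧
      doubleTrace W ≤ N * Λ₀ := by
  classical
  set hH := hpos.1
  set e := hH.eigenvalues with he
  set v : Fin N × Fin N → Fin N × Fin N → ℝ := fun s => ⇑(hH.eigenvectorBasis s) with hv
  have he0 : ∀ s, 0 ≤ e s := hpos.eigenvalues_nonneg
  have hort : ∀ s t, ∑ I, v s I * v t I = if s = t then 1 else 0 := fun s t => by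
    have := orthonormal_iff_ite.1 hH.eigenvectorBasis.orthonormal s t
    rw [← this, PiLp.inner_apply]
    exact Finset.sum_congr rfl fun I _ => by simp [hv, mul_comm]
  have heig : ∀ s I, ∑ J, pairMatrix W I J * v s J = e s * v s I := fun s I =>
    congrFun (hH.mulVec_eigenvectorBasis s) I
  have hcompl : ∀ I J, ∑ s, v s I * v s J = if I = J then 1 else 0 := fun I J => by
    have h1 : hH.eigenvectorUnitary.1 * star hH.eigenvectorUnitary.1 = 1 :=
      Unitary.coe_mul_star_self hH.eigenvectorUnitary
    have h2 := congrFun (congrFun h1 I) J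
    rw [Matrix.mul_apply, Matrix.one_apply] at h2
    rw [← h2]
    rfl
  have hW : ∀ I J, pairMatrix W I J = ∑ s, e s * v s I * v s J := fun I J => by
    calc pairMatrix W I J = ∑ K, pairMatrix W I K * (if K = J then 1 else 0) := by simp
      _ = ∑ K, ∑ s, pairMatrix W I K * (v s K * v s J) := by
        simp_rw [← hcompl, Finset.mul_sum]
      _ = ∑ s, ∑ K, pairMatrix W I K * (v s K * v s J) := Finset.sum_comm
      _ = _ := by
        refine Finset.sum_congr rfl fun s _ => ?_
        rw [← heig, Finset.sum_mul]
        exact Finset.sum_congr rfl fun K _ => by ring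
  have hswap : ∀ s i j, Real.sqrt (e s) * v s (i, j) = Real.sqrt (e s) * v s (j, i) := by
    intro s i j
    by_cases h0 : e s = 0
    · simp [h0]
    · congr 1
      apply mul_left_cancel₀ h0
      rw [← heig, ← heig]
      refine Finset.sum_congr rfl fun J _ => ?_
      simp only [pairMatrix, Matrix.of_apply]
      rw [(hsymm i j J.1 J.2).1]
  have hsq : ∀ s, Real.sqrt (e s) * Real.sqrt (e s) = e s := fun s => Real.mul_self_sqrt (he0 s)
  have htr : ∑ s, (∑ i, Real.sqrt (e s) * v s (i, i)) ^ 2 = doubleTrace W := by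
    rw [← sum_sum_sum_mul fun s i => Real.sqrt (e s) * v s (i, i)]
    unfold doubleTrace
    refine Finset.sum_congr rfl fun i _ => Finset.sum_congr rfl fun j _ => ?_
    have := hW (i, i) (j, j)
    simp only [pairMatrix, Matrix.of_apply] at this
    rw [this]
    refine Finset.sum_congr rfl fun s _ => ?_
    linear_combination (v s (i, i) * v s (j, j)) * hsq s
  refine ⟨fun s => Matrix.of fun i j => Real.sqrt (e s) * v s (i, j), e, ?_, he0, ?_, ?_, ?_, ?_, ?_⟩
  · intro s
    ext i j
    simp only [Matrix.conjTranspose_apply, Matrix.of_apply, star_trivial]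
    exact hswap s j i
  · intro s t
    have : (if s = t then e s else 0) = Real.sqrt (e s) * Real.sqrt (e t) * ∑ I, v s I * v t I := by
      rw [hort]
      split_ifs with h
      · rw [h, hsq, mul_one]
      · simp
    rw [this, Fintype.sum_prod_type, Finset.mul_sum]
    simp only [Matrix.trace, Matrix.diag_apply, Matrix.mul_apply, Matrix.of_apply, Finset.mul_sum]
    refine Finset.sum_congr rfl fun i _ => Finset.sum_congr rfl fun j _ => ?_
    rw [hswap t j i]; ring
  · intro i j k l
    have := hW (i, j) (k, l)
    simp only [pairMatrix, Matrix.of_apply] at this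
    rw [this]
    refine Finset.sum_congr rfl fun s _ => ?_
    simp only [Matrix.of_apply]
    linear_combination -(v s (i, j) * v s (k, l)) * hsq s
  · have h1 : (pairMatrix W).trace = ∑ s, e s := by
      have := hH.trace_eq_sum_eigenvalues
      simpa using this
    rw [← h1, Matrix.trace, Fintype.sum_prod_type]
    unfold doubleTrace
    refine Finset.sum_congr rfl fun i _ => Finset.sum_congr rfl fun j _ => ?_
    simp only [pairMatrix, Matrix.diag_apply, Matrix.of_apply]
    exact ((hsymm i i j j).2.1).symm
  · exact htr
  · have hle : ∀ s, e s ≤ Λ₀ := fun s => by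
      apply hΛ₀.2
      have h1 := hH.mulVec_eigenvectorBasis s
      refine Module.End.hasEigenvalue_of_hasEigenvector (x := v s) ⟨?_, ?_⟩
      · rw [Module.End.mem_eigenspace_iff, Matrix.toLin'_apply]
        exact h1
      · intro h0
        have := hort s s
        rw [h0] at this
        simp at this
    have hdt : doubleTrace W = ∑ s, e s * (∑ i, v s (i, i)) ^ 2 := by
      rw [← htr]
      refine Finset.sum_congr rfl fun s _ => ?_
      rw [← Finset.mul_sum, mul_pow, sq (Real.sqrt _), hsq]
    calc doubleTrace W = ∑ s, e s * (∑ i, v s (i, i)) ^ 2 := hdt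
      _ ≤ ∑ s, Λ₀ * (∑ i, v s (i, i)) ^ 2 := by
          gcongr with s; exact hle s
      _ = Λ₀ * ∑ i, ∑ j, ∑ s, v s (i, i) * v s (j, j) := by
          rw [← Finset.mul_sum, sum_sum_sum_mul fun s i => v s (i, i)]
      _ = N * Λ₀ := by
          simp_rw [hcompl]
          simp [mul_comm]

/-! ### Absence of zeros of the partition function -/

lemma sqrt_exp_one_div_pi_lt : Real.sqrt (Real.exp 1 / Real.pi) < 0.9303 := by
  rw [Real.sqrt_lt' (by norm_num), div_lt_iff₀ Real.pi_pos]
  have h1 := Real.exp_one_lt_d9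
  have h2 := Real.pi_gt_d4
  norm_num at *
  linarith

/-- The moment `∫ φ^l exp (-a φ² / 2 - V / 8)`, with `V` the quartic form. Writing the field as
`(u / 3) ^ (-1 / 4) φ` brings the moments of the model with coupling `u = 3 / a²` to this form, up
to a power of `u`; the integral converges for `0 < Re a`, that is for all `u` in the slit plane. -/
def rotatedMoment {N : ℕ} (W : Tensor4 N) (l : List (Fin N)) (a : ℂ) : ℂ :=
  ∫ φ : Fin N → ℝ, (fieldMonomial l φ : ℂ)
    * exp (-(a / 2) * ((∑ i, φ i ^ 2 : ℝ) : ℂ) - (quarticForm W φ : ℂ) / 8)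

/-- The numerical inequality that decides the size of the cardioid. The two thresholds are just
above `κ / √2` and `κ / 16`, for `κ = √(e / π)`. -/
lemma gaussian_error_lt_one {x z : ℝ} (hx : x ≤ 0.658) (hz0 : 0 ≤ z)
    (hz : z ≤ 0.0582) : Real.exp (z / (1 - x)) / Real.sqrt (1 - x) - Real.exp z < 1 := by
  have hx' : 0.342 ≤ 1 - x := by linarith
  have hs : 0.5848 ≤ Real.sqrt (1 - x) := Real.le_sqrt_of_sq_le (by norm_num; linarith)
  have h1 : z / (1 - x) ≤ z + 0.112 := by
    rw [div_le_iff₀ (by linarith)]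
    nlinarith
  have h2 : ∀ y : ℝ, y < 1 → Real.exp y ≤ 1 / (1 - y) := fun y hy => by
    rw [le_div_iff₀ (by linarith)]
    have := Real.add_one_le_exp (-y)
    have h3 : Real.exp y * Real.exp (-y) = 1 := by rw [← Real.exp_add]; simp
    nlinarith [Real.exp_pos y]
  have h3 : Real.exp z ≤ 1.0618 := (h2 z (by linarith)).trans (by
    rw [div_le_iff₀ (by linarith)]; linarith)
  have h4 : Real.exp 0.112 ≤ 1.1262 := (h2 _ (by norm_num)).trans (by norm_num)
  have h5 : Real.exp (z / (1 - x)) ≤ Real.exp z * 1.1262 :=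
    (Real.exp_le_exp.2 h1).trans (by rw [Real.exp_add]; gcongr)
  have h6 : Real.exp (z / (1 - x)) / Real.sqrt (1 - x) ≤ Real.exp z * 1.926 := by
    rw [div_le_iff₀ (by linarith)]
    nlinarith [Real.exp_pos z, mul_le_mul_of_nonneg_left hs (Real.exp_pos z).le]
  linarith

/-- The partition function has no zero where the Hubbard–Stratonovich error is smaller than the
main term, whose modulus relative to the free value is at least `1` when `Re a² ≤ 0`, i.e. when the
coupling `u = 3 / a²` is in the left half-plane. -/
lemma rotatedMoment_nil_ne_zero {N : ℕ} {W : Tensor4 N} (hsymm : IsCompletelySymmetric W)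
    (hpos : (pairMatrix W).PosSemidef) {Λ₀ : ℝ} (hΛ₀ : IsHighestEigenvalue (pairMatrix W) Λ₀)
    {a : ℂ} (ha : 0 < a.re) (ha2 : (a ^ 2).re ≤ 0)
    (hT : N * Λ₀ ≤ 2 * Real.sqrt (Real.exp 1 / Real.pi) * a.re ^ 2) :
    rotatedMoment W [] a ≠ 0 := by
  obtain ⟨B, μ, h1, h2, h3, h4, h5, h6, h7⟩ := exists_spectral_decomposition hsymm hpos hΛ₀
  set T := doubleTrace W
  set κ := Real.sqrt (Real.exp 1 / Real.pi)
  have hκ : κ < 0.9303 := sqrt_exp_one_div_pi_lt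
  have hκ0 : 0 ≤ κ := Real.sqrt_nonneg _
  have hT0 : 0 ≤ T := by rw [← h5]; exact Finset.sum_nonneg fun s _ => h2 s
  have ha0 : a ≠ 0 := fun h => by rw [h] at ha; simp at ha
  have hna : 0 < ‖a‖ := norm_pos_iff.2 ha0
  have hTa := h7.trans hT
  have hsq : ‖a‖ ^ 2 = a.re ^ 2 + a.im ^ 2 := by
    rw [← normSq_eq_norm_sq, normSq_apply]; ring
  have hre2 : (a ^ 2).re = a.re ^ 2 - a.im ^ 2 := by rw [sq, mul_re]; ring
  have hle : 2 * a.re ^ 2 ≤ ‖a‖ ^ 2 := by rw [hsq]; linarith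
  -- with `c = Re a / ‖a‖`, so that `c² ≤ 1 / 2`, the two parameters of the error are at most
  -- `κ c` and `κ c² (1 - c²) / 4`
  have hx : T / (2 * ‖a‖ * a.re) ≤ 0.658 := by
    rw [div_le_iff₀ (by positivity)]
    have h1 : a.re ≤ 0.7072 * ‖a‖ := by
      apply le_of_sq_le_sq _ (by positivity)
      nlinarith
    have : T ≤ 2 * 0.9303 * a.re ^ 2 := hTa.trans (by gcongr)
    nlinarith [mul_le_mul_of_nonneg_left h1 ha.le]
  have hz : T * a.im ^ 2 / (8 * ‖a‖ ^ 4) ≤ 0.0582 := by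
    rw [div_le_iff₀ (by positivity)]
    have h1 : T * a.im ^ 2 ≤ 2 * 0.9303 * a.re ^ 2 * a.im ^ 2 := by
      gcongr
      exact hTa.trans (by gcongr)
    have h2 : ‖a‖ ^ 4 = (a.re ^ 2 + a.im ^ 2) ^ 2 := by rw [← hsq]; ring
    rw [h2]
    nlinarith [sq_nonneg (a.re ^ 2 - a.im ^ 2), sq_nonneg (a.re ^ 2 + a.im ^ 2)]
  have key := norm_integral_sum_sq_sub_le h1 h2 h3 h5 h6 ha (hx.trans_lt (by norm_num))
  have hlt := gaussian_error_lt_one hx (by positivity) hz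
  have hI0 : ((Real.pi / (a / 2)) ^ (1 / 2 : ℂ)) ^ N ≠ 0 := by
    apply pow_ne_zero
    rw [Ne, cpow_eq_zero_iff]
    have : (Real.pi / (a / 2) : ℂ) ≠ 0 :=
      div_ne_zero (by exact_mod_cast Real.pi_ne_zero) (div_ne_zero ha0 two_ne_zero)
    tauto
  have hexp : 1 ≤ ‖exp (-(T : ℂ) / (8 * a ^ 2))‖ := by
    rw [norm_exp]
    apply Real.one_le_exp
    rw [show -(T : ℂ) / (8 * a ^ 2) = ((-T / 8 : ℝ) : ℂ) * (a ^ 2)⁻¹ by push_cast; field_simp,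
      re_ofReal_mul, inv_re]
    have : (a ^ 2).re / normSq (a ^ 2) ≤ 0 := div_nonpos_of_nonpos_of_nonneg ha2 (normSq_nonneg _)
    nlinarith
  intro h0
  have hP : rotatedMoment W [] a = ∫ φ : Fin N → ℝ, exp (-(a / 2) * ∑ i, (φ i : ℂ) ^ 2
          - ((∑ s, (φ ⬝ᵥ (B s).mulVec φ) ^ 2 : ℝ) : ℂ) / 8) := by
    unfold rotatedMoment
    simp only [fieldMonomial_nil, ofReal_one, one_mul, quarticForm_eq_sum_sq h4]
    congr 1; ext φ; congr 2; push_cast; rfl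
  rw [← hP, h0, zero_sub, norm_neg, norm_mul] at key
  have := norm_pos_iff.2 hI0
  nlinarith [mul_lt_mul_of_pos_left (hlt.trans_le hexp) this]

lemma quarticForm_nonneg {N : ℕ} {W : Tensor4 N} (hsymm : IsCompletelySymmetric W)
    (hpos : (pairMatrix W).PosSemidef) {Λ₀ : ℝ} (hΛ₀ : IsHighestEigenvalue (pairMatrix W) Λ₀)
    (φ : Fin N → ℝ) : 0 ≤ quarticForm W φ := by
  obtain ⟨B, μ, h1, h2, h3, h4, h5, h6, h7⟩ := exists_spectral_decomposition hsymm hpos hΛ₀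
  rw [quarticForm_eq_sum_sq h4]; positivity

lemma inv_sqrt_one_sub_le {y : ℝ} (h0 : 0 ≤ y) (h1 : y ≤ 1 / 2) :
    1 / Real.sqrt (1 - y) ≤ 1 + y / 2 + y ^ 2 := by
  rw [div_le_iff₀ (Real.sqrt_pos.2 (by linarith))]
  rw [← div_le_iff₀' (by positivity)]
  apply Real.le_sqrt_of_sq_le
  rw [div_pow, div_le_iff₀ (by positivity)]
  nlinarith [mul_nonneg h0 h0, mul_nonneg (mul_nonneg h0 h0) h0,
    mul_nonneg (mul_nonneg (mul_nonneg h0 h0) h0) h0, mul_nonneg (mul_nonneg h0 h0) (sub_nonneg.2 h1),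
    mul_nonneg (mul_nonneg (mul_nonneg h0 h0) h0) (sub_nonneg.2 h1),
    mul_nonneg (mul_nonneg (mul_nonneg (mul_nonneg h0 h0) h0) h0) (sub_nonneg.2 h1)]

lemma integrable_quarticForm_pow_mul_gaussian {N : ℕ} (W : Tensor4 N) (m : ℕ) :
    Integrable fun φ : Fin N → ℝ => quarticForm W φ ^ m * Real.exp (-(1 / 2) * ∑ i, φ i ^ 2) := by
  have h := (integrable_dominating (N := N) (a := 1 / 2) (by norm_num) 0 [] (2 * m)).const_mul
    (tensorNorm W ^ m)
  refine h.mono' (by fun_prop) (ae_of_all _ fun φ => ?_)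
  rw [norm_mul, norm_pow, Real.norm_eq_abs, Real.norm_of_nonneg (Real.exp_pos _).le]
  simp only [fieldMonomial_nil, abs_one, one_mul, zero_mul, add_zero]
  rw [pow_mul, ← mul_assoc, ← mul_pow]
  gcongr
  exact abs_quarticForm_le W φ

lemma integral_gaussian_fields (N : ℕ) :
    ∫ φ : Fin N → ℝ, Real.exp (-(1 / 2) * ∑ i, φ i ^ 2) = Real.sqrt (2 * Real.pi) ^ N := by
  have := (integral_rexp_quadratic (ι := Fin N) (b := fun _ => 1 / 2) (by norm_num) (fun _ => 0)).2
  simp only [zero_mul, Finset.sum_const_zero, add_zero, ← Finset.mul_sum, ← neg_mul] at this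
  rw [this]
  simp [mul_comm]

/-- The Gaussian expectation of the quartic form is at most three times its double trace: compare the
terms of first order in the coupling `ε` in the Hubbard–Stratonovich estimate. -/
lemma integral_quarticForm_le {N : ℕ} {W : Tensor4 N} (hsymm : IsCompletelySymmetric W)
    (hpos : (pairMatrix W).PosSemidef) {Λ₀ : ℝ} (hΛ₀ : IsHighestEigenvalue (pairMatrix W) Λ₀) :
    ∫ φ : Fin N → ℝ, quarticForm W φ * Real.exp (-(1 / 2) * ∑ i, φ i ^ 2)
      ≤ 3 * (N * Λ₀) * Real.sqrt (2 * Real.pi) ^ N := by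
  obtain ⟨B, μ, h1, h2, h3, h4, h5, h6, h7⟩ := exists_spectral_decomposition hsymm hpos hΛ₀
  set T := doubleTrace W
  set K : ℝ := Real.sqrt (2 * Real.pi) ^ N
  have hK : 0 < K := by positivity
  have hT0 : 0 ≤ T := by rw [← h5]; exact Finset.sum_nonneg fun s _ => h2 s
  have i0 := integrable_quarticForm_pow_mul_gaussian W 0
  have i1 := integrable_quarticForm_pow_mul_gaussian W 1
  have i2 := integrable_quarticForm_pow_mul_gaussian W 2
  have hg : ∫ φ : Fin N → ℝ, Real.exp (-(1 / 2) * ∑ i, φ i ^ 2) = K := integral_gaussian_fields N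
  simp only [pow_zero, one_mul, pow_one] at i0 i1
  set M1 := ∫ φ : Fin N → ℝ, quarticForm W φ * Real.exp (-(1 / 2) * ∑ i, φ i ^ 2)
  set M2 := ∫ φ : Fin N → ℝ, quarticForm W φ ^ 2 * Real.exp (-(1 / 2) * ∑ i, φ i ^ 2)
  have hM2 : 0 ≤ M2 := integral_nonneg fun φ => by positivity
  have hε : ∀ ε : ℝ, 0 < ε → ε * T ≤ 1 / 2 →
      M1 / 8 ≤ K * (3 * T / 8) + ε * (K * T ^ 2 + M2 / 128) := by
    intro ε hε0 hεT
    have hsq : Real.sqrt ε * Real.sqrt ε = ε := Real.mul_self_sqrt hε0.le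
    have key := norm_integral_sum_sq_sub_le (B := fun s => Real.sqrt ε • B s)
      (μ := fun s => ε * μ s) (T := ε * T) (a := 1)
      (fun s => by
        rw [Matrix.IsHermitian, Matrix.conjTranspose_smul, (h1 s).eq]; simp)
      (fun s => mul_nonneg hε0.le (h2 s))
      (fun s t => by
        rw [Matrix.smul_mul, Matrix.mul_smul, smul_smul, Matrix.trace_smul, h3, hsq, smul_eq_mul]
        split_ifs <;> simp)
      (by rw [← Finset.mul_sum, h5])
      (by simp only [Matrix.trace_smul, smul_eq_mul, mul_pow, sq (Real.sqrt ε), hsq]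
          rw [← Finset.mul_sum, h6])
      (by simp) (by simp; linarith)
    have hI : ((Real.pi / (1 / 2)) ^ (1 / 2 : ℂ)) ^ N = ((K : ℝ) : ℂ) := by
      simp only [K]
      push_cast
      rw [sqrt_eq_cpow_half (by positivity)]
      congr 2
      push_cast; ring
    have hq : ∀ φ : Fin N → ℝ, exp (-(1 / 2) * ∑ i, (φ i : ℂ) ^ 2
        - ((∑ s, (φ ⬝ᵥ (Real.sqrt ε • B s).mulVec φ) ^ 2 : ℝ) : ℂ) / 8)
        = ((Real.exp (-(1 / 2) * ∑ i, φ i ^ 2) * Real.exp (-(ε * quarticForm W φ / 8)) : ℝ) : ℂ) := by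
      intro φ
      simp only [Matrix.smul_mulVec, dotProduct_smul, smul_eq_mul, mul_pow, sq (Real.sqrt ε), hsq]
      rw [← Finset.mul_sum, ← quarticForm_eq_sum_sq h4, ← Real.exp_add]
      push_cast
      ring_nf
    rw [hI] at key
    simp_rw [hq] at key
    rw [integral_complex_ofReal, show -((ε * T : ℝ) : ℂ) / (8 * 1 ^ 2) = ((-(ε * T / 8) : ℝ) : ℂ) by
      push_cast; ring, ← ofReal_exp, ← ofReal_mul, ← ofReal_sub, norm_real, norm_real] at key
    simp only [one_im, one_re, norm_one, ne_eq, OfNat.ofNat_ne_zero, not_false_eq_true, zero_pow,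
      mul_zero, zero_div, Real.exp_zero, mul_one, Real.norm_of_nonneg hK.le] at key
    have k1 := (abs_le.1 key).1
    have k2 := inv_sqrt_one_sub_le (y := ε * T / 2) (by positivity) (by linarith)
    have k3 := Real.add_one_le_exp (-(ε * T / 8))
    have iE : Integrable fun φ : Fin N → ℝ =>
        Real.exp (-(1 / 2) * ∑ i, φ i ^ 2) * Real.exp (-(ε * quarticForm W φ / 8)) := by
      refine i0.mono' (by fun_prop) (ae_of_all _ fun φ => ?_)
      rw [Real.norm_of_nonneg (by positivity)]
      have hV : 0 ≤ quarticForm W φ := by rw [quarticForm_eq_sum_sq h4]; positivity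
      have : Real.exp (-(ε * quarticForm W φ / 8)) ≤ 1 := Real.exp_le_one_iff.2 (by
        have := mul_nonneg hε0.le hV; linarith)
      nlinarith [Real.exp_pos (-(1 / 2) * ∑ i, φ i ^ 2)]
    have k4 : ∫ φ : Fin N → ℝ,
        Real.exp (-(1 / 2) * ∑ i, φ i ^ 2) * Real.exp (-(ε * quarticForm W φ / 8))
        ≤ K - ε / 8 * M1 + ε ^ 2 / 128 * M2 := by
      have i01 : Integrable fun φ : Fin N → ℝ => Real.exp (-(1 / 2) * ∑ i, φ i ^ 2)
          - ε / 8 * (quarticForm W φ * Real.exp (-(1 / 2) * ∑ i, φ i ^ 2)) :=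
        i0.sub (i1.const_mul _)
      rw [← hg, ← integral_const_mul, ← integral_const_mul, ← integral_sub i0 (i1.const_mul _),
        ← integral_add i01 (i2.const_mul _)]
      refine integral_mono iE (i01.add (i2.const_mul _)) fun φ => ?_
      have hV : 0 ≤ quarticForm W φ := by rw [quarticForm_eq_sum_sq h4]; positivity
      have hw : 0 ≤ ε * quarticForm W φ / 8 := by positivity
      have h5 : Real.exp (-(ε * quarticForm W φ / 8)) ≤ 1 - ε * quarticForm W φ / 8
          + (ε * quarticForm W φ / 8) ^ 2 / 2 := by
        generalize ε * quarticForm W φ / 8 = w at hw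
        have h6 := Real.quadratic_le_exp_of_nonneg hw
        have h7 : Real.exp (-w) * Real.exp w = 1 := by rw [← Real.exp_add]; simp
        have h8 : 1 ≤ (1 - w + w ^ 2 / 2) * Real.exp w := by
          nlinarith [mul_le_mul_of_nonneg_left h6 (by nlinarith [sq_nonneg (w - 1)] :
            0 ≤ 1 - w + w ^ 2 / 2), sq_nonneg (w ^ 2)]
        nlinarith [Real.exp_pos w, Real.exp_pos (-w)]
      have := mul_le_mul_of_nonneg_left h5 (Real.exp_pos (-(1 / 2) * ∑ i, φ i ^ 2)).le
      nlinarith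
    have k5 : K * (1 / Real.sqrt (1 - ε * T / 2) - 1) ≤ K * (ε * T / 4 + ε ^ 2 * T ^ 2 / 4) := by
      gcongr; nlinarith
    have k6 : K * (-(ε * T / 8) + 1) ≤ K * Real.exp (-(ε * T / 8)) := by gcongr
    have k7 : ε * (M1 / 8) ≤ ε * (K * (3 * T / 8) + ε * (K * T ^ 2 + M2 / 128)) := by
      have : 0 ≤ K * (ε ^ 2 * T ^ 2) := by positivity
      nlinarith
    exact le_of_mul_le_mul_left k7 hε0
  have hlim : M1 / 8 ≤ K * (3 * T / 8) := by
    apply le_of_forall_pos_le_add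
    intro δ hδ
    set C := K * T ^ 2 + M2 / 128
    have hC : 0 ≤ C := by positivity
    set ε := min (δ / (C + 1)) (1 / 2 / (T + 1))
    have hε0 : 0 < ε := lt_min (by positivity) (by positivity)
    have e1 : ε * T ≤ 1 / 2 := by
      have : ε * (T + 1) ≤ 1 / 2 := by
        rw [← le_div_iff₀ (by positivity)]; exact min_le_right _ _
      linarith
    have e2 : ε * C ≤ δ := by
      have : ε * (C + 1) ≤ δ := by
        rw [← le_div_iff₀ (by positivity)]; exact min_le_left _ _
      linarith
    exact (hε ε hε0 e1).trans (by linarith)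
  nlinarith

/-! ### Moments and their analytic continuation -/

/-- The moment `∫ φ^l exp (-φ² / 2 - (u / 4!) V + J φ)` of the model with sources. -/
def sourcedMoment {N : ℕ} (W : Tensor4 N) (l : List (Fin N)) (u : ℂ) (J : Fin N → ℝ) : ℂ :=
  ∫ φ : Fin N → ℝ, (fieldMonomial l φ : ℂ)
    * exp (-(1 / 2) * ((∑ i, φ i ^ 2 : ℝ) : ℂ)
      - u / (Nat.factorial 4 : ℂ) * (quarticForm W φ : ℂ) + ((∑ i, J i * φ i : ℝ) : ℂ))

lemma partitionFunction_eq_sourcedMoment {N : ℕ} (W : Tensor4 N) (u : ℂ) (J : Fin N → ℝ) :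
    partitionFunction W u J = sourcedMoment W [] u J := by
  simp [partitionFunction, sourcedMoment]

lemma norm_sourced_integrand_le {N : ℕ} {W : Tensor4 N} (hV : ∀ φ, 0 ≤ quarticForm W φ)
    {u : ℂ} (hu : 0 ≤ u.re) {J : Fin N → ℝ} {k : ℝ} (hJ : ‖J‖ ≤ k) (φ : Fin N → ℝ) :
    ‖exp (-(1 / 2) * ((∑ i, φ i ^ 2 : ℝ) : ℂ)
      - u / (Nat.factorial 4 : ℂ) * (quarticForm W φ : ℂ) + ((∑ i, J i * φ i : ℝ) : ℂ))‖
      ≤ Real.exp (-(1 / 2) * ∑ i, φ i ^ 2 + k * absSum φ) := by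
  rw [norm_exp]
  apply Real.exp_le_exp.2
  have h1 : ∑ i, J i * φ i ≤ k * absSum φ := by
    unfold absSum
    rw [Finset.mul_sum]
    refine Finset.sum_le_sum fun i _ => (le_abs_self _).trans ?_
    rw [abs_mul]
    exact mul_le_mul_of_nonneg_right ((norm_le_pi_norm J i).trans hJ) (abs_nonneg _)
  have h2 : (u / (Nat.factorial 4 : ℂ) * (quarticForm W φ : ℂ)).re
      = u.re / 24 * quarticForm W φ := by
    rw [re_mul_ofReal, show (Nat.factorial 4 : ℂ) = ((24 : ℝ) : ℂ) by norm_num [Nat.factorial],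
      div_ofReal_re]
  have h3 : (-(1 / 2) * ((∑ i, φ i ^ 2 : ℝ) : ℂ)).re = -(1 / 2) * ∑ i, φ i ^ 2 := by
    rw [show (-(1 / 2) * ((∑ i, φ i ^ 2 : ℝ) : ℂ)) = ((-(1 / 2) * ∑ i, φ i ^ 2 : ℝ) : ℂ) by
      push_cast; ring, ofReal_re]
  rw [add_re, sub_re, h2, h3, ofReal_re]
  have : 0 ≤ u.re / 24 * quarticForm W φ := mul_nonneg (by positivity) (hV φ)
  linarith

lemma integrable_sourced_integrand {N : ℕ} {W : Tensor4 N} (hV : ∀ φ, 0 ≤ quarticForm W φ)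
    (l : List (Fin N)) {u : ℂ} (hu : 0 ≤ u.re) (J : Fin N → ℝ) :
    Integrable fun φ : Fin N → ℝ => (fieldMonomial l φ : ℂ)
      * exp (-(1 / 2) * ((∑ i, φ i ^ 2 : ℝ) : ℂ)
      - u / (Nat.factorial 4 : ℂ) * (quarticForm W φ : ℂ) + ((∑ i, J i * φ i : ℝ) : ℂ)) := by
  refine (integrable_dominating (N := N) (a := 1 / 2) (by norm_num) ‖J‖ l 0).mono'
    (Continuous.aestronglyMeasurable (by fun_prop)) (ae_of_all _ fun φ => ?_)
  rw [norm_mul, norm_real, Real.norm_eq_abs, pow_zero, mul_one]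
  gcongr
  exact norm_sourced_integrand_le hV hu le_rfl φ

lemma differentiableOn_sourcedMoment {N : ℕ} {W : Tensor4 N} (hV : ∀ φ, 0 ≤ quarticForm W φ)
    (l : List (Fin N)) : DifferentiableOn ℂ (fun u => sourcedMoment W l u 0) {u | 0 < u.re} := by
  intro u hu
  have hs : {u : ℂ | 0 < u.re} ∈ nhds u := (isOpen_lt continuous_const continuous_re).mem_nhds hu
  refine DifferentiableAt.differentiableWithinAt ?_
  have hb := (integrable_dominating (N := N) (a := 1 / 2) (by norm_num) 0 l 2).const_mul
    (tensorNorm W / 24)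
  refine (hasDerivAt_integral_of_dominated_loc_of_deriv_le
    (F' := fun u φ => (fieldMonomial l φ : ℂ) * (exp (-(1 / 2) * ((∑ i, φ i ^ 2 : ℝ) : ℂ)
      - u / (Nat.factorial 4 : ℂ) * (quarticForm W φ : ℂ)
        + ((∑ i, (0 : Fin N → ℝ) i * φ i : ℝ) : ℂ)) * -(quarticForm W φ / 24 : ℂ))) hs
    ?_ (integrable_sourced_integrand hV l hu.le 0) ?_ ?_ hb ?_).2.differentiableAt
  · exact Filter.Eventually.of_forall fun u => Continuous.aestronglyMeasurable (by fun_prop)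
  · exact Continuous.aestronglyMeasurable (by fun_prop)
  · refine ae_of_all _ fun φ x hx => ?_
    rw [norm_mul, norm_mul, norm_neg, norm_div, norm_real, norm_real, Real.norm_eq_abs,
      Real.norm_eq_abs, show ‖(24 : ℂ)‖ = 24 by simp]
    calc _ ≤ |fieldMonomial l φ| * (Real.exp (-(1 / 2) * ∑ i, φ i ^ 2 + 0 * absSum φ)
          * (tensorNorm W * (∑ i, φ i ^ 2) ^ 2 / 24)) := by
          gcongr
          · exact norm_sourced_integrand_le hV (le_of_lt hx) (by simp) φ
          · exact abs_quarticForm_le W φ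
      _ = _ := by ring
  · refine ae_of_all _ fun φ x _ => ?_
    refine HasDerivAt.const_mul _ (HasDerivAt.cexp ?_)
    have h1 : HasDerivAt (fun u : ℂ => u / (Nat.factorial 4 : ℂ) * (quarticForm W φ : ℂ))
        (quarticForm W φ / 24 : ℂ) x := by
      refine (((hasDerivAt_id x).div_const (Nat.factorial 4 : ℂ)).mul_const
        (quarticForm W φ : ℂ)).congr_deriv ?_
      norm_num [Nat.factorial]; ring
    exact (h1.const_sub _).add_const _

lemma continuousOn_sourcedMoment {N : ℕ} {W : Tensor4 N} (hV : ∀ φ, 0 ≤ quarticForm W φ)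
    (l : List (Fin N)) : ContinuousOn (fun u => sourcedMoment W l u 0) {u | 0 ≤ u.re} := by
  refine continuousOn_of_dominated (fun u _ => Continuous.aestronglyMeasurable (by fun_prop)) ?_
    (integrable_dominating (N := N) (a := 1 / 2) (by norm_num) 0 l 0) ?_
  · refine fun u hu => ae_of_all _ fun φ => ?_
    rw [norm_mul, norm_real, Real.norm_eq_abs, pow_zero, mul_one]
    gcongr
    exact norm_sourced_integrand_le hV hu (by simp) φ
  · exact ae_of_all _ fun φ => Continuous.continuousOn (by fun_prop)

lemma differentiableAt_rotatedMoment {N : ℕ} {W : Tensor4 N} (hV : ∀ φ, 0 ≤ quarticForm W φ)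
    (l : List (Fin N)) {a : ℂ} (ha : 0 < a.re) : DifferentiableAt ℂ (rotatedMoment W l) a := by
  have hs : {b : ℂ | a.re / 2 < b.re} ∈ nhds a :=
    (isOpen_lt continuous_const continuous_re).mem_nhds (by simp; linarith)
  have hb := (integrable_dominating (N := N) (a := a.re / 4) (by positivity) 0 l 1).const_mul (1 / 2)
  have hn : ∀ (b : ℂ) (φ : Fin N → ℝ), a.re / 2 < b.re →
      ‖exp (-(b / 2) * ((∑ i, φ i ^ 2 : ℝ) : ℂ) - (quarticForm W φ : ℂ) / 8)‖
        ≤ Real.exp (-(a.re / 4) * ∑ i, φ i ^ 2 + 0 * absSum φ) := by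
    intro b φ hb
    rw [norm_exp]
    apply Real.exp_le_exp.2
    have h1 : (-(b / 2) * ((∑ i, φ i ^ 2 : ℝ) : ℂ)).re = -(b.re / 2) * ∑ i, φ i ^ 2 := by
      rw [re_mul_ofReal, neg_re, show b / 2 = b / ((2 : ℝ) : ℂ) by norm_num, div_ofReal_re]
    have h2 : ((quarticForm W φ : ℂ) / 8).re = quarticForm W φ / 8 := by
      rw [show (8 : ℂ) = ((8 : ℝ) : ℂ) by norm_num, div_ofReal_re, ofReal_re]
    rw [sub_re, h1, h2]
    have h3 : 0 ≤ ∑ i, φ i ^ 2 := Finset.sum_nonneg fun _ _ => sq_nonneg _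
    nlinarith [hV φ]
  have hmeas : ∀ b : ℂ, AEStronglyMeasurable (fun φ : Fin N → ℝ => (fieldMonomial l φ : ℂ)
      * exp (-(b / 2) * ((∑ i, φ i ^ 2 : ℝ) : ℂ) - (quarticForm W φ : ℂ) / 8)) volume :=
    fun b => Continuous.aestronglyMeasurable (by fun_prop)
  refine (hasDerivAt_integral_of_dominated_loc_of_deriv_le
    (F' := fun b φ => (fieldMonomial l φ : ℂ) * (exp (-(b / 2) * ((∑ i, φ i ^ 2 : ℝ) : ℂ)
      - (quarticForm W φ : ℂ) / 8) * -((∑ i, φ i ^ 2 : ℝ) / 2 : ℂ))) hs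
    (Filter.Eventually.of_forall hmeas) ?_ ?_ ?_ hb ?_).2.differentiableAt
  · refine (integrable_dominating (N := N) (a := a.re / 4) (by positivity) 0 l 0).mono' (hmeas a)
      (ae_of_all _ fun φ => ?_)
    rw [norm_mul, norm_real, Real.norm_eq_abs, pow_zero, mul_one]
    gcongr
    exact hn a φ (by linarith)
  · exact Continuous.aestronglyMeasurable (by fun_prop)
  · refine ae_of_all _ fun φ x hx => ?_
    have h3 : 0 ≤ ∑ i, φ i ^ 2 := Finset.sum_nonneg fun _ _ => sq_nonneg _
    rw [norm_mul, norm_mul, norm_neg, norm_div, norm_real, norm_real, Real.norm_eq_abs,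
      Real.norm_of_nonneg h3, show ‖(2 : ℂ)‖ = 2 by simp]
    calc _ ≤ |fieldMonomial l φ| * (Real.exp (-(a.re / 4) * ∑ i, φ i ^ 2 + 0 * absSum φ)
          * ((∑ i, φ i ^ 2) / 2)) := by
          gcongr
          exact hn x φ hx
      _ = _ := by ring
  · refine ae_of_all _ fun φ x _ => ?_
    refine HasDerivAt.const_mul _ (HasDerivAt.cexp ?_)
    exact ((((hasDerivAt_id x).div_const 2).neg.mul_const
      ((∑ i, φ i ^ 2 : ℝ) : ℂ)).sub_const ((quarticForm W φ : ℂ) / 8)).congr_deriv (by ring)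

/-- The analytic continuation to the slit plane of the moments at vanishing source, obtained by
rescaling the field by the complex number `(u / 3) ^ (-1 / 4)`. -/
def continuedMoment {N : ℕ} (W : Tensor4 N) (l : List (Fin N)) (u : ℂ) : ℂ :=
  ((u / 3) ^ (-(1 / 4) : ℂ)) ^ (N + l.length) * rotatedMoment W l ((u / 3) ^ (-(1 / 2) : ℂ))

lemma div_three_mem_slitPlane {u : ℂ} (hu : u ∈ slitPlane) : u / 3 ∈ slitPlane := by
  have h : u / 3 = ((1 / 3 : ℝ) : ℂ) * u := by push_cast; ring
  rw [h]
  rcases hu with h | h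
  · left; rw [re_ofReal_mul]; positivity
  · right; rw [im_ofReal_mul]; exact mul_ne_zero (by norm_num) h

lemma rotation_re_pos {u : ℂ} (hu : u ∈ slitPlane) : 0 < ((u / 3) ^ (-(1 / 2) : ℂ)).re := by
  have h3 := div_three_mem_slitPlane hu
  have h0 := slitPlane_ne_zero h3
  rw [cpow_def_of_ne_zero h0, exp_re]
  apply mul_pos (Real.exp_pos _)
  have e : (log (u / 3) * (-(1 / 2) : ℂ)).im = -(arg (u / 3) / 2) := by
    rw [show (-(1 / 2) : ℂ) = ((-(1 / 2) : ℝ) : ℂ) by push_cast; ring, im_mul_ofReal, log_im]; ring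
  rw [e, Real.cos_neg]
  have h1 := neg_pi_lt_arg (u / 3)
  have h2 := lt_of_le_of_ne (arg_le_pi (u / 3)) (mem_slitPlane_iff_arg.1 h3).1
  exact Real.cos_pos_of_mem_Ioo ⟨by linarith, by linarith⟩

lemma differentiableOn_continuedMoment {N : ℕ} {W : Tensor4 N} (hV : ∀ φ, 0 ≤ quarticForm W φ)
    (l : List (Fin N)) : DifferentiableOn ℂ (continuedMoment W l) slitPlane := by
  intro u hu
  refine DifferentiableAt.differentiableWithinAt ?_
  have h3 := div_three_mem_slitPlane hu
  have hp : ∀ c : ℂ, DifferentiableAt ℂ (fun u : ℂ => (u / 3) ^ c) u := fun c =>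
    (differentiableAt_id.div_const 3).cpow_const h3
  have hc : DifferentiableAt ℂ (fun u : ℂ => rotatedMoment W l ((u / 3) ^ (-(1 / 2) : ℂ))) u :=
    DifferentiableAt.comp (g := rotatedMoment W l) u
      (differentiableAt_rotatedMoment hV l (rotation_re_pos hu)) (hp _)
  exact ((hp _).pow _).mul hc

/-- For a positive coupling the rotation of the field is a real change of variables. -/
lemma continuedMoment_ofReal {N : ℕ} (W : Tensor4 N) (l : List (Fin N)) {r : ℝ} (hr : 0 < r) :
    continuedMoment W l r = sourcedMoment W l r 0 := by
  set t : ℝ := (r / 3) ^ (-(1 / 4) : ℝ) with ht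
  have ht0 : 0 < t := by positivity
  have h1 : ((r : ℂ) / 3) ^ (-(1 / 4) : ℂ) = (t : ℂ) := by
    rw [ht, ofReal_cpow (by positivity)]; push_cast; rfl
  have h2 : ((r : ℂ) / 3) ^ (-(1 / 2) : ℂ) = ((t ^ 2 : ℝ) : ℂ) := by
    rw [ht, ← Real.rpow_natCast, ← Real.rpow_mul (by positivity), ofReal_cpow (by positivity)]
    push_cast; norm_num
  have h4 : t ^ 4 * r = 3 := by
    rw [ht, ← Real.rpow_natCast, ← Real.rpow_mul (by positivity)]
    norm_num [Real.rpow_neg_one]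
    field_simp
  have hq : ∀ φ : Fin N → ℝ, quarticForm W (t • φ) = t ^ 4 * quarticForm W φ := fun φ => by
    unfold quarticForm
    simp only [Finset.mul_sum, Pi.smul_apply, smul_eq_mul]
    refine Finset.sum_congr rfl fun i _ => Finset.sum_congr rfl fun j _ =>
      Finset.sum_congr rfl fun k _ => Finset.sum_congr rfl fun l _ => by ring
  unfold continuedMoment
  rw [h1, h2]
  unfold sourcedMoment rotatedMoment
  set f : (Fin N → ℝ) → ℂ := fun φ => (fieldMonomial l φ : ℂ)
    * exp (-(1 / 2) * ((∑ i, φ i ^ 2 : ℝ) : ℂ)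
      - r / (Nat.factorial 4 : ℂ) * (quarticForm W φ : ℂ)
        + ((∑ i, (0 : Fin N → ℝ) i * φ i : ℝ) : ℂ)) with hf
  have hsc := Measure.integral_comp_smul (volume : Measure (Fin N → ℝ)) f t
  have hft : ∀ φ, f (t • φ) = (t : ℂ) ^ l.length * ((fieldMonomial l φ : ℂ)
      * exp (-(((t ^ 2 : ℝ) : ℂ) / 2) * ((∑ i, φ i ^ 2 : ℝ) : ℂ) - (quarticForm W φ : ℂ) / 8)) := by
    intro φ
    simp only [hf, fieldMonomial_smul, hq, Pi.smul_apply, smul_eq_mul, mul_pow, ← Finset.mul_sum,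
      Pi.zero_apply, zero_mul, Finset.sum_const_zero, ofReal_zero, add_zero]
    rw [ofReal_mul, ofReal_pow, mul_assoc]
    congr 3
    have h5 : (t : ℂ) ^ 4 * r = 3 := by exact_mod_cast h4
    norm_num [Nat.factorial]
    linear_combination (-(quarticForm W φ : ℂ) / 24) * h5
  simp_rw [hft] at hsc
  rw [integral_const_mul, Module.finrank_fintype_fun_eq_card, Fintype.card_fin,
    abs_of_pos (by positivity), real_smul] at hsc
  rw [pow_add, mul_assoc, hsc]
  push_cast
  have : (t : ℂ) ≠ 0 := by exact_mod_cast ht0.ne'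
  field_simp

/-- The continued moments extend the moments of the model, up to the boundary `Re u = 0`. -/
lemma continuedMoment_eq {N : ℕ} {W : Tensor4 N} (hV : ∀ φ, 0 ≤ quarticForm W φ)
    (l : List (Fin N)) {u : ℂ} (hu : 0 ≤ u.re) (hu0 : u ∈ slitPlane) :
    continuedMoment W l u = sourcedMoment W l u 0 := by
  have hopen : IsOpen {u : ℂ | 0 < u.re} := isOpen_lt continuous_const continuous_re
  have hsub : {u : ℂ | 0 < u.re} ⊆ slitPlane := fun u hu => Or.inl hu
  have hpos : EqOn (continuedMoment W l) (fun u => sourcedMoment W l u 0) {u | 0 < u.re} := by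
    refine AnalyticOnNhd.eqOn_of_preconnected_of_frequently_eq (z₀ := 1)
      (((differentiableOn_continuedMoment hV l).mono hsub).analyticOnNhd hopen)
      ((differentiableOn_sourcedMoment hV l).analyticOnNhd hopen)
      (convex_halfSpace_re_gt 0).isPreconnected (by simp) ?_
    have hseq : Filter.Tendsto (fun n : ℕ => ((1 + 1 / ((n : ℝ) + 1) : ℝ) : ℂ)) Filter.atTop
        (nhdsWithin 1 {1}ᶜ) := by
      rw [tendsto_nhdsWithin_iff]
      constructor
      · have := (tendsto_one_div_add_atTop_nhds_zero_nat (𝕜 := ℝ)).const_add 1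
        have h2 := (continuous_ofReal.tendsto (1 + 0 : ℝ)).comp this
        simpa [Function.comp_def] using h2
      · refine Filter.Eventually.of_forall fun n => ?_
        simp only [mem_compl_iff, mem_singleton_iff]
        intro h
        have h2 : (1 + 1 / ((n : ℝ) + 1)) = 1 := by exact_mod_cast h
        have : 0 < 1 / ((n : ℝ) + 1) := by positivity
        linarith
    refine hseq.frequently (Filter.Frequently.of_forall fun n => ?_)
    exact continuedMoment_ofReal W l (by positivity)
  -- pass to the boundary along `u + 1 / (n + 1)`
  have hseq : Filter.Tendsto (fun n : ℕ => u + ((1 / ((n : ℝ) + 1) : ℝ) : ℂ)) Filter.atTop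
      (nhds u) := by
    have h2 := (continuous_ofReal.tendsto (0 : ℝ)).comp
      (tendsto_one_div_add_atTop_nhds_zero_nat (𝕜 := ℝ))
    simpa using h2.const_add u
  have hre : ∀ n : ℕ, 0 < (u + ((1 / ((n : ℝ) + 1) : ℝ) : ℂ)).re := fun n => by
    rw [add_re, ofReal_re]
    have : 0 < 1 / ((n : ℝ) + 1) := by positivity
    linarith
  have l1 : Filter.Tendsto (fun n : ℕ => continuedMoment W l (u + ((1 / ((n : ℝ) + 1) : ℝ) : ℂ)))
      Filter.atTop (nhds (continuedMoment W l u)) :=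
    (((differentiableOn_continuedMoment hV l).continuousOn.continuousAt
      (isOpen_slitPlane.mem_nhds hu0)).tendsto).comp hseq
  have l2 : Filter.Tendsto (fun n : ℕ => sourcedMoment W l (u + ((1 / ((n : ℝ) + 1) : ℝ) : ℂ)) 0)
      Filter.atTop (nhds (sourcedMoment W l u 0)) :=
    ((continuousOn_sourcedMoment hV l u hu).tendsto).comp
      (tendsto_nhdsWithin_iff.2 ⟨hseq, Filter.Eventually.of_forall fun n => (hre n).le⟩)
  refine tendsto_nhds_unique l1 (l2.congr fun n => (hpos (hre n)).symm)

/-! ### Correlation functions as polynomials in the moments -/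

/-- The `i`-th coordinate, as a complex-valued real-linear form. -/
def coordForm {N : ℕ} (i : Fin N) : (Fin N → ℝ) →L[ℝ] ℂ :=
  ofRealCLM.comp (ContinuousLinearMap.proj i)

lemma coordForm_apply {N : ℕ} (i : Fin N) (v : Fin N → ℝ) : coordForm i v = (v i : ℂ) := rfl

lemma norm_coordForm_le {N : ℕ} (i : Fin N) : ‖coordForm i‖ ≤ 1 :=
  ContinuousLinearMap.opNorm_le_bound _ zero_le_one fun v => by
    rw [coordForm_apply, norm_real, one_mul]; exact norm_le_pi_norm v i

/-- Differentiating a moment with respect to the source `J i` inserts a field `φ i`. -/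
lemma hasFDerivAt_sourcedMoment {N : ℕ} {W : Tensor4 N} (hV : ∀ φ, 0 ≤ quarticForm W φ)
    (l : List (Fin N)) {u : ℂ} (hu : 0 ≤ u.re) (J : Fin N → ℝ) :
    HasFDerivAt (sourcedMoment W l u) (∑ i, sourcedMoment W (i :: l) u J • coordForm i) J := by
  set E : (Fin N → ℝ) → (Fin N → ℝ) → ℂ := fun J φ => exp (-(1 / 2) * ((∑ i, φ i ^ 2 : ℝ) : ℂ)
      - u / (Nat.factorial 4 : ℂ) * (quarticForm W φ : ℂ) + ((∑ i, J i * φ i : ℝ) : ℂ)) with hE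
  have hb : Integrable fun φ : Fin N → ℝ => ∑ i : Fin N, |fieldMonomial (i :: l) φ|
      * Real.exp (-(1 / 2) * ∑ i, φ i ^ 2 + (‖J‖ + 1) * absSum φ) :=
    integrable_finsetSum _ fun i _ => by
      simpa using integrable_dominating (N := N) (a := 1 / 2) (by norm_num) (‖J‖ + 1) (i :: l) 0
  have key := hasFDerivAt_integral_of_dominated_of_fderiv_le (𝕜 := ℝ) (μ := volume)
    (F := fun J φ => (fieldMonomial l φ : ℂ) * E J φ)
    (F' := fun J φ => ∑ i, ((fieldMonomial (i :: l) φ : ℂ) * E J φ) • coordForm i)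
    (x₀ := J) (Metric.ball_mem_nhds J one_pos)
    (Filter.Eventually.of_forall fun J => Continuous.aestronglyMeasurable (by fun_prop))
    (integrable_sourced_integrand hV l hu J)
    (Continuous.aestronglyMeasurable (by fun_prop)) ?_ hb ?_
  · rw [integral_finsetSum] at key
    · simp_rw [integral_smul_const] at key
      exact key
    · exact fun i _ => (integrable_sourced_integrand hV (i :: l) hu J).smul_const _
  · refine ae_of_all _ fun φ x hx => (norm_sum_le _ _).trans (Finset.sum_le_sum fun i _ => ?_)
    rw [norm_smul, norm_mul, norm_real, Real.norm_eq_abs]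
    have h1 := norm_sourced_integrand_le hV hu (J := x) (k := ‖J‖ + 1) (by
      have h2 := norm_sub_norm_le x J
      rw [mem_ball_iff_norm] at hx
      linarith) φ
    calc _ ≤ |fieldMonomial (i :: l) φ|
          * Real.exp (-(1 / 2) * ∑ i, φ i ^ 2 + (‖J‖ + 1) * absSum φ) * 1 := by
          gcongr
          exact norm_coordForm_le i
      _ = _ := mul_one _
  · refine ae_of_all _ fun φ x _ => ?_
    have h0 : HasFDerivAt (fun J : Fin N → ℝ => ((∑ i, J i * φ i : ℝ) : ℂ))
        (∑ i, (φ i : ℂ) • coordForm i) x := by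
      have : (fun J : Fin N → ℝ => ((∑ i, J i * φ i : ℝ) : ℂ))
          = fun J => (∑ i, (φ i : ℂ) • coordForm i) J := by
        ext J
        simp [coordForm_apply, mul_comm]
      rw [this]
      exact ContinuousLinearMap.hasFDerivAt _
    have h1 := ((h0.const_add (-(1 / 2) * ((∑ i, φ i ^ 2 : ℝ) : ℂ)
      - u / (Nat.factorial 4 : ℂ) * (quarticForm W φ : ℂ))).cexp).const_mul
        (fieldMonomial l φ : ℂ)
    convert! h1 using 1
    rw [Finset.smul_sum, Finset.smul_sum]
    refine Finset.sum_congr rfl fun i _ => ?_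
    rw [smul_smul, smul_smul, fieldMonomial_cons]
    congr 1
    rw [ofReal_mul, hE]
    ring

lemma contDiff_sourcedMoment {N : ℕ} {W : Tensor4 N} (hV : ∀ φ, 0 ≤ quarticForm W φ)
    {u : ℂ} (hu : 0 ≤ u.re) (n : ℕ) (l : List (Fin N)) :
    ContDiff ℝ n (sourcedMoment W l u) := by
  induction n generalizing l with
  | zero =>
    rw [Nat.cast_zero, contDiff_zero]
    exact continuous_iff_continuousAt.2 fun J => (hasFDerivAt_sourcedMoment hV l hu J).continuousAt
  | succ n ih =>
    rw [Nat.cast_succ, contDiff_succ_iff_hasFDerivAt]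
    refine ⟨fun J => ∑ i, sourcedMoment W (i :: l) u J • coordForm i, ?_,
      hasFDerivAt_sourcedMoment hV l hu⟩
    exact ContDiff.sum fun i _ => (ih (i :: l)).smul contDiff_const

/-- Formal polynomials in the moments (indexed by `some l`) and the inverse of the partition
function (indexed by `none`). -/
abbrev MomentPoly (N : ℕ) : Type := MvPolynomial (Option (List (Fin N))) ℂ

/-- The derivation of `MomentPoly N` that represents the derivative with respect to the `i`-th
source. -/
def sourceDerivation {N : ℕ} (i : Fin N) : Derivation ℂ (MomentPoly N) (MomentPoly N) :=
  MvPolynomial.mkDerivation ℂ fun s => match s with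
    | some l => MvPolynomial.X (some (i :: l))
    | none => -(MvPolynomial.X none ^ 2 * MvPolynomial.X (some [i]))

/-- The polynomial in the moments and the inverse of the partition function that represents the
connected correlation function with `n + 1` external legs. -/
def correlationPoly {N : ℕ} : (n : ℕ) → (Fin (n + 1) → Fin N) → MomentPoly N
  | 0, idx => MvPolynomial.X none * MvPolynomial.X (some [idx 0])
  | n + 1, idx => sourceDerivation (idx 0) (correlationPoly n (Fin.tail idx))

/-- The point at which a `MomentPoly` is evaluated, for a given family of moments. -/
def momentPoint {N : ℕ} (M : List (Fin N) → ℂ) : Option (List (Fin N)) → ℂ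
  | some l => M l
  | none => (M [])⁻¹

/-- The derivations `sourceDerivation i` compute the derivatives with respect to the sources. -/
lemma hasFDerivAt_eval_momentPoly {N : ℕ} {W : Tensor4 N} (hV : ∀ φ, 0 ≤ quarticForm W φ)
    {u : ℂ} (hu : 0 ≤ u.re) {J : Fin N → ℝ} (hJ : sourcedMoment W [] u J ≠ 0)
    (p : MomentPoly N) :
    HasFDerivAt (fun J => MvPolynomial.eval (momentPoint fun l => sourcedMoment W l u J) p)
      (∑ i, MvPolynomial.eval (momentPoint fun l => sourcedMoment W l u J) (sourceDerivation i p)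
        • coordForm i) J := by
  induction p using MvPolynomial.induction_on with
  | C a => 
    simp only [MvPolynomial.eval_C]
    refine (hasFDerivAt_const (𝕜 := ℝ) a J).congr_fderiv ?_
    ext v
    simp [← MvPolynomial.algebraMap_eq]
  | add p q hp hq =>
    simp only [map_add]
    refine (hp.fun_add hq).congr_fderiv ?_
    ext v
    simp [add_mul, Finset.sum_add_distrib]
  | mul_X p s hp =>
    have hX : HasFDerivAt (fun J => momentPoint (fun l => sourcedMoment W l u J) s)
        (∑ i, MvPolynomial.eval (momentPoint fun l => sourcedMoment W l u J)
          (sourceDerivation i (MvPolynomial.X s)) • coordForm i) J := by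
      cases s with
      | some l =>
        simp only [sourceDerivation, MvPolynomial.mkDerivation_X, MvPolynomial.eval_X]
        exact hasFDerivAt_sourcedMoment hV l hu J
      | none =>
        simp only [sourceDerivation, MvPolynomial.mkDerivation_X, map_neg, map_mul, map_pow,
          MvPolynomial.eval_X]
        have h1 := (hasDerivAt_inv hJ).comp_hasFDerivAt J (hasFDerivAt_sourcedMoment hV [] hu J)
        convert! h1 using 1
        rw [Finset.smul_sum]
        refine Finset.sum_congr rfl fun i _ => ?_
        rw [smul_smul]
        simp [momentPoint]
    have h2 := hp.mul hX
    simp only [map_mul, MvPolynomial.eval_X, Derivation.leibniz, map_add, smul_eq_mul]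
    refine HasFDerivAt.congr_fderiv h2 ?_
    ext v
    simp [add_mul, Finset.sum_add_distrib, Finset.mul_sum, mul_assoc]

lemma sum_smul_coordForm_single {N : ℕ} (c : Fin N → ℂ) (i : Fin N) :
    (∑ k, c k • coordForm k) (Pi.single i 1) = c i := by
  rw [sum_apply, Finset.sum_eq_single i]
  · simp [coordForm_apply]
  · intro k _ hk; simp [coordForm_apply, hk]
  · simp

/-- The connected correlation functions with sources, wherever the partition function avoids the cut
of the logarithm. This condition is open in the sources, so the identity can be differentiated. -/
lemma iteratedFDeriv_freeEnergy {N : ℕ} {W : Tensor4 N} (hV : ∀ φ, 0 ≤ quarticForm W φ)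
    {u : ℂ} (hu : 0 ≤ u.re) (n : ℕ) (idx : Fin (n + 1) → Fin N) {J : Fin N → ℝ}
    (hJ : sourcedMoment W [] u J ∈ slitPlane) :
    iteratedFDeriv ℝ (n + 1) (freeEnergy W u) J (fun k => Pi.single (idx k) 1)
      = MvPolynomial.eval (momentPoint fun l => sourcedMoment W l u J)
        (correlationPoly n idx) := by
  have hF : freeEnergy W u = fun J => log (sourcedMoment W [] u J) := by
    ext J; rw [freeEnergy, partitionFunction_eq_sourcedMoment]
  have hder : ∀ J, sourcedMoment W [] u J ∈ slitPlane → HasFDerivAt (freeEnergy W u)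
      ((sourcedMoment W [] u J)⁻¹ • ∑ i, sourcedMoment W [i] u J • coordForm i) J := fun J hJ => by
    rw [hF]
    exact (hasDerivAt_log hJ).comp_hasFDerivAt J (hasFDerivAt_sourcedMoment hV [] hu J)
  induction n generalizing J with
  | zero =>
    rw [iteratedFDeriv_succ_apply_left]
    have h0 : iteratedFDeriv ℝ 0 (freeEnergy W u)
        = (continuousMultilinearCurryFin0 ℝ (Fin N → ℝ) ℂ).symm ∘ freeEnergy W u :=
      iteratedFDeriv_zero_eq_comp
    rw [h0, LinearIsometryEquiv.comp_fderiv, (hder J hJ).fderiv]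
    simp only [ContinuousLinearMap.comp_apply]
    rw [Finset.smul_sum]
    simp_rw [smul_smul]
    rw [sum_smul_coordForm_single]
    simp [correlationPoly, momentPoint]
  | succ n ih =>
    rw [iteratedFDeriv_succ_apply_left]
    have hcd : ContDiffAt ℝ ((n + 2 : ℕ) : WithTop ℕ∞) (freeEnergy W u) J := by
      rw [hF]
      exact ((contDiffAt_log hJ).restrict_scalars ℝ).comp J
        (contDiff_sourcedMoment hV hu (n + 2) []).contDiffAt
    have hd : DifferentiableAt ℝ (iteratedFDeriv ℝ (n + 1) (freeEnergy W u)) J :=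
      hcd.differentiableAt_iteratedFDeriv (by norm_cast; omega)
    have h1 := hd.hasFDerivAt.continuousMultilinear_apply_const
      (fun k : Fin (n + 1) => (Pi.single (Fin.tail idx k) 1 : Fin N → ℝ))
    have h2 := hasFDerivAt_eval_momentPoly hV hu (slitPlane_ne_zero hJ)
      (correlationPoly n (Fin.tail idx))
    have hev : ∀ᶠ J' in nhds J, iteratedFDeriv ℝ (n + 1) (freeEnergy W u) J'
        (fun k : Fin (n + 1) => (Pi.single (Fin.tail idx k) 1 : Fin N → ℝ))
        = MvPolynomial.eval (momentPoint fun l => sourcedMoment W l u J')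
          (correlationPoly n (Fin.tail idx)) := by
      have hc : ContinuousAt (sourcedMoment W [] u) J :=
        (hasFDerivAt_sourcedMoment hV [] hu J).continuousAt
      filter_upwards [hc.preimage_mem_nhds (isOpen_slitPlane.mem_nhds hJ)] with J' hJ'
      exact ih (Fin.tail idx) hJ'
    have h3 := h1.unique (h2.congr_of_eventuallyEq hev)
    have h4 := congrArg (fun L => L (Pi.single (idx 0) 1)) h3
    simp only [sum_smul_coordForm_single] at h4
    exact h4

/-! ### Gevrey expansions -/

/-- `f` has the asymptotic expansion `∑ a_k u^k` on `Ω`, with coefficients and remainders of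
factorial type. -/
def HasGevreyExpansion (Ω : Set ℂ) (f : ℂ → ℂ) (a : PowerSeries ℂ) : Prop :=
  ∃ K σ : ℝ, 0 ≤ K ∧ 0 ≤ σ ∧ (∀ k, ‖a.coeff k‖ ≤ K * σ ^ k * k.factorial) ∧
    ∀ r : ℕ, ∀ u ∈ Ω, ‖f u - ∑ k ∈ Finset.range r, a.coeff k * u ^ k‖
      ≤ K * σ ^ r * r.factorial * ‖u‖ ^ r

lemma factorial_mul_factorial_sub_le {k n : ℕ} (h : k ≤ n) :
    (k.factorial : ℝ) * (n - k).factorial ≤ n.factorial := by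
  exact_mod_cast Nat.le_of_dvd n.factorial_pos (Nat.factorial_mul_factorial_dvd_factorial h)

lemma succ_le_two_pow (r : ℕ) : (r : ℝ) + 1 ≤ 2 ^ r := by
  exact_mod_cast Nat.lt_two_pow_self (n := r)

namespace HasGevreyExpansion

variable {Ω : Set ℂ} {f g : ℂ → ℂ} {a b : PowerSeries ℂ}

lemma mono {Ω' : Set ℂ} (h : HasGevreyExpansion Ω f a) (hΩ : Ω' ⊆ Ω) :
    HasGevreyExpansion Ω' f a := by
  obtain ⟨K, σ, hK, hσ, h1, h2⟩ := h
  exact ⟨K, σ, hK, hσ, h1, fun r u hu => h2 r u (hΩ hu)⟩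

lemma congr (h : HasGevreyExpansion Ω f a) (hfg : ∀ u ∈ Ω, g u = f u) :
    HasGevreyExpansion Ω g a := by
  obtain ⟨K, σ, hK, hσ, h1, h2⟩ := h
  exact ⟨K, σ, hK, hσ, h1, fun r u hu => by rw [hfg u hu]; exact h2 r u hu⟩

lemma const (Ω : Set ℂ) (c : ℂ) : HasGevreyExpansion Ω (fun _ => c) (PowerSeries.C c) := by
  refine ⟨‖c‖, 1, norm_nonneg _, zero_le_one, fun k => ?_, fun r u _ => ?_⟩
  · rw [PowerSeries.coeff_C]
    split_ifs with h
    · simp [h]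
    · rw [norm_zero]; positivity
  · rcases r with _ | r
    · simp
    · rw [Finset.sum_range_succ']
      simp [PowerSeries.coeff_C]
      positivity

/-- The constants of two expansions can be chosen equal. -/
lemma common (hf : HasGevreyExpansion Ω f a) (hg : HasGevreyExpansion Ω g b) :
    ∃ K σ : ℝ, 0 ≤ K ∧ 0 ≤ σ ∧ (∀ k, ‖a.coeff k‖ ≤ K * σ ^ k * k.factorial) ∧
      (∀ k, ‖b.coeff k‖ ≤ K * σ ^ k * k.factorial) ∧
      (∀ r : ℕ, ∀ u ∈ Ω, ‖f u - ∑ k ∈ Finset.range r, a.coeff k * u ^ k‖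
        ≤ K * σ ^ r * r.factorial * ‖u‖ ^ r) ∧
      ∀ r : ℕ, ∀ u ∈ Ω, ‖g u - ∑ k ∈ Finset.range r, b.coeff k * u ^ k‖
        ≤ K * σ ^ r * r.factorial * ‖u‖ ^ r := by
  obtain ⟨K, σ, hK, hσ, h1, h2⟩ := hf
  obtain ⟨L, τ, hL, hτ, h3, h4⟩ := hg
  have e1 : ∀ k : ℕ, K * σ ^ k * k.factorial ≤ max K L * (max σ τ) ^ k * k.factorial :=
    fun k => by gcongr <;> exact le_max_left _ _
  have e2 : ∀ k : ℕ, L * τ ^ k * k.factorial ≤ max K L * (max σ τ) ^ k * k.factorial :=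
    fun k => by gcongr <;> exact le_max_right _ _
  exact ⟨max K L, max σ τ, le_max_of_le_left hK, le_max_of_le_left hσ,
    fun k => (h1 k).trans (e1 k), fun k => (h3 k).trans (e2 k),
    fun r u hu => (h2 r u hu).trans (mul_le_mul_of_nonneg_right (e1 r) (by positivity)),
    fun r u hu => (h4 r u hu).trans (mul_le_mul_of_nonneg_right (e2 r) (by positivity))⟩

lemma add (hf : HasGevreyExpansion Ω f a) (hg : HasGevreyExpansion Ω g b) :
    HasGevreyExpansion Ω (fun u => f u + g u) (a + b) := by
  obtain ⟨K, σ, hK, hσ, h1, h2, h3, h4⟩ := hf.common hg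
  refine ⟨2 * K, σ, by positivity, hσ, fun k => ?_, fun r u hu => ?_⟩
  · rw [map_add]
    refine (norm_add_le _ _).trans ((add_le_add (h1 k) (h2 k)).trans_eq ?_)
    ring
  · have : f u + g u - ∑ k ∈ Finset.range r, (a + b).coeff k * u ^ k
        = (f u - ∑ k ∈ Finset.range r, a.coeff k * u ^ k)
          + (g u - ∑ k ∈ Finset.range r, b.coeff k * u ^ k) := by
      simp only [map_add, add_mul, Finset.sum_add_distrib]; ring
    rw [this]
    refine (norm_add_le _ _).trans ((add_le_add (h3 r u hu) (h4 r u hu)).trans_eq ?_)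
    ring

/-- A product of two sequences of factorial type is of factorial type. -/
lemma sum_mul_le {K σ : ℝ} (hK : 0 ≤ K) (hσ : 0 ≤ σ) {A B : ℕ → ℝ} (hB0 : ∀ k, 0 ≤ B k)
    (hA : ∀ k, A k ≤ K * σ ^ k * k.factorial) (hB : ∀ k, B k ≤ K * σ ^ k * k.factorial)
    {m n : ℕ} (hm : m ≤ n + 1) :
    ∑ k ∈ Finset.range m, A k * B (n - k) ≤ K ^ 2 * (2 * σ) ^ n * n.factorial := by
  have h1 : ∀ k ∈ Finset.range m, A k * B (n - k) ≤ K ^ 2 * σ ^ n * n.factorial := by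
    intro k hk
    have hk' : k ≤ n := by rw [Finset.mem_range] at hk; omega
    calc A k * B (n - k) ≤ (K * σ ^ k * k.factorial) * (K * σ ^ (n - k) * (n - k).factorial) :=
          mul_le_mul (hA k) (hB _) (hB0 _) (by positivity)
      _ = K ^ 2 * (σ ^ k * σ ^ (n - k)) * (k.factorial * (n - k).factorial) := by ring
      _ ≤ K ^ 2 * (σ ^ k * σ ^ (n - k)) * n.factorial := by
          gcongr; exact factorial_mul_factorial_sub_le hk'
      _ = _ := by rw [← pow_add, Nat.add_sub_cancel' hk']
  refine (Finset.sum_le_card_nsmul _ _ _ h1).trans ?_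
  rw [Finset.card_range, nsmul_eq_mul]
  have h2 : (m : ℝ) ≤ 2 ^ n := le_trans (by exact_mod_cast hm) (succ_le_two_pow n)
  calc (m : ℝ) * (K ^ 2 * σ ^ n * n.factorial) ≤ 2 ^ n * (K ^ 2 * σ ^ n * n.factorial) := by
        gcongr
    _ = _ := by rw [mul_pow]; ring

lemma mul (hf : HasGevreyExpansion Ω f a) (hg : HasGevreyExpansion Ω g b) :
    HasGevreyExpansion Ω (fun u => f u * g u) (a * b) := by
  obtain ⟨K, σ, hK, hσ, h1, h2, h3, h4⟩ := hf.common hg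
  refine ⟨2 * K ^ 2, 2 * σ, by positivity, by positivity, fun n => ?_, fun r u hu => ?_⟩
  · rw [PowerSeries.coeff_mul, Finset.Nat.sum_antidiagonal_eq_sum_range_succ
      (fun i j => a.coeff i * b.coeff j)]
    refine (norm_sum_le _ _).trans ?_
    simp_rw [norm_mul]
    refine (sum_mul_le hK hσ (fun _ => norm_nonneg _) h1 h2 le_rfl).trans ?_
    have : 0 ≤ K ^ 2 * (2 * σ) ^ n * n.factorial := by positivity
    linarith
  · have e1 : ∑ n ∈ Finset.range r, (a * b).coeff n * u ^ n
        = ∑ k ∈ Finset.range r, a.coeff k * u ^ k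
          * ∑ j ∈ Finset.range (r - k), b.coeff j * u ^ j := by
      simp_rw [Finset.mul_sum]
      rw [← Finset.sum_range_diag_flip r fun i j => a.coeff i * u ^ i * (b.coeff j * u ^ j)]
      refine Finset.sum_congr rfl fun n _ => ?_
      rw [PowerSeries.coeff_mul, Finset.Nat.sum_antidiagonal_eq_sum_range_succ
        (fun i j => a.coeff i * b.coeff j), Finset.sum_mul]
      refine Finset.sum_congr rfl fun k hk => ?_
      rw [Finset.mem_range] at hk
      rw [show u ^ n = u ^ k * u ^ (n - k) by rw [← pow_add]; congr 1; omega]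
      ring
    -- the remainder of a product in terms of the remainders of the factors
    have e2 : f u * g u - ∑ n ∈ Finset.range r, (a * b).coeff n * u ^ n
        = ∑ k ∈ Finset.range r, a.coeff k * u ^ k
          * (g u - ∑ j ∈ Finset.range (r - k), b.coeff j * u ^ j)
        + (f u - ∑ k ∈ Finset.range r, a.coeff k * u ^ k) * g u := by
      rw [e1]
      simp_rw [mul_sub, Finset.sum_sub_distrib, ← Finset.sum_mul]
      ring
    rw [e2]
    have e3 : ‖∑ k ∈ Finset.range r, a.coeff k * u ^ k
          * (g u - ∑ j ∈ Finset.range (r - k), b.coeff j * u ^ j)‖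
        ≤ K ^ 2 * (2 * σ) ^ r * r.factorial * ‖u‖ ^ r := by
      refine (norm_sum_le _ _).trans ?_
      calc _ ≤ ∑ k ∈ Finset.range r, (‖a.coeff k‖
              * (K * σ ^ (r - k) * (r - k).factorial)) * ‖u‖ ^ r := by
            refine Finset.sum_le_sum fun k hk => ?_
            rw [Finset.mem_range] at hk
            rw [norm_mul, norm_mul, norm_pow]
            calc _ ≤ ‖a.coeff k‖ * ‖u‖ ^ k
                  * (K * σ ^ (r - k) * (r - k).factorial * ‖u‖ ^ (r - k)) := by
                  gcongr; exact h4 _ u hu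
              _ = (‖a.coeff k‖ * (K * σ ^ (r - k) * (r - k).factorial))
                  * (‖u‖ ^ k * ‖u‖ ^ (r - k)) := by ring
              _ = _ := by rw [← pow_add, Nat.add_sub_cancel' hk.le]
        _ ≤ _ := by
            rw [← Finset.sum_mul]
            gcongr
            exact sum_mul_le (B := fun k => K * σ ^ k * k.factorial) hK hσ
              (fun _ => by positivity) h1 (fun _ => le_rfl) (Nat.le_succ r)
    have e4 : ‖(f u - ∑ k ∈ Finset.range r, a.coeff k * u ^ k) * g u‖
        ≤ K ^ 2 * (2 * σ) ^ r * r.factorial * ‖u‖ ^ r := by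
      have h5 : ‖g u‖ ≤ K := by simpa using h4 0 u hu
      rw [norm_mul]
      calc _ ≤ (K * σ ^ r * r.factorial * ‖u‖ ^ r) * K := by gcongr; exact h3 r u hu
        _ = K ^ 2 * σ ^ r * r.factorial * ‖u‖ ^ r := by ring
        _ ≤ _ := by gcongr; linarith
    refine (norm_add_le _ _).trans ((add_le_add e3 e4).trans_eq ?_)
    ring

/-- The coefficients of the inverse of a power series of factorial type are of factorial type. -/
lemma exists_norm_coeff_inv_le {K σ : ℝ} (hK : 0 ≤ K) (hσ : 0 ≤ σ)
    (ha : PowerSeries.constantCoeff a ≠ 0)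
    (h : ∀ k, ‖a.coeff k‖ ≤ K * σ ^ k * k.factorial) :
    ∃ L τ : ℝ, 0 ≤ L ∧ 0 ≤ τ ∧ ∀ k, ‖(a⁻¹).coeff k‖ ≤ L * τ ^ k * k.factorial := by
  set c := PowerSeries.constantCoeff a with hc
  have hc0 : 0 < ‖c‖ := norm_pos_iff.2 ha
  -- the ratio of the geometric series that bounds the recursion is `1 / s`
  set s : ℝ := 1 + (K + 1) / ‖c‖ with hs
  have hs1 : 0 < s - 1 := by rw [hs, add_sub_cancel_left]; positivity
  have hs0 : 0 < s := by linarith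
  refine ⟨‖c‖⁻¹, s * σ, by positivity, by positivity, fun n => ?_⟩
  induction n using Nat.strong_induction_on with
  | _ n ih =>
    rcases n with _ | n
    · simp [hc]
    · have e1 := congrArg (PowerSeries.coeff (n + 1)) (PowerSeries.inv_mul_cancel a ha)
      rw [PowerSeries.coeff_mul, Finset.Nat.sum_antidiagonal_eq_sum_range_succ
        (fun i j => (a⁻¹).coeff i * a.coeff j), Finset.sum_range_succ, Nat.sub_self,
        PowerSeries.coeff_one, if_neg n.succ_ne_zero, PowerSeries.coeff_zero_eq_constantCoeff_apply,
        ← hc] at e1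
      have e2 : ‖(a⁻¹).coeff (n + 1)‖ * ‖c‖
          = ‖∑ k ∈ Finset.range (n + 1), (a⁻¹).coeff k * a.coeff (n + 1 - k)‖ := by
        rw [← norm_mul, ← norm_neg, eq_neg_of_add_eq_zero_right e1, neg_neg]
      have e3 : ∀ k ∈ Finset.range (n + 1), ‖(a⁻¹).coeff k * a.coeff (n + 1 - k)‖
          ≤ ‖c‖⁻¹ * K * σ ^ (n + 1) * (n + 1).factorial * s ^ k := by
        intro k hk
        rw [Finset.mem_range] at hk
        rw [norm_mul]
        calc _ ≤ (‖c‖⁻¹ * (s * σ) ^ k * k.factorial)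
              * (K * σ ^ (n + 1 - k) * (n + 1 - k).factorial) :=
              mul_le_mul (ih k hk) (h _) (norm_nonneg _) (by positivity)
          _ = ‖c‖⁻¹ * K * (σ ^ k * σ ^ (n + 1 - k))
              * (k.factorial * (n + 1 - k).factorial) * s ^ k := by rw [mul_pow]; ring
          _ ≤ ‖c‖⁻¹ * K * (σ ^ k * σ ^ (n + 1 - k)) * (n + 1).factorial * s ^ k := by
              gcongr; exact factorial_mul_factorial_sub_le hk.le
          _ = _ := by rw [← pow_add, Nat.add_sub_cancel' hk.le]
      have e4 : ∑ k ∈ Finset.range (n + 1), s ^ k ≤ s ^ (n + 1) / (s - 1) := by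
        rw [geom_sum_eq (by linarith)]
        gcongr
        linarith
      have e5 : K / (s - 1) ≤ ‖c‖ := by
        rw [hs, add_sub_cancel_left, div_div_eq_mul_div, div_le_iff₀ (by positivity)]
        nlinarith
      have e6 : ‖(a⁻¹).coeff (n + 1)‖ * ‖c‖
          ≤ (‖c‖⁻¹ * (s * σ) ^ (n + 1) * (n + 1).factorial) * ‖c‖ := by
        rw [e2]
        calc _ ≤ ∑ k ∈ Finset.range (n + 1),
              ‖c‖⁻¹ * K * σ ^ (n + 1) * (n + 1).factorial * s ^ k :=
              (norm_sum_le _ _).trans (Finset.sum_le_sum e3)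
          _ ≤ ‖c‖⁻¹ * K * σ ^ (n + 1) * (n + 1).factorial * (s ^ (n + 1) / (s - 1)) := by
              rw [← Finset.mul_sum]; gcongr
          _ = (‖c‖⁻¹ * (s * σ) ^ (n + 1) * (n + 1).factorial) * (K / (s - 1)) := by
              rw [mul_pow]; ring
          _ ≤ _ := by gcongr
      exact le_of_mul_le_mul_right e6 hc0

lemma inv (hf : HasGevreyExpansion Ω f a) (ha : PowerSeries.constantCoeff a ≠ 0) {C : ℝ}
    (hC : ∀ u ∈ Ω, f u ≠ 0 ∧ ‖(f u)⁻¹‖ ≤ C) :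
    HasGevreyExpansion Ω (fun u => (f u)⁻¹) a⁻¹ := by
  rcases Ω.eq_empty_or_nonempty with hΩ | ⟨u₀, hu₀⟩
  · obtain ⟨K, σ, hK, hσ, h1, h2⟩ := hf
    obtain ⟨L, τ, hL, hτ, h3⟩ := exists_norm_coeff_inv_le hK hσ ha h1
    exact ⟨L, τ, hL, hτ, h3, fun r u hu => by simp [hΩ] at hu⟩
  have hC0 : 0 ≤ C := (norm_nonneg _).trans (hC u₀ hu₀).2
  obtain ⟨K₀, σ₀, hK₀, hσ₀, h1₀, h2₀⟩ := hf
  obtain ⟨L₀, τ₀, hL₀, hτ₀, h3₀⟩ := exists_norm_coeff_inv_le hK₀ hσ₀ ha h1₀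
  obtain ⟨K, σ, hK, hσ, h1, h2⟩ : ∃ K σ : ℝ, 0 ≤ K ∧ 0 ≤ σ ∧
      (∀ k, ‖(a⁻¹).coeff k‖ ≤ K * σ ^ k * k.factorial) ∧
      ∀ k : ℕ, K₀ * σ₀ ^ k * k.factorial ≤ K * σ ^ k * k.factorial := by
    refine ⟨max K₀ L₀, max σ₀ τ₀, le_max_of_le_left hK₀, le_max_of_le_left hσ₀,
      fun k => (h3₀ k).trans ?_, fun k => ?_⟩
    · gcongr <;> exact le_max_right _ _
    · gcongr <;> exact le_max_left _ _
  have hR : ∀ r : ℕ, ∀ u ∈ Ω, ‖f u - ∑ k ∈ Finset.range r, a.coeff k * u ^ k‖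
      ≤ K * σ ^ r * r.factorial * ‖u‖ ^ r := fun r u hu =>
    (h2₀ r u hu).trans (mul_le_mul_of_nonneg_right (h2 r) (by positivity))
  refine ⟨K + C + K ^ 2 * C, 2 * σ, by positivity, by positivity, fun k => (h1 k).trans ?_,
    fun r u hu => ?_⟩
  · have : 0 ≤ C + K ^ 2 * C := by positivity
    gcongr <;> linarith
  obtain ⟨hu0, huC⟩ := hC u hu
  rcases r with _ | r
  · simp only [Finset.range_zero, Finset.sum_empty, sub_zero, pow_zero, mul_one,
      Nat.factorial_zero, Nat.cast_one]
    have : 0 ≤ K + K ^ 2 * C := by positivity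
    linarith
  · set q := a⁻¹
    have e1 : ∑ k ∈ Finset.range (r + 1), q.coeff k * u ^ k
        * ∑ j ∈ Finset.range (r + 1 - k), a.coeff j * u ^ j = 1 := by
      have : ∑ n ∈ Finset.range (r + 1), (q * a).coeff n * u ^ n = 1 := by
        rw [PowerSeries.inv_mul_cancel a ha, Finset.sum_range_succ']
        simp [PowerSeries.coeff_one]
      rw [← this]
      simp_rw [Finset.mul_sum]
      rw [← Finset.sum_range_diag_flip (r + 1) fun i j => q.coeff i * u ^ i * (a.coeff j * u ^ j)]
      refine Finset.sum_congr rfl fun n _ => ?_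
      rw [PowerSeries.coeff_mul, Finset.Nat.sum_antidiagonal_eq_sum_range_succ
        (fun i j => q.coeff i * a.coeff j), Finset.sum_mul]
      refine Finset.sum_congr rfl fun k hk => ?_
      rw [Finset.mem_range] at hk
      rw [show u ^ n = u ^ k * u ^ (n - k) by rw [← pow_add]; congr 1; omega]
      ring
    -- multiplying by `f u` turns the remainder of the inverse into remainders of `f`
    have e2 : (f u)⁻¹ - ∑ k ∈ Finset.range (r + 1), q.coeff k * u ^ k
        = -((f u)⁻¹ * ∑ k ∈ Finset.range (r + 1), q.coeff k * u ^ k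
          * (f u - ∑ j ∈ Finset.range (r + 1 - k), a.coeff j * u ^ j)) := by
      simp_rw [mul_sub, Finset.sum_sub_distrib, ← Finset.sum_mul]
      rw [e1]
      field_simp
      ring
    rw [e2, norm_neg, norm_mul]
    have e3 : ‖∑ k ∈ Finset.range (r + 1), q.coeff k * u ^ k
          * (f u - ∑ j ∈ Finset.range (r + 1 - k), a.coeff j * u ^ j)‖
        ≤ K ^ 2 * (2 * σ) ^ (r + 1) * (r + 1).factorial * ‖u‖ ^ (r + 1) := by
      refine (norm_sum_le _ _).trans ?_
      calc _ ≤ ∑ k ∈ Finset.range (r + 1), (‖q.coeff k‖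
              * (K * σ ^ (r + 1 - k) * (r + 1 - k).factorial)) * ‖u‖ ^ (r + 1) := by
            refine Finset.sum_le_sum fun k hk => ?_
            rw [Finset.mem_range] at hk
            rw [norm_mul, norm_mul, norm_pow]
            calc _ ≤ ‖q.coeff k‖ * ‖u‖ ^ k
                  * (K * σ ^ (r + 1 - k) * (r + 1 - k).factorial * ‖u‖ ^ (r + 1 - k)) := by
                  gcongr; exact hR _ u hu
              _ = (‖q.coeff k‖ * (K * σ ^ (r + 1 - k) * (r + 1 - k).factorial))
                  * (‖u‖ ^ k * ‖u‖ ^ (r + 1 - k)) := by ring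
              _ = _ := by rw [← pow_add, Nat.add_sub_cancel' hk.le]
        _ ≤ _ := by
            rw [← Finset.sum_mul]
            gcongr
            exact sum_mul_le (B := fun k => K * σ ^ k * k.factorial) hK hσ
              (fun _ => by positivity) h1 (fun _ => le_rfl) (Nat.le_succ _)
    calc _ ≤ C * (K ^ 2 * (2 * σ) ^ (r + 1) * (r + 1).factorial * ‖u‖ ^ (r + 1)) := by gcongr
      _ = (K ^ 2 * C) * (2 * σ) ^ (r + 1) * (r + 1).factorial * ‖u‖ ^ (r + 1) := by ring
      _ ≤ _ := by gcongr; linarith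

end HasGevreyExpansion

/-! ### Perturbative expansion of the moments -/

/-- Taylor's formula for `exp (-w)` in the right half-plane, where all derivatives are bounded
by one. -/
lemma norm_exp_neg_sub_sum_le (r : ℕ) {w : ℂ} (hw : 0 ≤ w.re) :
    ‖exp (-w) - ∑ k ∈ Finset.range r, (-w) ^ k / (k.factorial : ℂ)‖ ≤ ‖w‖ ^ r / r.factorial := by
  suffices H : ∀ t ∈ Icc (0 : ℝ) 1,
      ‖exp (-(t * w)) - ∑ k ∈ Finset.range r, (-(t * w)) ^ k / (k.factorial : ℂ)‖
        ≤ ‖w‖ ^ r * t ^ r / r.factorial by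
    simpa using H 1 (by simp)
  induction r with
  | zero =>
    intro t ht
    simp only [Finset.range_zero, Finset.sum_empty, sub_zero, pow_zero, norm_exp]
    have : 0 ≤ t * w.re := mul_nonneg ht.1 hw
    simpa using this
  | succ r ih =>
    have hd : ∀ t : ℝ, HasDerivAt (fun t : ℝ => exp (-(t * w))
        - ∑ k ∈ Finset.range (r + 1), (-(t * w)) ^ k / (k.factorial : ℂ))
        (-w * (exp (-(t * w)) - ∑ k ∈ Finset.range r, (-(t * w)) ^ k / (k.factorial : ℂ))) t := by
      intro t
      have h0 : HasDerivAt (fun t : ℝ => -(t * w)) (-w) t := by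
        simpa using (((hasDerivAt_id t).ofReal_comp).mul_const w).fun_neg
      have h1 : HasDerivAt (fun t : ℝ => ∑ k ∈ Finset.range (r + 1),
          (-(t * w)) ^ k / (k.factorial : ℂ))
          (∑ k ∈ Finset.range (r + 1), (k * (-(t * w)) ^ (k - 1) * (-w)) / (k.factorial : ℂ)) t :=
        HasDerivAt.fun_sum fun k _ => (h0.pow k).div_const _
      refine (h0.cexp.sub h1).congr_deriv ?_
      rw [Finset.sum_range_succ', mul_sub, Finset.mul_sum]
      simp only [Nat.cast_zero, zero_mul, zero_div, add_zero]
      rw [mul_comm]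
      congr 1
      refine Finset.sum_congr rfl fun k _ => ?_
      rw [Nat.factorial_succ, Nat.add_sub_cancel]
      have h2 : ((k : ℂ) + 1) ≠ 0 := by exact_mod_cast k.succ_ne_zero
      have h3 : (k.factorial : ℂ) ≠ 0 := by exact_mod_cast k.factorial_ne_zero
      push_cast
      field_simp
    refine image_norm_le_of_norm_deriv_right_le_deriv_boundary
      (fun t _ => (hd t).continuousAt.continuousWithinAt)
      (fun t _ => (hd t).hasDerivWithinAt) (B' := fun t => ‖w‖ ^ (r + 1) * t ^ r / r.factorial)
      ?_ (fun t => ?_) fun t ht => ?_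
    · rw [Finset.sum_range_succ']; simp
    · refine ((((hasDerivAt_id t).pow (r + 1)).const_mul (‖w‖ ^ (r + 1))).div_const
        ((r + 1).factorial : ℝ)).congr_deriv ?_
      rw [Nat.factorial_succ, Nat.add_sub_cancel]
      have h2 : ((r : ℝ) + 1) ≠ 0 := by exact_mod_cast r.succ_ne_zero
      have h3 : (r.factorial : ℝ) ≠ 0 := by exact_mod_cast r.factorial_ne_zero
      simp only [id]
      push_cast
      field_simp
    · rw [norm_mul, norm_neg]
      calc _ ≤ ‖w‖ * (‖w‖ ^ r * t ^ r / r.factorial) := by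
            gcongr; exact ih t ⟨ht.1, ht.2.le⟩
        _ = _ := by ring

lemma factorial_two_mul_le (r : ℕ) : ((2 * r).factorial : ℝ) ≤ 4 ^ r * (r.factorial : ℝ) ^ 2 := by
  have h1 := Nat.choose_mul_factorial_mul_factorial (n := 2 * r) (k := r) (by omega)
  have h2 : 2 * r - r = r := by omega
  rw [h2] at h1
  have h3 : (2 * r).choose r ≤ 4 ^ r := by
    rw [show (4 : ℕ) = 2 ^ 2 by norm_num, ← pow_mul]
    exact Nat.choose_le_two_pow _ _
  rw [← h1]
  push_cast
  rw [mul_assoc, ← sq]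
  gcongr
  exact_mod_cast h3

/-- Gaussian moments of the `r`-th power of the quartic form grow at most like `(r!)²`. -/
lemma exists_integral_quarticForm_pow_le {N : ℕ} (W : Tensor4 N) (l : List (Fin N)) :
    ∃ K σ : ℝ, 0 ≤ K ∧ 0 ≤ σ ∧ ∀ r : ℕ,
      Integrable (fun φ : Fin N → ℝ => |fieldMonomial l φ| * |quarticForm W φ| ^ r
        * Real.exp (-(1 / 2) * ∑ i, φ i ^ 2)) ∧
      ∫ φ : Fin N → ℝ, |fieldMonomial l φ| * |quarticForm W φ| ^ r
        * Real.exp (-(1 / 2) * ∑ i, φ i ^ 2) ≤ K * σ ^ r * (r.factorial : ℝ) ^ 2 := by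
  have hd := integrable_dominating (N := N) (a := 3 / 8) (by norm_num) 0 l 0
  simp only [pow_zero, mul_one, zero_mul, add_zero] at hd
  refine ⟨∫ φ : Fin N → ℝ, |fieldMonomial l φ| * Real.exp (-(3 / 8) * ∑ i, φ i ^ 2),
    tensorNorm W * 256, integral_nonneg fun φ => by positivity,
    mul_nonneg (tensorNorm_nonneg W) (by norm_num), fun r => ?_⟩
  have hp : ∀ φ : Fin N → ℝ, |fieldMonomial l φ| * |quarticForm W φ| ^ r
      * Real.exp (-(1 / 2) * ∑ i, φ i ^ 2)
      ≤ (|fieldMonomial l φ| * Real.exp (-(3 / 8) * ∑ i, φ i ^ 2))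
        * ((tensorNorm W * 256) ^ r * (r.factorial : ℝ) ^ 2) := by
    intro φ
    set s : ℝ := ∑ i, φ i ^ 2
    have hs : 0 ≤ s := Finset.sum_nonneg fun _ _ => sq_nonneg _
    -- half of the Gaussian weight is more than enough to absorb the powers of the field
    have h1 := Real.pow_div_factorial_le_exp (s / 8) (by positivity) (2 * r)
    rw [div_le_iff₀ (by positivity)] at h1
    have h2 : |quarticForm W φ| ^ r
        ≤ (tensorNorm W * 256) ^ r * (r.factorial : ℝ) ^ 2 * Real.exp (s / 8) := by
      calc |quarticForm W φ| ^ r ≤ (tensorNorm W * s ^ 2) ^ r := by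
            gcongr; exact abs_quarticForm_le W φ
        _ = (tensorNorm W * 64) ^ r * (s / 8) ^ (2 * r) := by
            rw [pow_mul, ← mul_pow]; congr 1; ring
        _ ≤ (tensorNorm W * 64) ^ r * (Real.exp (s / 8) * (2 * r).factorial) := by
            have := tensorNorm_nonneg W
            gcongr
        _ ≤ (tensorNorm W * 64) ^ r * (Real.exp (s / 8) * (4 ^ r * (r.factorial : ℝ) ^ 2)) := by
            have := tensorNorm_nonneg W
            gcongr
            exact factorial_two_mul_le r
        _ = ((tensorNorm W * 64) * 4) ^ r * (r.factorial : ℝ) ^ 2 * Real.exp (s / 8) := by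
            rw [mul_pow _ (4 : ℝ)]; ring
        _ = _ := by congr 3; ring
    calc _ ≤ |fieldMonomial l φ| * ((tensorNorm W * 256) ^ r * (r.factorial : ℝ) ^ 2
            * Real.exp (s / 8)) * Real.exp (-(1 / 2) * s) := by gcongr
      _ = |fieldMonomial l φ| * (Real.exp (s / 8) * Real.exp (-(1 / 2) * s))
          * ((tensorNorm W * 256) ^ r * (r.factorial : ℝ) ^ 2) := by ring
      _ = _ := by rw [← Real.exp_add]; congr 3; ring
  have hi : Integrable fun φ : Fin N → ℝ => |fieldMonomial l φ| * |quarticForm W φ| ^ r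
      * Real.exp (-(1 / 2) * ∑ i, φ i ^ 2) := by
    refine (hd.mul_const ((tensorNorm W * 256) ^ r * (r.factorial : ℝ) ^ 2)).mono'
      (Continuous.aestronglyMeasurable (by fun_prop)) (ae_of_all _ fun φ => ?_)
    rw [Real.norm_eq_abs, abs_of_nonneg (by positivity)]
    exact hp φ
  refine ⟨hi, (integral_mono hi (hd.mul_const _) hp).trans_eq ?_⟩
  rw [integral_mul_const, mul_assoc]

lemma exp_sum_sq_eq_ofReal {N : ℕ} (φ : Fin N → ℝ) :
    exp (-(1 / 2) * ((∑ i, φ i ^ 2 : ℝ) : ℂ)) = (Real.exp (-(1 / 2) * ∑ i, φ i ^ 2) : ℝ) := by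
  push_cast; rfl

/-- The perturbative coefficients of a moment. -/
def momentCoeff {N : ℕ} (W : Tensor4 N) (l : List (Fin N)) : PowerSeries ℂ :=
  PowerSeries.mk fun k => (-(1 / 24)) ^ k / (k.factorial : ℂ)
    * ((∫ φ : Fin N → ℝ, fieldMonomial l φ * quarticForm W φ ^ k
      * Real.exp (-(1 / 2) * ∑ i, φ i ^ 2) : ℝ) : ℂ)

lemma hasGevreyExpansion_sourcedMoment {N : ℕ} {W : Tensor4 N}
    (hV : ∀ φ, 0 ≤ quarticForm W φ) (l : List (Fin N)) :
    HasGevreyExpansion {u | 0 ≤ u.re} (fun u => sourcedMoment W l u 0) (momentCoeff W l) := by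
  obtain ⟨K, σ, hK, hσ, h⟩ := exists_integral_quarticForm_pow_le W l
  have hfac : ∀ r : ℕ, (r.factorial : ℝ) ≠ 0 := fun r => by exact_mod_cast r.factorial_ne_zero
  have habs : ∀ (r : ℕ) (φ : Fin N → ℝ), ‖fieldMonomial l φ * quarticForm W φ ^ r
      * Real.exp (-(1 / 2) * ∑ i, φ i ^ 2)‖ = |fieldMonomial l φ| * |quarticForm W φ| ^ r
      * Real.exp (-(1 / 2) * ∑ i, φ i ^ 2) := fun r φ => by
    simp [Real.abs_exp]
  have hint : ∀ r : ℕ, Integrable fun φ : Fin N → ℝ => fieldMonomial l φ * quarticForm W φ ^ r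
      * Real.exp (-(1 / 2) * ∑ i, φ i ^ 2) := fun r =>
    (h r).1.mono' (Continuous.aestronglyMeasurable (by fun_prop))
      (ae_of_all _ fun φ => (habs r φ).le)
  refine ⟨K, σ / 24, hK, by positivity, fun k => ?_, fun r u hu => ?_⟩
  · rw [momentCoeff, PowerSeries.coeff_mk, norm_mul, norm_real]
    have h1 : ‖∫ φ : Fin N → ℝ, fieldMonomial l φ * quarticForm W φ ^ k
        * Real.exp (-(1 / 2) * ∑ i, φ i ^ 2)‖ ≤ K * σ ^ k * (k.factorial : ℝ) ^ 2 := by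
      refine (norm_integral_le_integral_norm _).trans ?_
      simp_rw [habs k]
      exact (h k).2
    have h2 : ‖((-(1 / 24)) ^ k / (k.factorial : ℂ) : ℂ)‖ = (1 / 24) ^ k / k.factorial := by
      simp
    rw [h2]
    calc _ ≤ (1 / 24) ^ k / k.factorial * (K * σ ^ k * (k.factorial : ℝ) ^ 2) := by gcongr
      _ = K * (σ / 24) ^ k * (k.factorial : ℝ) := by
        have := hfac k
        rw [div_pow, div_pow, one_pow]; field_simp
  · have e1 : sourcedMoment W l u 0 - ∑ k ∈ Finset.range r, (momentCoeff W l).coeff k * u ^ k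
        = ∫ φ : Fin N → ℝ, ((fieldMonomial l φ * Real.exp (-(1 / 2) * ∑ i, φ i ^ 2) : ℝ) : ℂ)
          * (exp (-(u * quarticForm W φ / 24))
            - ∑ k ∈ Finset.range r, (-(u * quarticForm W φ / 24)) ^ k / (k.factorial : ℂ)) := by
      have i1 := integrable_sourced_integrand hV l hu 0
      have i2 : ∀ k : ℕ, Integrable fun φ : Fin N → ℝ =>
          ((-(1 / 24)) ^ k / (k.factorial : ℂ) * u ^ k) * ((fieldMonomial l φ
            * quarticForm W φ ^ k * Real.exp (-(1 / 2) * ∑ i, φ i ^ 2) : ℝ) : ℂ) := fun k =>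
        ((hint k).ofReal).const_mul _
      have e2 : ∀ k : ℕ, (momentCoeff W l).coeff k * u ^ k
          = ∫ φ : Fin N → ℝ, ((-(1 / 24)) ^ k / (k.factorial : ℂ) * u ^ k) * ((fieldMonomial l φ
            * quarticForm W φ ^ k * Real.exp (-(1 / 2) * ∑ i, φ i ^ 2) : ℝ) : ℂ) := fun k => by
        rw [integral_const_mul, integral_complex_ofReal, momentCoeff, PowerSeries.coeff_mk]
        ring
      simp_rw [e2]
      rw [← integral_finsetSum _ fun k _ => i2 k, sourcedMoment, ← integral_sub i1
        (integrable_finsetSum _ fun k _ => i2 k)]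
      refine integral_congr_ae (ae_of_all _ fun φ => ?_)
      simp only [Pi.zero_apply, zero_mul, Finset.sum_const_zero, ofReal_zero, add_zero]
      rw [sub_eq_add_neg (-(1 / 2) * ((∑ i, φ i ^ 2 : ℝ) : ℂ)), exp_add, exp_sum_sq_eq_ofReal, mul_sub, Finset.mul_sum (Finset.range r)]
      congr 1
      · rw [show u / (Nat.factorial 4 : ℂ) * (quarticForm W φ : ℂ) = u * quarticForm W φ / 24 by
          norm_num [Nat.factorial]; ring]
        push_cast; ring
      · refine Finset.sum_congr rfl fun k _ => ?_
        rw [show -(u * (quarticForm W φ : ℂ) / 24) = -(1 / 24) * u * quarticForm W φ by ring,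
          mul_pow, mul_pow]
        push_cast; ring
    rw [e1]
    have e3 : ∀ φ : Fin N → ℝ,
        ‖((fieldMonomial l φ * Real.exp (-(1 / 2) * ∑ i, φ i ^ 2) : ℝ) : ℂ)
          * (exp (-(u * quarticForm W φ / 24))
            - ∑ k ∈ Finset.range r, (-(u * quarticForm W φ / 24)) ^ k / (k.factorial : ℂ))‖
        ≤ (‖u‖ / 24) ^ r / r.factorial * (|fieldMonomial l φ| * |quarticForm W φ| ^ r
          * Real.exp (-(1 / 2) * ∑ i, φ i ^ 2)) := fun φ => by
      have h1 : 0 ≤ (u * quarticForm W φ / 24).re := by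
        rw [show (u * quarticForm W φ / 24) = ((quarticForm W φ / 24 : ℝ) : ℂ) * u by
          push_cast; ring, re_ofReal_mul]
        exact mul_nonneg (div_nonneg (hV φ) (by norm_num)) hu
      have h2 := norm_exp_neg_sub_sum_le r h1
      have h3 : ‖u * quarticForm W φ / 24‖ = ‖u‖ / 24 * |quarticForm W φ| := by
        rw [norm_div, norm_mul, norm_real, Real.norm_eq_abs]; norm_num; ring
      rw [h3, mul_pow] at h2
      rw [norm_mul, norm_real, Real.norm_eq_abs, abs_mul, Real.abs_exp]
      calc _ ≤ |fieldMonomial l φ| * Real.exp (-(1 / 2) * ∑ i, φ i ^ 2)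
            * ((‖u‖ / 24) ^ r * |quarticForm W φ| ^ r / r.factorial) := by gcongr
        _ = _ := by ring
    refine (norm_integral_le_of_norm_le ((h r).1.const_mul _) (ae_of_all _ e3)).trans ?_
    rw [integral_const_mul]
    calc _ ≤ (‖u‖ / 24) ^ r / r.factorial * (K * σ ^ r * (r.factorial : ℝ) ^ 2) := by
          gcongr; exact (h r).2
      _ = _ := by
        have := hfac r
        rw [div_pow, div_pow]; field_simp

lemma constantCoeff_momentCoeff_nil {N : ℕ} (W : Tensor4 N) :
    PowerSeries.constantCoeff (momentCoeff W []) = ((Real.sqrt (2 * Real.pi) ^ N : ℝ) : ℂ) := by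
  rw [← PowerSeries.coeff_zero_eq_constantCoeff_apply, momentCoeff, PowerSeries.coeff_mk]
  simp only [fieldMonomial_nil, pow_zero, Nat.factorial_zero, Nat.cast_one, div_one, one_mul]
  rw [integral_gaussian_fields]

/-- Polynomials in the moments and in the inverse of the partition function inherit a Gevrey
expansion. -/
lemma exists_hasGevreyExpansion_eval {N : ℕ} {M : List (Fin N) → ℂ → ℂ} {Ω : Set ℂ}
    {A : List (Fin N) → PowerSeries ℂ} (h : ∀ l, HasGevreyExpansion Ω (M l) (A l))
    (h0 : PowerSeries.constantCoeff (A []) ≠ 0) {C : ℝ}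
    (hC : ∀ u ∈ Ω, M [] u ≠ 0 ∧ ‖(M [] u)⁻¹‖ ≤ C) (p : MomentPoly N) :
    ∃ a, HasGevreyExpansion Ω
      (fun u => MvPolynomial.eval (momentPoint fun l => M l u) p) a := by
  induction p using MvPolynomial.induction_on with
  | C c => exact ⟨_, by simpa using HasGevreyExpansion.const Ω c⟩
  | add p q hp hq =>
    obtain ⟨a, ha⟩ := hp
    obtain ⟨b, hb⟩ := hq
    exact ⟨_, by simpa using ha.add hb⟩
  | mul_X p s hp =>
    obtain ⟨a, ha⟩ := hp
    cases s with
    | some l => exact ⟨_, by simpa [momentPoint] using ha.mul (h l)⟩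
    | none => exact ⟨_, by simpa [momentPoint] using ha.mul ((h []).inv h0 hC)⟩

/-! ### The inverse Laplace transform -/

/-- The point with parameter `ξ` on the vertical line `Re ζ = c`, with the normalization of the
Fourier transform. -/
def verticalLine (c ξ : ℝ) : ℂ := c + ((2 * Real.pi * ξ : ℝ) : ℂ) * I

lemma verticalLine_re (c ξ : ℝ) : (verticalLine c ξ).re = c := by simp [verticalLine]

lemma norm_verticalLine_sq (c ξ : ℝ) : ‖verticalLine c ξ‖ ^ 2 = c ^ 2 + (2 * Real.pi * ξ) ^ 2 := by
  rw [verticalLine, Complex.sq_norm, normSq_add_mul_I]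

@[fun_prop]
lemma continuous_verticalLine (c : ℝ) : Continuous (verticalLine c) := by
  unfold verticalLine; fun_prop

lemma integral_inv_sq_add_sq {c : ℝ} (hc : 0 < c) :
    Integrable (fun ξ : ℝ => (c ^ 2 + (2 * Real.pi * ξ) ^ 2)⁻¹) ∧
      ∫ ξ : ℝ, (c ^ 2 + (2 * Real.pi * ξ) ^ 2)⁻¹ = 1 / (2 * c) := by
  have hπ := Real.pi_pos
  have e : ∀ ξ : ℝ, (c ^ 2 + (2 * Real.pi * ξ) ^ 2)⁻¹
      = (c ^ 2)⁻¹ * (1 + (2 * Real.pi / c * ξ) ^ 2)⁻¹ := fun ξ => by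
    rw [← mul_inv]; congr 1; field_simp
  simp_rw [e]
  refine ⟨(integrable_inv_one_add_sq.comp_mul_left' (by positivity)).const_mul _, ?_⟩
  rw [integral_const_mul, Measure.integral_comp_mul_left (fun x : ℝ => (1 + x ^ 2)⁻¹),
    integral_univ_inv_one_add_sq, abs_of_pos (by positivity), smul_eq_mul]
  field_simp

/-- The inverse Laplace transform `(2πi)⁻¹ ∫ e^{tζ} g(ζ) dζ` along the line `Re ζ = c`. -/
def laplaceInverse (c : ℝ) (g : ℂ → ℂ) (t : ℝ) : ℂ :=
  ∫ ξ : ℝ, exp (t * verticalLine c ξ) * g (verticalLine c ξ)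

section

variable {c₀ M : ℝ} {g : ℂ → ℂ}

lemma continuous_comp_verticalLine (hg : DifferentiableOn ℂ g {ζ | c₀ < ζ.re}) {c : ℝ}
    (hc : c₀ < c) : Continuous fun ξ => g (verticalLine c ξ) :=
  hg.continuousOn.comp_continuous (continuous_verticalLine c) fun ξ => by
    rw [mem_ofPred_eq, verticalLine_re]; exact hc

lemma norm_exp_mul_verticalLine (t c ξ : ℝ) :
    ‖exp (t * verticalLine c ξ)‖ = Real.exp (t * c) := by
  rw [norm_exp, re_ofReal_mul, verticalLine_re]

lemma norm_laplace_integrand_le (hM : ∀ ζ : ℂ, c₀ < ζ.re → ‖g ζ‖ ≤ M / ‖ζ‖ ^ 2) {c : ℝ}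
    (hc : c₀ < c) (t ξ : ℝ) :
    ‖exp (t * verticalLine c ξ) * g (verticalLine c ξ)‖
      ≤ Real.exp (t * c) * M * (c ^ 2 + (2 * Real.pi * ξ) ^ 2)⁻¹ := by
  rw [norm_mul, norm_exp_mul_verticalLine, mul_assoc, ← norm_verticalLine_sq, ← div_eq_mul_inv]
  gcongr
  exact hM _ (by rwa [verticalLine_re])

lemma integrable_laplace_integrand (hc₀ : 0 ≤ c₀) (hg : DifferentiableOn ℂ g {ζ | c₀ < ζ.re})
    (hM : ∀ ζ : ℂ, c₀ < ζ.re → ‖g ζ‖ ≤ M / ‖ζ‖ ^ 2) {c : ℝ} (hc : c₀ < c) (t : ℝ) :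
    Integrable fun ξ => exp (t * verticalLine c ξ) * g (verticalLine c ξ) := by
  have h := continuous_comp_verticalLine hg hc
  exact ((integral_inv_sq_add_sq (hc₀.trans_lt hc)).1.const_mul (Real.exp (t * c) * M)).mono'
    (Continuous.mul (by fun_prop) h).aestronglyMeasurable
    (ae_of_all _ fun ξ => norm_laplace_integrand_le hM hc t ξ)

lemma norm_laplaceInverse_le (hc₀ : 0 ≤ c₀)
    (hM : ∀ ζ : ℂ, c₀ < ζ.re → ‖g ζ‖ ≤ M / ‖ζ‖ ^ 2) {c : ℝ} (hc : c₀ < c) (t : ℝ) :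
    ‖laplaceInverse c g t‖ ≤ M * Real.exp (t * c) / (2 * c) := by
  obtain ⟨h1, h2⟩ := integral_inv_sq_add_sq (hc₀.trans_lt hc)
  refine (norm_integral_le_of_norm_le (h1.const_mul (Real.exp (t * c) * M))
    (ae_of_all _ fun ξ => norm_laplace_integrand_le hM hc t ξ)).trans_eq ?_
  rw [integral_const_mul, h2]
  ring

lemma nonneg_of_norm_le_div (hc₀ : 0 ≤ c₀) (hM : ∀ ζ : ℂ, c₀ < ζ.re → ‖g ζ‖ ≤ M / ‖ζ‖ ^ 2)
    {c : ℝ} (hc : c₀ < c) : 0 ≤ M := by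
  have hc1 : 0 < c := hc₀.trans_lt hc
  have := (norm_nonneg _).trans (norm_laplaceInverse_le hc₀ hM hc 0)
  rw [zero_mul, Real.exp_zero, mul_one] at this
  by_contra hneg
  exact absurd this (not_le.2 (div_neg_of_neg_of_pos (not_le.1 hneg) (by positivity)))

/-- By Cauchy's theorem the inverse Laplace transform does not depend on the line of
integration. -/
lemma laplaceInverse_shift (hc₀ : 0 ≤ c₀) (hg : DifferentiableOn ℂ g {ζ | c₀ < ζ.re})
    (hM : ∀ ζ : ℂ, c₀ < ζ.re → ‖g ζ‖ ≤ M / ‖ζ‖ ^ 2) {c c' : ℝ} (hc : c₀ < c) (hcc : c ≤ c')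
    (t : ℝ) : laplaceInverse c g t = laplaceInverse c' g t := by
  set F : ℂ → ℂ := fun ζ => exp (t * ζ) * g ζ with hF
  have hM0 : 0 ≤ M := nonneg_of_norm_le_div hc₀ hM hc
  have hrect : ∀ S : ℝ, 0 < S → ‖(∫ y in (-S)..S, F (c' + y * I)) - ∫ y in (-S)..S, F (c + y * I)‖
      ≤ 2 * (Real.exp (|t| * c') * (M * (S⁻¹ * S⁻¹)) * |c' - c|) := by
    intro S hS
    have h0 := integral_boundary_rect_eq_zero_of_differentiableOn F (c + ((-S : ℝ) : ℂ) * I)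
      (c' + (S : ℂ) * I) (by
        refine DifferentiableOn.mul (by fun_prop) (hg.mono ?_)
        intro ζ hζ
        rw [mem_reProdIm] at hζ
        simp only [add_re, ofReal_re, mul_re, I_re, mul_zero, ofReal_im, I_im, mul_one, sub_self,
          add_zero, uIcc_of_le hcc] at hζ
        exact hc.trans_le hζ.1.1)
    simp only [add_re, ofReal_re, mul_re, I_re, mul_zero, ofReal_im, I_im, mul_one, sub_self,
      add_zero, add_im, mul_im, zero_add] at h0
    have hb : ∀ s : ℝ, |s| = |S| → ‖∫ x in c..c', F (x + s * I)‖
        ≤ Real.exp (|t| * c') * (M * (S⁻¹ * S⁻¹)) * |c' - c| := by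
      intro s hs
      refine intervalIntegral.norm_integral_le_of_norm_le_const fun x hx => ?_
      rw [uIoc_of_le hcc] at hx
      have hre : ((x : ℂ) + s * I).re = x := by simp
      have hx0 : c₀ < x := hc.trans hx.1
      have h1 := hM ((x : ℂ) + s * I) (by rwa [hre])
      rw [hF, norm_mul, norm_exp, re_ofReal_mul, hre]
      have h2 : t * x ≤ |t| * c' :=
        mul_le_mul (le_abs_self t) hx.2 (hc₀.trans hx0.le) (abs_nonneg t)
      have h3 : M / ‖(x : ℂ) + s * I‖ ^ 2 ≤ M * (S⁻¹ * S⁻¹) := by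
        rw [div_eq_mul_inv]
        gcongr
        rw [Complex.sq_norm, normSq_add_mul_I, ← sq_abs s, hs, sq_abs, ← mul_inv, ← sq]
        gcongr
        nlinarith [sq_nonneg x]
      gcongr
      exact h1.trans h3
    have hi1 := hb (-S) (abs_neg S)
    have hi2 := hb S rfl
    have h5 : (∫ y in (-S)..S, F (c' + y * I)) - ∫ y in (-S)..S, F (c + y * I)
        = I * ((∫ x in c..c', F (x + ((-S : ℝ) : ℂ) * I)) - ∫ x in c..c', F (x + S * I)) := by
      simp only [smul_eq_mul] at h0
      linear_combination (-I) * h0 + ((∫ y in (-S)..S, F (c' + y * I))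
        - ∫ y in (-S)..S, F (c + y * I)) * (I_mul_I)
    rw [h5, norm_mul, norm_I, one_mul]
    refine (norm_sub_le _ _).trans ?_
    linarith
  have hint : ∀ d : ℝ, c₀ < d → Integrable fun y : ℝ => F (d + y * I) := by
    intro d hd
    have h1 := (integrable_laplace_integrand hc₀ hg hM hd t).comp_mul_left'
      (inv_ne_zero (mul_ne_zero two_ne_zero Real.pi_ne_zero))
    refine h1.congr (ae_of_all _ fun y => ?_)
    have : verticalLine d ((2 * Real.pi)⁻¹ * y) = d + y * I := by
      rw [verticalLine, mul_inv_cancel_left₀ (mul_ne_zero two_ne_zero Real.pi_ne_zero)]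
    simp only [this, hF]
  have hlim : ∀ d : ℝ, c₀ < d → Filter.Tendsto (fun S : ℝ => ∫ y in (-S)..S, F (d + y * I))
      Filter.atTop (nhds (∫ y : ℝ, F (d + y * I))) := fun d hd =>
    intervalIntegral_tendsto_integral (hint d hd) Filter.tendsto_neg_atTop_atBot Filter.tendsto_id
  have heq : ∫ y : ℝ, F (c' + y * I) = ∫ y : ℝ, F (c + y * I) := by
    have h1 := (hlim c' (hc.trans_le hcc)).sub (hlim c hc)
    have h2 : Filter.Tendsto (fun S : ℝ => 2 * (Real.exp (|t| * c') * (M * (S⁻¹ * S⁻¹))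
        * |c' - c|)) Filter.atTop (nhds (2 * (Real.exp (|t| * c') * (M * (0 * 0)) * |c' - c|))) :=
      ((((tendsto_inv_atTop_zero.mul tendsto_inv_atTop_zero).const_mul M).const_mul _).mul_const
        _).const_mul 2
    simp only [mul_zero, zero_mul] at h2
    exact sub_eq_zero.1 (tendsto_nhds_unique h1 (squeeze_zero_norm'
      ((Filter.eventually_gt_atTop 0).mono hrect) h2))
  have hconv : ∀ d : ℝ, laplaceInverse d g t = |(2 * Real.pi)⁻¹| • ∫ y : ℝ, F (d + y * I) :=
    fun d => by
      rw [← Measure.integral_comp_mul_left (fun y : ℝ => F (d + y * I))]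
      rfl
  rw [hconv, hconv, heq]

/-- Pushing the line of integration to the right shows that the inverse Laplace transform vanishes
for nonpositive times. -/
lemma laplaceInverse_eq_zero (hc₀ : 0 ≤ c₀) (hg : DifferentiableOn ℂ g {ζ | c₀ < ζ.re})
    (hM : ∀ ζ : ℂ, c₀ < ζ.re → ‖g ζ‖ ≤ M / ‖ζ‖ ^ 2) {c : ℝ} (hc : c₀ < c) {t : ℝ} (ht : t ≤ 0) :
    laplaceInverse c g t = 0 := by
  have hM0 : 0 ≤ M := nonneg_of_norm_le_div hc₀ hM hc
  have h1 : ∀ᶠ c' : ℝ in Filter.atTop, ‖laplaceInverse c g t‖ ≤ M / 2 * c'⁻¹ := by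
    filter_upwards [Filter.eventually_ge_atTop c] with c' hc'
    have hc1 : 0 < c' := hc₀.trans_lt (hc.trans_le hc')
    rw [laplaceInverse_shift hc₀ hg hM hc hc' t]
    refine (norm_laplaceInverse_le hc₀ hM (hc.trans_le hc') t).trans ?_
    have : Real.exp (t * c') ≤ 1 := Real.exp_le_one_iff.2 (mul_nonpos_of_nonpos_of_nonneg ht hc1.le)
    calc M * Real.exp (t * c') / (2 * c') ≤ M * 1 / (2 * c') := by gcongr
      _ = _ := by field_simp
  have h2 := (tendsto_inv_atTop_zero (𝕜 := ℝ)).const_mul (M / 2)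
  rw [mul_zero] at h2
  exact norm_le_zero_iff.1 (ge_of_tendsto h2 h1)

lemma continuous_laplaceInverse (hc₀ : 0 ≤ c₀) (hg : DifferentiableOn ℂ g {ζ | c₀ < ζ.re})
    (hM : ∀ ζ : ℂ, c₀ < ζ.re → ‖g ζ‖ ≤ M / ‖ζ‖ ^ 2) {c : ℝ} (hc : c₀ < c) :
    Continuous (laplaceInverse c g) := by
  have hi : Integrable fun ξ => g (verticalLine c ξ) := by
    simpa using integrable_laplace_integrand hc₀ hg hM hc 0
  have h := continuous_comp_verticalLine hg hc
  rw [continuous_iff_continuousAt]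
  intro t₀
  refine continuousAt_of_dominated (bound := fun ξ => Real.exp ((t₀ + 1) * c)
    * ‖g (verticalLine c ξ)‖) (Filter.Eventually.of_forall fun t =>
      (Continuous.mul (by fun_prop) h).aestronglyMeasurable) ?_ (hi.norm.const_mul _)
      (ae_of_all _ fun ξ => by fun_prop)
  filter_upwards [Iio_mem_nhds (lt_add_one t₀)] with t ht
  refine ae_of_all _ fun ξ => ?_
  rw [norm_mul, norm_exp_mul_verticalLine]
  have : 0 < c := hc₀.trans_lt hc
  have := (mem_Iio.1 ht).le
  gcongr

lemma hasDerivAt_laplaceInverse (hc₀ : 0 ≤ c₀) (hg : DifferentiableOn ℂ g {ζ | c₀ < ζ.re})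
    (hM : ∀ ζ : ℂ, c₀ < ζ.re → ‖g ζ‖ ≤ M / ‖ζ‖ ^ 2) {c : ℝ} (hc : c₀ < c) (t₀ : ℝ) :
    HasDerivAt (laplaceInverse c fun ζ => g ζ / ζ) (laplaceInverse c g t₀) t₀ := by
  have hi : Integrable fun ξ => g (verticalLine c ξ) := by
    simpa using integrable_laplace_integrand hc₀ hg hM hc 0
  have h := continuous_comp_verticalLine hg hc
  have hc1 : 0 < c := hc₀.trans_lt hc
  have hne : ∀ ξ, verticalLine c ξ ≠ 0 := fun ξ h0 => by
    have := verticalLine_re c ξ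
    rw [h0, zero_re] at this
    exact hc1.ne this
  have hc' : Continuous fun ξ => g (verticalLine c ξ) / verticalLine c ξ :=
    h.div (by fun_prop) hne
  have hle : ∀ ξ, ‖g (verticalLine c ξ) / verticalLine c ξ‖ ≤ c⁻¹ * ‖g (verticalLine c ξ)‖ := by
    intro ξ
    have : c ≤ ‖verticalLine c ξ‖ := by
      have := (le_abs_self _).trans (abs_re_le_norm (verticalLine c ξ))
      rwa [verticalLine_re] at this
    rw [norm_div, div_eq_inv_mul]
    gcongr
  have hi' : Integrable fun ξ => g (verticalLine c ξ) / verticalLine c ξ :=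
    (hi.norm.const_mul c⁻¹).mono' hc'.aestronglyMeasurable (ae_of_all _ hle)
  refine (hasDerivAt_integral_of_dominated_loc_of_deriv_le (𝕜 := ℝ) (s := Iio (t₀ + 1))
    (F := fun t ξ => exp (t * verticalLine c ξ) * (g (verticalLine c ξ) / verticalLine c ξ))
    (F' := fun t ξ => exp (t * verticalLine c ξ) * g (verticalLine c ξ))
    (bound := fun ξ => Real.exp ((t₀ + 1) * c) * ‖g (verticalLine c ξ)‖)
    (Iio_mem_nhds (lt_add_one t₀)) (Filter.Eventually.of_forall fun t =>
      (Continuous.mul (by fun_prop) hc').aestronglyMeasurable) ?_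
      (Continuous.mul (by fun_prop) h).aestronglyMeasurable ?_ (hi.norm.const_mul _) ?_).2
  · refine (hi'.norm.const_mul (Real.exp (t₀ * c))).mono'
      (Continuous.mul (by fun_prop) hc').aestronglyMeasurable (ae_of_all _ fun ξ => ?_)
    rw [norm_mul, norm_exp_mul_verticalLine]
  · refine ae_of_all _ fun ξ t ht => ?_
    rw [norm_mul, norm_exp_mul_verticalLine]
    have := (mem_Iio.1 ht).le
    gcongr
  · refine ae_of_all _ fun ξ t _ => ?_
    have h1 : HasDerivAt (fun t : ℝ => (t : ℂ) * verticalLine c ξ) (verticalLine c ξ) t := by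
      simpa using ((hasDerivAt_id t).ofReal_comp).mul_const (verticalLine c ξ)
    refine (h1.cexp.mul_const (g (verticalLine c ξ) / verticalLine c ξ)).congr_deriv ?_
    have := hne ξ
    field_simp

end

section

open FourierTransform

variable {c₀ M : ℝ} {g : ℂ → ℂ}

lemma laplaceInverse_eq_fourierInv (c : ℝ) (g : ℂ → ℂ) (t : ℝ) :
    laplaceInverse c g t = Real.exp (t * c) * 𝓕⁻ (fun ξ => g (verticalLine c ξ)) t := by
  rw [Real.fourierInv_eq', ← integral_const_mul]
  refine integral_congr_ae (ae_of_all _ fun ξ => ?_)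
  simp only [smul_eq_mul, RCLike.inner_apply, conj_trivial]
  rw [← mul_assoc, ofReal_exp, ← exp_add, verticalLine]
  congr 2
  push_cast
  ring

lemma fourier_eq_fourierInv_neg (G : ℝ → ℂ) (t : ℝ) : 𝓕 G t = 𝓕⁻ G (-t) := by
  rw [Real.fourierInv_eq_fourier_neg, neg_neg]

/-- The Laplace transform inverts the inverse Laplace transform. -/
lemma integral_exp_mul_laplaceInverse (hc₀ : 0 ≤ c₀)
    (hg : DifferentiableOn ℂ g {ζ | c₀ < ζ.re})
    (hM : ∀ ζ : ℂ, c₀ < ζ.re → ‖g ζ‖ ≤ M / ‖ζ‖ ^ 2) {c : ℝ} (hc : c₀ < c) {z : ℂ}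
    (hz : c < z.re) :
    IntegrableOn (fun t : ℝ => laplaceInverse c g t * exp (-t * z)) (Ioi 0) ∧
      ∫ t in Ioi (0 : ℝ), laplaceInverse c g t * exp (-t * z) = g z := by
  have hc1 : 0 < c := hc₀.trans_lt hc
  set G : ℝ → ℂ := fun ξ => g (verticalLine z.re ξ) with hG
  have hGc : Continuous G := continuous_comp_verticalLine hg (hc.trans hz)
  have hGi : Integrable G := by
    simpa using integrable_laplace_integrand hc₀ hg hM (hc.trans hz) 0
  have hh := continuous_laplaceInverse hc₀ hg hM hc
  have hinv : ∀ t, 𝓕⁻ G t = Real.exp (-(t * z.re)) * laplaceInverse c g t := by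
    intro t
    rw [laplaceInverse_shift hc₀ hg hM hc hz.le t, laplaceInverse_eq_fourierInv, ← mul_assoc,
      ← ofReal_mul, ← Real.exp_add, neg_add_cancel, Real.exp_zero, ofReal_one, one_mul]
  have hbase : IntegrableOn (fun t : ℝ => M / (2 * c) * Real.exp (-(z.re - c) * t)) (Ioi 0) :=
    (exp_neg_integrableOn_Ioi 0 (sub_pos.2 hz)).const_mul _
  have hle : ∀ t : ℝ, Real.exp (-(t * z.re)) * ‖laplaceInverse c g t‖
      ≤ M / (2 * c) * Real.exp (-(z.re - c) * t) := by
    intro t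
    calc _ ≤ Real.exp (-(t * z.re)) * (M * Real.exp (t * c) / (2 * c)) := by
          gcongr; exact norm_laplaceInverse_le hc₀ hM hc t
      _ = M / (2 * c) * (Real.exp (-(t * z.re)) * Real.exp (t * c)) := by ring
      _ = _ := by rw [← Real.exp_add]; congr 2; ring
  have hvanish : ∀ t, t ∉ Ioi (0 : ℝ) → laplaceInverse c g t = 0 := fun t ht =>
    laplaceInverse_eq_zero hc₀ hg hM hc (not_lt.1 ht)
  have hIi : Integrable (𝓕⁻ G) := by
    have h1 : IntegrableOn (𝓕⁻ G) (Ioi 0) := by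
      refine hbase.mono' ?_ (ae_of_all _ fun t => ?_)
      · rw [funext hinv]
        exact Continuous.aestronglyMeasurable (by fun_prop)
      · rw [hinv, norm_mul, norm_real, Real.norm_eq_abs, Real.abs_exp]
        exact hle t
    rw [integrableOn_iff_integrable_of_support_subset] at h1
    · exact h1
    · intro t ht
      by_contra h0
      exact ht (by rw [hinv, hvanish t h0, mul_zero])
  have hFi : Integrable (𝓕 G) := by
    rw [funext (fourier_eq_fourierInv_neg G)]
    exact hIi.comp_neg
  have hline : verticalLine z.re (z.im / (2 * Real.pi)) = z := by
    rw [verticalLine, mul_div_cancel₀ _ (mul_ne_zero two_ne_zero Real.pi_ne_zero), re_add_im]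
  constructor
  · refine hbase.mono' (Continuous.aestronglyMeasurable (by fun_prop)) (ae_of_all _ fun t => ?_)
    have : (-(t : ℂ) * z).re = -(t * z.re) := by
      rw [neg_mul, neg_re, re_ofReal_mul]
    rw [norm_mul, norm_exp, this, mul_comm]
    exact hle t
  · have h1 := congrFun (hGc.fourier_fourierInv_eq hGi hFi) (z.im / (2 * Real.pi))
    rw [Real.fourier_real_eq_integral_exp_smul, hG] at h1
    simp only [hline] at h1
    rw [← h1, setIntegral_eq_integral_of_forall_compl_eq_zero fun t ht => by
      rw [hvanish t ht, zero_mul]]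
    refine integral_congr_ae (ae_of_all _ fun t => ?_)
    have h2 := hinv t
    rw [hG] at h2
    simp only [smul_eq_mul]
    rw [h2, ofReal_exp, ← mul_assoc, ← exp_add, mul_comm]
    congr 2
    have hπ : (Real.pi : ℂ) ≠ 0 := by exact_mod_cast Real.pi_ne_zero
    conv_lhs => rw [← re_add_im z]
    push_cast
    field_simp
    ring

lemma integral_mul_exp_neg {s : ℂ} (hs : 0 < s.re) :
    IntegrableOn (fun t : ℝ => (t : ℂ) * exp (-t * s)) (Ioi 0) ∧
      ∫ t in Ioi (0 : ℝ), (t : ℂ) * exp (-t * s) = (s ^ 2)⁻¹ := by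
  have hs0 : s ≠ 0 := fun h => by simp [h] at hs
  have hle : ∀ t : ℝ, 0 ≤ t → ‖(t : ℂ) * exp (-t * s)‖
      ≤ 2 / s.re * Real.exp (-(s.re / 2) * t) := by
    intro t ht
    have : (-(t : ℂ) * s).re = -(t * s.re) := by rw [neg_mul, neg_re, re_ofReal_mul]
    rw [norm_mul, norm_exp, this, norm_real, Real.norm_eq_abs, abs_of_nonneg ht]
    have h1 : t * s.re / 2 ≤ Real.exp (t * s.re / 2) :=
      (le_add_of_nonneg_right zero_le_one).trans (Real.add_one_le_exp _)
    calc t * Real.exp (-(t * s.re)) = 2 / s.re * ((t * s.re / 2) * Real.exp (-(t * s.re))) := by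
          field_simp
      _ ≤ 2 / s.re * (Real.exp (t * s.re / 2) * Real.exp (-(t * s.re))) := by gcongr
      _ = _ := by rw [← Real.exp_add]; congr 2; ring
  have hint : IntegrableOn (fun t : ℝ => (t : ℂ) * exp (-t * s)) (Ioi 0) := by
    refine ((exp_neg_integrableOn_Ioi 0 (half_pos hs)).const_mul (2 / s.re)).mono'
      (Continuous.aestronglyMeasurable (by fun_prop)) ?_
    exact (ae_restrict_iff' measurableSet_Ioi).2 (ae_of_all _ fun t ht => hle t (le_of_lt ht))
  refine ⟨hint, ?_⟩
  have hder : ∀ t : ℝ, HasDerivAt (fun t : ℝ => -((t : ℂ) / s + (s ^ 2)⁻¹) * exp (-t * s))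
      ((t : ℂ) * exp (-t * s)) t := by
    intro t
    have h0 : HasDerivAt (fun t : ℝ => (t : ℂ)) 1 t := by
      simpa using (hasDerivAt_id t).ofReal_comp
    have h1 : HasDerivAt (fun t : ℝ => -((t : ℂ) / s + (s ^ 2)⁻¹)) (-(1 / s)) t :=
      ((h0.div_const s).add_const _).fun_neg
    have h2 : HasDerivAt (fun t : ℝ => -(t : ℂ) * s) (-1 * s) t := h0.fun_neg.mul_const s
    refine (h1.mul h2.cexp).congr_deriv ?_
    field_simp
    ring
  have hexp : Filter.Tendsto (fun t : ℝ => Real.exp (-(s.re / 2) * t)) Filter.atTop (nhds 0) :=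
    Real.tendsto_exp_atBot.comp
      ((Filter.tendsto_const_mul_atBot_of_neg (by linarith)).2 Filter.tendsto_id)
  have hbd : Filter.Tendsto (fun t : ℝ => 2 / s.re * Real.exp (-(s.re / 2) * t)) Filter.atTop
      (nhds 0) := by
    simpa using hexp.const_mul (2 / s.re)
  have hlim : Filter.Tendsto (fun t : ℝ => -((t : ℂ) / s + (s ^ 2)⁻¹) * exp (-t * s))
      Filter.atTop (nhds 0) := by
    have h1 : Filter.Tendsto (fun t : ℝ => (t : ℂ) * exp (-t * s)) Filter.atTop (nhds 0) :=
      squeeze_zero_norm' ((Filter.eventually_ge_atTop 0).mono hle) hbd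
    have h2 : Filter.Tendsto (fun t : ℝ => exp (-t * s)) Filter.atTop (nhds 0) := by
      refine squeeze_zero_norm' ((Filter.eventually_ge_atTop 1).mono fun t ht => ?_) hbd
      refine le_trans ?_ (hle t (zero_le_one.trans ht))
      rw [norm_mul, norm_real, Real.norm_eq_abs, abs_of_nonneg (zero_le_one.trans ht)]
      exact le_mul_of_one_le_left (norm_nonneg _) ht
    have h3 := ((h1.const_mul (s⁻¹)).add (h2.const_mul ((s ^ 2)⁻¹))).neg
    simp only [mul_zero, add_zero, neg_zero] at h3
    refine h3.congr fun t => ?_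
    ring
  rw [integral_Ioi_of_hasDerivAt_of_tendsto' (fun t _ => hder t) hint hlim]
  simp

lemma laplaceInverse_inv_sq {c : ℝ} (hc : 0 < c) {t : ℝ} (ht : 0 ≤ t) :
    laplaceInverse c (fun ζ => (ζ ^ 2)⁻¹) t = t := by
  set f : ℝ → ℂ := fun t => ((max t 0 : ℝ) : ℂ) * exp (-t * c) with hf
  have hfc : Continuous f := by fun_prop
  have hvan : ∀ t, t ∉ Ioi (0 : ℝ) → f t = 0 := fun t ht => by
    rw [hf]; simp only; rw [max_eq_right (not_lt.1 ht), ofReal_zero, zero_mul]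
  have hfi : Integrable f := by
    rw [← integrableOn_iff_integrable_of_support_subset (s := Ioi 0) fun t ht => by
      by_contra h0; exact ht (hvan t h0)]
    refine ((integral_mul_exp_neg (s := c) (by simpa using hc)).1).congr_fun (fun t ht => ?_)
      measurableSet_Ioi
    simp only [hf]
    rw [max_eq_left (le_of_lt ht)]
  have hF : 𝓕 f = fun ξ => (verticalLine c ξ ^ 2)⁻¹ := by
    ext ξ
    rw [Real.fourier_real_eq_integral_exp_smul,
      ← (integral_mul_exp_neg (s := verticalLine c ξ) (by rwa [verticalLine_re])).2,
      ← setIntegral_eq_integral_of_forall_compl_eq_zero (s := Ioi 0) fun t ht => by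
        rw [hvan t ht, smul_zero]]
    refine setIntegral_congr_fun measurableSet_Ioi fun t ht => ?_
    simp only [hf, smul_eq_mul]
    rw [max_eq_left (le_of_lt ht), mul_left_comm, ← exp_add, verticalLine]
    congr 2
    push_cast
    ring
  have hFi : Integrable (𝓕 f) := by
    rw [hF]
    have h1 : Continuous fun ξ => (verticalLine c ξ ^ 2)⁻¹ := by
      refine Continuous.inv₀ (by fun_prop) fun ξ => pow_ne_zero 2 fun h => ?_
      have := verticalLine_re c ξ
      rw [h, zero_re] at this
      exact hc.ne this
    refine (integral_inv_sq_add_sq hc).1.mono' h1.aestronglyMeasurable (ae_of_all _ fun ξ => ?_)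
    rw [norm_inv, norm_pow, norm_verticalLine_sq]
  have h := congrFun (hfc.fourierInv_fourier_eq hfi hFi) t
  rw [hF] at h
  rw [laplaceInverse_eq_fourierInv, h, hf]
  simp only
  rw [max_eq_left ht, mul_left_comm, ofReal_exp, ← exp_add]
  push_cast
  rw [neg_mul, add_neg_cancel, exp_zero, mul_one]

end

/-! ### Analytic extension of Gevrey towers -/

/-- A sequence of functions on `[0, ∞)` each of which is the derivative of its predecessor, with
bounds of factorial type. It consists of the successive derivatives of a function that is
analytic near the half-line. -/
structure IsGevreyTower (b : ℕ → ℝ → ℂ) (C σ c : ℝ) : Prop where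
  sigma_pos : 0 < σ
  rate_nonneg : 0 ≤ c
  hasDerivWithinAt : ∀ m t, 0 ≤ t → HasDerivWithinAt (b m) (b (m + 1) t) (Ici t) t
  continuousOn : ∀ m, ContinuousOn (b m) (Ici 0)
  norm_le : ∀ m t, 0 ≤ t → ‖b m t‖ ≤ C * σ ^ m * m.factorial * Real.exp (c * t)

/-- The Taylor series at `x` of the function whose derivatives are given by `b`. -/
def taylorPatch (b : ℕ → ℝ → ℂ) (x : ℝ) (w : ℂ) : ℂ :=
  ∑' m : ℕ, b m x / (m.factorial : ℂ) * (w - x) ^ m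

namespace IsGevreyTower

variable {b : ℕ → ℝ → ℂ} {C σ c : ℝ}

lemma const_nonneg (h : IsGevreyTower b C σ c) : 0 ≤ C := by
  simpa using (norm_nonneg _).trans (h.norm_le 0 0 le_rfl)

lemma norm_term_le (h : IsGevreyTower b C σ c) {x : ℝ} (hx : 0 ≤ x) (w : ℂ) (m : ℕ) :
    ‖b m x / (m.factorial : ℂ) * (w - x) ^ m‖
      ≤ C * Real.exp (c * x) * (σ * ‖w - x‖) ^ m := by
  have h1 := h.norm_le m x hx
  have hf : (0 : ℝ) < m.factorial := by exact_mod_cast m.factorial_pos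
  rw [norm_mul, norm_div, norm_natCast, norm_pow]
  calc ‖b m x‖ / m.factorial * ‖w - x‖ ^ m
      ≤ (C * σ ^ m * m.factorial * Real.exp (c * x)) / m.factorial * ‖w - x‖ ^ m := by gcongr
    _ = _ := by rw [mul_pow]; field_simp

lemma summable_term (h : IsGevreyTower b C σ c) {x : ℝ} (hx : 0 ≤ x) {w : ℂ}
    (hw : ‖w - x‖ < σ⁻¹) : Summable fun m : ℕ => b m x / (m.factorial : ℂ) * (w - x) ^ m := by
  have hσ := h.sigma_pos
  refine Summable.of_norm_bounded ((summable_geometric_of_lt_one (by positivity)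
    ?_).mul_left (C * Real.exp (c * x))) (h.norm_term_le hx w)
  calc σ * ‖w - x‖ < σ * σ⁻¹ := by gcongr
    _ = 1 := mul_inv_cancel₀ hσ.ne'

lemma norm_taylorPatch_le (h : IsGevreyTower b C σ c) {x : ℝ} (hx : 0 ≤ x) {w : ℂ}
    (hw : ‖w - x‖ < (2 * σ)⁻¹) : ‖taylorPatch b x w‖ ≤ 2 * C * Real.exp (c * x) := by
  have hσ := h.sigma_pos
  have hC := h.const_nonneg
  have h1 : σ * ‖w - x‖ ≤ 1 / 2 := by
    calc σ * ‖w - x‖ ≤ σ * (2 * σ)⁻¹ := by gcongr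
      _ = 1 / 2 := by field_simp
  have h2 : HasSum (fun m : ℕ => C * Real.exp (c * x) * (1 / 2 : ℝ) ^ m)
      (C * Real.exp (c * x) * 2) := by
    have := (hasSum_geometric_of_lt_one (r := (1 / 2 : ℝ)) (by norm_num) (by norm_num)).mul_left
      (C * Real.exp (c * x))
    norm_num at this ⊢
    exact this
  refine (tsum_of_norm_bounded h2 fun m => (h.norm_term_le hx w m).trans ?_).trans_eq (by ring)
  gcongr

lemma analyticOnNhd_taylorPatch (h : IsGevreyTower b C σ c) {x : ℝ} (hx : 0 ≤ x) :
    AnalyticOnNhd ℂ (taylorPatch b x) (Metric.ball (x : ℂ) σ⁻¹) := by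
  have hσ := h.sigma_pos
  have hC := h.const_nonneg
  refine DifferentiableOn.analyticOnNhd (fun w hw => ?_) Metric.isOpen_ball
  rw [mem_ball_iff_norm] at hw
  obtain ⟨ρ, h1, h2⟩ := exists_between hw
  have hρ : 0 ≤ ρ := (norm_nonneg _).trans h1.le
  have h3 : σ * ρ < 1 := by
    calc σ * ρ < σ * σ⁻¹ := by gcongr
      _ = 1 := mul_inv_cancel₀ hσ.ne'
  have hd : DifferentiableOn ℂ (taylorPatch b x) (Metric.ball (x : ℂ) ρ) := by
    refine differentiableOn_tsum_of_summable_norm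
      ((summable_geometric_of_lt_one (by positivity) h3).mul_left (C * Real.exp (c * x)))
      (fun m => by fun_prop) Metric.isOpen_ball fun m v hv => (h.norm_term_le hx v m).trans ?_
    rw [mem_ball_iff_norm] at hv
    gcongr
  exact (hd.differentiableAt (Metric.isOpen_ball.mem_nhds
    (mem_ball_iff_norm.2 h1))).differentiableWithinAt

/-- Taylor's formula for all members of the tower at once: the derivative of the remainder of order
`n + 1` of `b m` is the remainder of order `n` of `b (m + 1)`. -/
lemma norm_sub_taylor_le (h : IsGevreyTower b C σ c) {x X : ℝ} (hx : 0 ≤ x) (n m : ℕ) {y : ℝ}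
    (hy : y ∈ Icc x X) :
    ‖b m y - ∑ k ∈ Finset.range n, b (m + k) x / (k.factorial : ℂ) * ((y - x : ℝ) : ℂ) ^ k‖
      ≤ C * Real.exp (c * X) * σ ^ (m + n) * (m + n).factorial / n.factorial * (y - x) ^ n := by
  have hσ := h.sigma_pos
  have hC := h.const_nonneg
  have hc := h.rate_nonneg
  induction n generalizing m y with
  | zero =>
    simp only [Finset.range_zero, Finset.sum_empty, sub_zero, add_zero, pow_zero, mul_one,
      Nat.factorial_zero, Nat.cast_one, div_one]
    refine (h.norm_le m y (hx.trans hy.1)).trans ?_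
    calc C * σ ^ m * m.factorial * Real.exp (c * y)
        ≤ C * σ ^ m * m.factorial * Real.exp (c * X) := by gcongr; exact hy.2
      _ = _ := by ring
  | succ n ih =>
    have hpoly : ∀ t : ℝ, HasDerivAt (fun y : ℝ => ∑ k ∈ Finset.range (n + 1),
        b (m + k) x / (k.factorial : ℂ) * ((y - x : ℝ) : ℂ) ^ k)
        (∑ k ∈ Finset.range n, b (m + 1 + k) x / (k.factorial : ℂ) * ((t - x : ℝ) : ℂ) ^ k) t := by
      intro t
      have h0 : HasDerivAt (fun y : ℝ => ((y - x : ℝ) : ℂ)) 1 t := by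
        simpa using ((hasDerivAt_id t).sub_const x).ofReal_comp
      have h1 : HasDerivAt (fun y : ℝ => ∑ k ∈ Finset.range (n + 1),
          b (m + k) x / (k.factorial : ℂ) * ((y - x : ℝ) : ℂ) ^ k)
          (∑ k ∈ Finset.range (n + 1), b (m + k) x / (k.factorial : ℂ)
            * (k * ((t - x : ℝ) : ℂ) ^ (k - 1) * 1)) t :=
        HasDerivAt.fun_sum fun k _ => (h0.pow k).const_mul _
      refine h1.congr_deriv ?_
      rw [Finset.sum_range_succ']
      simp only [Nat.cast_zero, zero_mul, mul_zero, add_zero]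
      refine Finset.sum_congr rfl fun k _ => ?_
      rw [Nat.factorial_succ, Nat.add_sub_cancel, show m + (k + 1) = m + 1 + k by ring]
      have h2 : ((k : ℂ) + 1) ≠ 0 := by exact_mod_cast k.succ_ne_zero
      have h3 : (k.factorial : ℂ) ≠ 0 := by exact_mod_cast k.factorial_ne_zero
      push_cast
      field_simp
    refine image_norm_le_of_norm_deriv_right_le_deriv_boundary
      (f := fun y => b m y - ∑ k ∈ Finset.range (n + 1),
        b (m + k) x / (k.factorial : ℂ) * ((y - x : ℝ) : ℂ) ^ k)
      (((h.continuousOn m).mono fun t ht => hx.trans ht.1).sub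
        fun t _ => (hpoly t).continuousAt.continuousWithinAt)
      (fun t ht => (h.hasDerivWithinAt m t (hx.trans ht.1)).sub (hpoly t).hasDerivWithinAt)
      (B := fun t => C * Real.exp (c * X) * σ ^ (m + (n + 1)) * (m + (n + 1)).factorial
        / (n + 1).factorial * (t - x) ^ (n + 1))
      (B' := fun t => C * Real.exp (c * X) * σ ^ (m + 1 + n) * (m + 1 + n).factorial / n.factorial
        * (t - x) ^ n) ?_ (fun t => ?_) (fun t ht => ih (m + 1) ⟨ht.1, ht.2.le⟩) hy
    · rw [Finset.sum_range_succ']; simp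
    · refine ((((hasDerivAt_id t).sub_const x).pow (n + 1)).const_mul (C * Real.exp (c * X)
        * σ ^ (m + (n + 1)) * (m + (n + 1)).factorial / (n + 1).factorial)).congr_deriv ?_
      rw [Nat.factorial_succ n, Nat.add_sub_cancel, show m + 1 + n = m + (n + 1) by ring]
      have h2 : ((n : ℝ) + 1) ≠ 0 := by exact_mod_cast n.succ_ne_zero
      have h3 : (n.factorial : ℝ) ≠ 0 := by exact_mod_cast n.factorial_ne_zero
      simp only [id]
      push_cast
      field_simp

/-- To the right of its centre, and within its disk of convergence, a Taylor patch represents the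
function. -/
lemma taylorPatch_ofReal (h : IsGevreyTower b C σ c) {x y : ℝ} (hx : 0 ≤ x) (hxy : x ≤ y)
    (hy : y - x < σ⁻¹) : taylorPatch b x y = b 0 y := by
  have hσ := h.sigma_pos
  have hnorm : ‖(y : ℂ) - x‖ = y - x := by
    rw [← ofReal_sub, norm_real, Real.norm_eq_abs, abs_of_nonneg (sub_nonneg.2 hxy)]
  have hs := (h.summable_term hx (w := y) (by rwa [hnorm])).hasSum.tendsto_sum_nat
  refine tendsto_nhds_unique hs ?_
  rw [tendsto_iff_norm_sub_tendsto_zero]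
  have h1 : σ * (y - x) < 1 := by
    calc σ * (y - x) < σ * σ⁻¹ := by gcongr
      _ = 1 := mul_inv_cancel₀ hσ.ne'
  have h2 := (tendsto_pow_atTop_nhds_zero_of_lt_one
    (mul_nonneg hσ.le (sub_nonneg.2 hxy)) h1).const_mul (C * Real.exp (c * y))
  rw [mul_zero] at h2
  refine squeeze_zero (fun _ => norm_nonneg _) (fun n => ?_) h2
  have h3 := h.norm_sub_taylor_le hx n 0 (y := y) (X := y) ⟨hxy, le_rfl⟩
  simp only [zero_add] at h3
  rw [norm_sub_rev]
  have hf : (n.factorial : ℝ) ≠ 0 := by exact_mod_cast n.factorial_ne_zero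
  refine le_trans (by simpa using h3) (le_of_eq ?_)
  rw [mul_pow]
  field_simp

/-- Two Taylor patches agree where both converge, because they agree on the real points to the right
of both centres. -/
lemma taylorPatch_eq_of_le (h : IsGevreyTower b C σ c) {x y : ℝ} (hx : 0 ≤ x) (hxy : x ≤ y)
    (hy : y - x < σ⁻¹) : EqOn (taylorPatch b x) (taylorPatch b y)
      (Metric.ball (x : ℂ) σ⁻¹ ∩ Metric.ball (y : ℂ) σ⁻¹) := by
  have hσ : 0 < σ⁻¹ := inv_pos.2 h.sigma_pos
  have hnorm : ‖(y : ℂ) - x‖ = y - x := by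
    rw [← ofReal_sub, norm_real, Real.norm_eq_abs, abs_of_nonneg (sub_nonneg.2 hxy)]
  refine AnalyticOnNhd.eqOn_of_preconnected_of_frequently_eq (z₀ := (y : ℂ))
    ((h.analyticOnNhd_taylorPatch hx).mono inter_subset_left)
    ((h.analyticOnNhd_taylorPatch (hx.trans hxy)).mono inter_subset_right)
    ((convex_ball _ _).inter (convex_ball _ _)).isPreconnected
    ⟨mem_ball_iff_norm.2 (by rwa [hnorm]), Metric.mem_ball_self hσ⟩ ?_
  -- the real points slightly to the right of `y` accumulate at `y`
  have ht : Filter.Tendsto (fun t : ℝ => (t : ℂ)) (nhdsWithin y (Ioi y))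
      (nhdsWithin (y : ℂ) {(y : ℂ)}ᶜ) := by
    refine tendsto_nhdsWithin_iff.2 ⟨(continuous_ofReal.tendsto y).mono_left nhdsWithin_le_nhds, ?_⟩
    filter_upwards [self_mem_nhdsWithin] with t ht
    simpa using (ne_of_gt ht : t ≠ y)
  refine ht.frequently (Filter.Eventually.frequently ?_)
  have hlt : y < x + σ⁻¹ := by linarith
  filter_upwards [Ioo_mem_nhdsGT hlt] with t ht
  rw [h.taylorPatch_ofReal hx (hxy.trans ht.1.le) (by linarith [ht.2]),
    h.taylorPatch_ofReal (hx.trans hxy) ht.1.le (by linarith [ht.2])]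

lemma taylorPatch_eq (h : IsGevreyTower b C σ c) {x y : ℝ} (hx : 0 ≤ x) (hy : 0 ≤ y)
    (hxy : |y - x| < σ⁻¹) {w : ℂ} (hwx : ‖w - x‖ < σ⁻¹) (hwy : ‖w - y‖ < σ⁻¹) :
    taylorPatch b x w = taylorPatch b y w := by
  rw [abs_lt] at hxy
  rcases le_total x y with hle | hle
  · exact h.taylorPatch_eq_of_le hx hle hxy.2
      ⟨mem_ball_iff_norm.2 hwx, mem_ball_iff_norm.2 hwy⟩
  · exact (h.taylorPatch_eq_of_le hy hle (by linarith)
      ⟨mem_ball_iff_norm.2 hwy, mem_ball_iff_norm.2 hwx⟩).symm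

end IsGevreyTower

lemma norm_sub_max_re_lt {δ : ℝ} {t : ℂ} (ht : t ∈ halfStrip δ) :
    ‖t - (max t.re 0 : ℝ)‖ < δ := by
  obtain ⟨_, ⟨y, hy, rfl⟩, hd⟩ := (Metric.infDist_lt_iff ⟨_, mem_image_of_mem _ self_mem_Ici⟩).1 ht
  refine lt_of_le_of_lt ?_ hd
  rw [dist_eq_norm]
  refine le_of_sq_le_sq ?_ (norm_nonneg _)
  rw [Complex.sq_norm, Complex.sq_norm, normSq_apply, normSq_apply]
  simp only [sub_re, ofReal_re, sub_im, ofReal_im, sub_zero]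
  have hy' : 0 ≤ y := hy
  rcases le_total 0 t.re with h | h
  · rw [max_eq_left h]; nlinarith [sq_nonneg (t.re - y)]
  · rw [max_eq_right h]; nlinarith

lemma isOpen_halfStrip (δ : ℝ) : IsOpen (halfStrip δ) :=
  isOpen_lt (Metric.continuous_infDist_pt _) continuous_const

/-- The functions of a Gevrey tower extend analytically to a neighbourhood of the half-line, by
gluing the Taylor series centred at its points. -/
lemma IsGevreyTower.exists_extension {b : ℕ → ℝ → ℂ} {C σ c : ℝ} (h : IsGevreyTower b C σ c) :
    ∃ B : ℂ → ℂ, (∀ t : ℝ, 0 ≤ t → B t = b 0 t) ∧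
      (∀ t : ℂ, ‖t‖ < (2 * σ)⁻¹ →
        HasSum (fun k : ℕ => b k 0 / (k.factorial : ℂ) * t ^ k) (B t)) ∧
      AnalyticOnNhd ℂ B (halfStrip (2 * σ)⁻¹) ∧
      ∀ t ∈ halfStrip (2 * σ)⁻¹, ‖B t‖ ≤ 2 * C * Real.exp (c * ‖t‖) := by
  have hσ := h.sigma_pos
  have hC := h.const_nonneg
  have hc := h.rate_nonneg
  have hhalf : (2 * σ)⁻¹ < σ⁻¹ := by
    apply inv_strictAnti₀ hσ; linarith
  have hlip : ∀ s t : ℂ, |max s.re 0 - max t.re 0| ≤ ‖s - t‖ := fun s t =>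
    (abs_max_sub_max_le_abs _ _ _).trans (by simpa using abs_re_le_norm (s - t))
  refine ⟨fun t => taylorPatch b (max t.re 0) t, fun t ht => ?_, fun t ht => ?_, fun t ht => ?_,
    fun t ht => ?_⟩
  · simp only [ofReal_re]
    rw [max_eq_left ht]
    exact h.taylorPatch_ofReal ht le_rfl (by simpa using hσ)
  · have h1 : t ∈ halfStrip (2 * σ)⁻¹ :=
      (Metric.infDist_lt_iff ⟨_, mem_image_of_mem _ self_mem_Ici⟩).2
        ⟨0, ⟨0, self_mem_Ici, ofReal_zero⟩, by simpa using ht⟩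
    have h2 := hlip t 0
    simp only [zero_re, max_self, sub_zero] at h2
    have h3 := h.taylorPatch_eq (w := t) (le_max_right t.re 0) le_rfl
      (by rw [zero_sub, abs_neg]; linarith) ((norm_sub_max_re_lt h1).trans hhalf)
      (by simpa using ht.trans hhalf)
    simp only [h3]
    have h4 := (h.summable_term le_rfl (w := t) (by simpa using ht.trans hhalf)).hasSum
    simpa [taylorPatch] using h4
  · have h1 := norm_sub_max_re_lt ht
    refine (h.analyticOnNhd_taylorPatch (le_max_right t.re 0) t
      (mem_ball_iff_norm.2 (h1.trans hhalf))).congr ?_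
    have hpos : 0 < (2 * σ)⁻¹ := by positivity
    filter_upwards [(isOpen_halfStrip _).mem_nhds ht, Metric.ball_mem_nhds t hpos] with s hs hst
    rw [mem_ball_iff_norm] at hst
    have e : (2 * σ)⁻¹ + (2 * σ)⁻¹ = σ⁻¹ := by field_simp; norm_num
    refine h.taylorPatch_eq (le_max_right _ _) (le_max_right _ _)
      ((hlip s t).trans_lt (hst.trans hhalf)) ?_ ((norm_sub_max_re_lt hs).trans hhalf)
    calc ‖s - (max t.re 0 : ℝ)‖ ≤ ‖s - t‖ + ‖t - (max t.re 0 : ℝ)‖ := norm_sub_le_norm_sub_add_norm_sub _ _ _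
      _ < σ⁻¹ := by linarith
  · refine (h.norm_taylorPatch_le (le_max_right _ _) (norm_sub_max_re_lt ht)).trans ?_
    gcongr
    exact max_le ((le_abs_self _).trans (abs_re_le_norm t)) (norm_nonneg t)

/-! ### Borel summability -/

lemma inv_mem_tangentDisk {R : ℝ} {ζ : ℂ} : ζ⁻¹ ∈ tangentDisk R ↔ R⁻¹ < ζ.re := by
  rw [tangentDisk, mem_ofPred_eq, inv_inv]

lemma tangentDisk_mono {R R' : ℝ} (hR : 0 < R) (h : R ≤ R') : tangentDisk R ⊆ tangentDisk R' :=
  fun _ hz => lt_of_le_of_lt (inv_anti₀ hR h) hz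

lemma ne_zero_of_mem_tangentDisk {R : ℝ} (hR : 0 < R) {z : ℂ} (hz : z ∈ tangentDisk R) :
    z ≠ 0 := by
  rintro rfl
  rw [tangentDisk, mem_ofPred_eq, inv_zero, zero_re] at hz
  exact absurd hz (not_lt.2 (inv_pos.2 hR).le)

lemma isOpen_tangentDisk {R : ℝ} (hR : 0 < R) : IsOpen (tangentDisk R) := by
  have h : tangentDisk R = {z | z ≠ 0} ∩ (fun z : ℂ => (z⁻¹).re) ⁻¹' Ioi R⁻¹ := by
    ext z
    exact ⟨fun hz => ⟨ne_zero_of_mem_tangentDisk hR hz, hz⟩, fun hz => hz.2⟩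
  rw [h]
  refine ContinuousOn.isOpen_inter_preimage ?_ isOpen_ne isOpen_Ioi
  exact continuous_re.comp_continuousOn (continuousOn_inv₀)

/-- The rescaled remainder `ζ^(m-1) (f (1/ζ) - ∑_{k ≤ m} a_k ζ^(-k))`, of order `ζ^(-2)`. -/
def scaledRemainder (f : ℂ → ℂ) (a : PowerSeries ℂ) (m : ℕ) (ζ : ℂ) : ℂ :=
  ζ ^ (m + 1) * (f ζ⁻¹ - ∑ k ∈ Finset.range (m + 1), a.coeff k * ζ⁻¹ ^ k) / ζ ^ 2

lemma scaledRemainder_succ (f : ℂ → ℂ) (a : PowerSeries ℂ) (m : ℕ) {ζ : ℂ} (hζ : ζ ≠ 0) :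
    scaledRemainder f a m ζ
      = a.coeff (m + 1) * (ζ ^ 2)⁻¹ + scaledRemainder f a (m + 1) ζ / ζ := by
  have h : ζ ^ (m + 1) * ζ⁻¹ ^ (m + 1) = 1 := by
    rw [← mul_pow, mul_inv_cancel₀ hζ, one_pow]
  unfold scaledRemainder
  rw [Finset.sum_range_succ _ (m + 1), pow_succ ζ (m + 1)]
  generalize ∑ k ∈ Finset.range (m + 1), a.coeff k * ζ⁻¹ ^ k = s
  have h2 : ζ ^ (m + 1) * ζ * (f ζ⁻¹ - (s + a.coeff (m + 1) * ζ⁻¹ ^ (m + 1)))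
      = ζ * (ζ ^ (m + 1) * (f ζ⁻¹ - s) - a.coeff (m + 1)) := by
    linear_combination (-ζ * a.coeff (m + 1)) * h
  rw [h2]
  generalize ζ ^ (m + 1) * (f ζ⁻¹ - s) = q
  field_simp
  ring

/-- The `m`-th derivative of the inverse Laplace transform of `f (1/ζ) / ζ`, on `[0, ∞)`. Its value
`a_m` at the origin is split off, so that the remaining integral converges absolutely. -/
def borelTower (f : ℂ → ℂ) (a : PowerSeries ℂ) (c : ℝ) (m : ℕ) (t : ℝ) : ℂ :=
  a.coeff m + laplaceInverse c (scaledRemainder f a m) t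

section

variable {f : ℂ → ℂ} {a : PowerSeries ℂ} {R₀ K σ : ℝ}

lemma differentiableOn_scaledRemainder (hR₀ : 0 < R₀) (hf : DifferentiableOn ℂ f (tangentDisk R₀))
    (m : ℕ) : DifferentiableOn ℂ (scaledRemainder f a m) {ζ | R₀⁻¹ < ζ.re} := by
  have hne : ∀ ζ ∈ {ζ : ℂ | R₀⁻¹ < ζ.re}, ζ ≠ 0 := fun ζ hζ h => by
    rw [h, mem_ofPred_eq, zero_re] at hζ
    exact absurd hζ (not_lt.2 (inv_pos.2 hR₀).le)
  have hinv : DifferentiableOn ℂ (fun ζ : ℂ => ζ⁻¹) {ζ : ℂ | R₀⁻¹ < ζ.re} :=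
    differentiableOn_id.inv hne
  have h1 : DifferentiableOn ℂ (fun ζ => f ζ⁻¹) {ζ | R₀⁻¹ < ζ.re} :=
    hf.comp hinv fun ζ hζ => inv_mem_tangentDisk.2 hζ
  refine DifferentiableOn.div ?_ (by fun_prop) fun ζ hζ => pow_ne_zero 2 (hne ζ hζ)
  exact DifferentiableOn.mul (by fun_prop) (h1.sub
    (DifferentiableOn.fun_sum fun k _ => (hinv.pow k).const_mul _))

lemma norm_scaledRemainder_le (hR₀ : 0 < R₀)
    (h : ∀ r : ℕ, ∀ u ∈ tangentDisk R₀, ‖f u - ∑ k ∈ Finset.range r, a.coeff k * u ^ k‖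
      ≤ K * σ ^ r * r.factorial * ‖u‖ ^ r) (m : ℕ) (ζ : ℂ) (hζ : R₀⁻¹ < ζ.re) :
    ‖scaledRemainder f a m ζ‖ ≤ K * σ ^ (m + 1) * (m + 1).factorial / ‖ζ‖ ^ 2 := by
  have h1 := h (m + 1) ζ⁻¹ (inv_mem_tangentDisk.2 hζ)
  have hne : ζ ≠ 0 := by
    rintro rfl
    exact absurd hζ (not_lt.2 (by simpa using hR₀.le))
  have hn : 0 < ‖ζ‖ := norm_pos_iff.2 hne
  rw [scaledRemainder, norm_div, norm_mul, norm_pow, norm_pow]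
  refine div_le_div_of_nonneg_right ?_ (by positivity)
  calc _ ≤ ‖ζ‖ ^ (m + 1) * (K * σ ^ (m + 1) * (m + 1).factorial * ‖ζ⁻¹‖ ^ (m + 1)) := by gcongr
    _ = K * σ ^ (m + 1) * (m + 1).factorial * (‖ζ‖ * ‖ζ⁻¹‖) ^ (m + 1) := by rw [mul_pow]; ring
    _ = _ := by rw [norm_inv, mul_inv_cancel₀ hn.ne', one_pow, mul_one]

lemma isGevreyTower_borelTower (hR₀ : 0 < R₀) (hf : DifferentiableOn ℂ f (tangentDisk R₀))
    (hK : 0 ≤ K) (hσ : 0 < σ) (ha : ∀ k, ‖a.coeff k‖ ≤ K * σ ^ k * k.factorial)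
    (h : ∀ r : ℕ, ∀ u ∈ tangentDisk R₀, ‖f u - ∑ k ∈ Finset.range r, a.coeff k * u ^ k‖
      ≤ K * σ ^ r * r.factorial * ‖u‖ ^ r) {c : ℝ} (hc : R₀⁻¹ < c) :
    IsGevreyTower (borelTower f a c) (K + K * σ / (2 * c)) (2 * σ) c := by
  have hc₀ : 0 ≤ R₀⁻¹ := (inv_pos.2 hR₀).le
  have hc0 : 0 < c := hc₀.trans_lt hc
  have hd := differentiableOn_scaledRemainder (a := a) hR₀ hf
  have hb := norm_scaledRemainder_le hR₀ h
  have hne : ∀ ξ, verticalLine c ξ ≠ 0 := fun ξ h0 => by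
    have := verticalLine_re c ξ
    rw [h0, zero_re] at this
    exact hc0.ne this
  have hsplit : ∀ m t, 0 ≤ t → borelTower f a c m t = a.coeff m + (a.coeff (m + 1) * t
      + laplaceInverse c (fun ζ => scaledRemainder f a (m + 1) ζ / ζ) t) := by
    intro m t ht
    have i1 : Integrable fun ξ => exp (t * verticalLine c ξ) * (verticalLine c ξ ^ 2)⁻¹ := by
      refine integrable_laplace_integrand (c₀ := R₀⁻¹) (M := 1) (g := fun ζ => (ζ ^ 2)⁻¹) hc₀ ?_
        (fun ζ _ => by rw [norm_inv, norm_pow, one_div]) hc t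
      refine DifferentiableOn.inv (by fun_prop) fun ζ hζ => pow_ne_zero 2 fun h0 => ?_
      rw [h0, mem_ofPred_eq, zero_re] at hζ
      exact absurd hζ (not_lt.2 hc₀)
    have i2 := integrable_laplace_integrand hc₀ (hd m) (hb m) hc t
    have e : ∀ ξ, exp (t * verticalLine c ξ)
        * (scaledRemainder f a (m + 1) (verticalLine c ξ) / verticalLine c ξ)
        = exp (t * verticalLine c ξ) * scaledRemainder f a m (verticalLine c ξ)
          - a.coeff (m + 1) * (exp (t * verticalLine c ξ) * (verticalLine c ξ ^ 2)⁻¹) := fun ξ => by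
      rw [scaledRemainder_succ f a m (hne ξ)]
      ring
    have e2 : laplaceInverse c (fun ζ => scaledRemainder f a (m + 1) ζ / ζ) t
        = laplaceInverse c (scaledRemainder f a m) t - a.coeff (m + 1) * t := by
      rw [← laplaceInverse_inv_sq hc0 ht]
      unfold laplaceInverse
      rw [← integral_const_mul, ← integral_sub i2 (i1.const_mul _)]
      exact integral_congr_ae (ae_of_all _ e)
    rw [e2, borelTower]
    ring
  refine ⟨by positivity, hc0.le, fun m t ht => ?_, fun m => ?_, fun m t ht => ?_⟩
  · have h1 := hasDerivAt_laplaceInverse hc₀ (hd (m + 1)) (hb (m + 1)) hc t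
    have h0 : HasDerivAt (fun t : ℝ => a.coeff (m + 1) * (t : ℂ)) (a.coeff (m + 1)) t := by
      simpa using ((hasDerivAt_id t).ofReal_comp).const_mul (a.coeff (m + 1))
    exact ((h0.add h1).const_add (a.coeff m)).hasDerivWithinAt.congr
      (fun s hs => hsplit m s (ht.trans hs)) (hsplit m t ht)
  · exact (continuous_const.add (continuous_laplaceInverse hc₀ (hd m) (hb m) hc)).continuousOn
  · have h1 := norm_laplaceInverse_le hc₀ (hb m) hc t
    have he : 1 ≤ Real.exp (c * t) := Real.one_le_exp (by positivity)
    calc ‖borelTower f a c m t‖ ≤ K * σ ^ m * m.factorial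
          + K * σ ^ (m + 1) * (m + 1).factorial * Real.exp (t * c) / (2 * c) :=
          (norm_add_le _ _).trans (add_le_add (ha m) h1)
      _ = K * σ ^ m * m.factorial * 1
          + K * σ / (2 * c) * (((m : ℝ) + 1) * σ ^ m) * m.factorial * Real.exp (c * t) := by
          rw [Nat.factorial_succ, mul_comm t c]; push_cast; ring
      _ ≤ K * (2 * σ) ^ m * m.factorial * Real.exp (c * t)
          + K * σ / (2 * c) * (2 ^ m * σ ^ m) * m.factorial * Real.exp (c * t) := by
          gcongr
          · linarith
          · exact succ_le_two_pow m
      _ = _ := by rw [mul_pow]; ring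

end

/-- The Nevanlinna–Sokal theorem: a function analytic in a disk tangent to the imaginary axis,
with an expansion of factorial type there, is Borel summable (with respect to a smaller disk). -/
theorem borelSummable_of_hasGevreyExpansion {f : ℂ → ℂ} {a : PowerSeries ℂ} {R₀ : ℝ}
    (hR₀ : 0 < R₀) (hf : DifferentiableOn ℂ f (tangentDisk R₀))
    (h : HasGevreyExpansion (tangentDisk R₀) f a) : BorelSummable f := by
  obtain ⟨K, σ₀, hK, hσ₀, ha₀, hr₀⟩ := h
  obtain ⟨σ, hσ, ha, hr⟩ : ∃ σ : ℝ, 0 < σ ∧ (∀ k, ‖a.coeff k‖ ≤ K * σ ^ k * k.factorial) ∧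
      ∀ r : ℕ, ∀ u ∈ tangentDisk R₀, ‖f u - ∑ k ∈ Finset.range r, a.coeff k * u ^ k‖
        ≤ K * σ ^ r * r.factorial * ‖u‖ ^ r := by
    refine ⟨σ₀ + 1, by positivity, fun k => (ha₀ k).trans ?_, fun r u hu => (hr₀ r u hu).trans ?_⟩
    · gcongr; linarith
    · gcongr; linarith
  have hR : 0 < R₀ / 2 := by positivity
  have hsub : tangentDisk (R₀ / 2) ⊆ tangentDisk R₀ := tangentDisk_mono hR (by linarith)
  have hc : R₀⁻¹ < (R₀ / 2)⁻¹ := inv_strictAnti₀ hR (by linarith)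
  have hc₀ : 0 ≤ R₀⁻¹ := (inv_pos.2 hR₀).le
  set c := (R₀ / 2)⁻¹ with hcdef
  have hc0 : 0 < c := hc₀.trans_lt hc
  have hd := differentiableOn_scaledRemainder (a := a) hR₀ hf 0
  have hb := norm_scaledRemainder_le hR₀ hr 0
  obtain ⟨B, hB1, hB2, hB3, hB4⟩ :=
    (isGevreyTower_borelTower hR₀ hf hK hσ ha hr hc).exists_extension
  refine ⟨fun k => a.coeff k, R₀ / 2, K + 1, 2 * (2 * σ), hR, by positivity, by positivity,
    ⟨(hf.mono hsub).analyticOnNhd (isOpen_tangentDisk hR), fun r z hz =>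
      (hr r z (hsub hz)).trans ?_⟩, B, fun t ht => ?_, hB3,
    ⟨2 * (K + K * σ / (2 * c)), fun t ht => (hB4 t ht).trans_eq ?_⟩, fun z hz => ?_⟩
  · gcongr <;> linarith
  · have h0 : ∀ k, borelTower f a c k 0 = a.coeff k := fun k => by
      rw [borelTower, laplaceInverse_eq_zero hc₀ (differentiableOn_scaledRemainder (a := a) hR₀ hf k)
        (norm_scaledRemainder_le hR₀ hr k) hc le_rfl, add_zero]
    simpa only [h0] using hB2 t ht
  · rw [hcdef, div_eq_inv_mul ‖t‖]
  · have hz0 := ne_zero_of_mem_tangentDisk hR hz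
    have hzre : c < (z⁻¹).re := hz
    obtain ⟨j1, j2⟩ := integral_exp_mul_laplaceInverse hc₀ hd hb hc hzre
    have hexp : ∀ t : ℝ, exp (-(t : ℂ) / z) = exp (-t * z⁻¹) := fun t => by rw [div_eq_mul_inv]
    have k1 : IntegrableOn (fun t : ℝ => exp (-(t : ℂ) * z⁻¹)) (Ioi 0) ∧
        ∫ t in Ioi (0 : ℝ), exp (-(t : ℂ) * z⁻¹) = z := by
      have hneg : (-z⁻¹).re < 0 := by rw [neg_re]; linarith
      have e : ∀ t : ℝ, exp (-(t : ℂ) * z⁻¹) = exp (-z⁻¹ * t) := fun t => by ring_nf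
      simp_rw [e]
      refine ⟨integrableOn_exp_mul_complex_Ioi hneg 0, ?_⟩
      rw [integral_exp_mul_complex_Ioi hneg]
      simp
    have hBeq : EqOn (fun t : ℝ => B t * exp (-(t : ℂ) / z)) (fun t : ℝ => a.coeff 0
        * exp (-(t : ℂ) * z⁻¹) + laplaceInverse c (scaledRemainder f a 0) t * exp (-t * z⁻¹))
        (Ioi 0) := fun t ht => by
      simp only
      rw [hB1 t (le_of_lt ht), borelTower, hexp, add_mul]
    refine ⟨IntegrableOn.congr_fun ((k1.1.const_mul _).add j1) hBeq.symm measurableSet_Ioi, ?_⟩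
    rw [setIntegral_congr_fun measurableSet_Ioi hBeq, integral_add (k1.1.const_mul _) j1,
      integral_const_mul, k1.2, j2, scaledRemainder]
    simp
    field_simp
    ring

/-! ### The partition function in the cardioid -/

/-- The trace of a nonzero positive semidefinite matrix is positive, and `N Λ₀` bounds the trace of
the pair matrix. -/
lemma mul_highestEigenvalue_pos {N : ℕ} {W : Tensor4 N} (hsymm : IsCompletelySymmetric W)
    (hpos : (pairMatrix W).PosSemidef) (hW : W ≠ 0) {Λ₀ : ℝ}
    (hΛ₀ : IsHighestEigenvalue (pairMatrix W) Λ₀) : 0 < N * Λ₀ := by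
  obtain ⟨B, μ, h1, h2, h3, h4, h5, h6, h7⟩ := exists_spectral_decomposition hsymm hpos hΛ₀
  by_contra hneg
  have hsum : ∑ s, μ s ≤ 0 := by rw [h5]; exact h7.trans (not_lt.1 hneg)
  have hμ : ∀ s, μ s = 0 := fun s =>
    (Finset.sum_eq_zero_iff_of_nonneg fun s _ => h2 s).1
      (le_antisymm hsum (Finset.sum_nonneg fun s _ => h2 s)) s (Finset.mem_univ s)
  have hB : ∀ s, B s = 0 := fun s => by
    have h := h3 s s
    rw [if_pos rfl, hμ s] at h
    rw [← Matrix.trace_conjTranspose_mul_self_eq_zero_iff, (h1 s).eq]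
    exact h
  refine hW ?_
  ext i j k l
  rw [h4]
  simp [hB]

/-- In the right half-plane the partition function deviates from its free value by at most the
first-order term of perturbation theory. -/
lemma norm_partition_sub_le {N : ℕ} {W : Tensor4 N} (hsymm : IsCompletelySymmetric W)
    (hpos : (pairMatrix W).PosSemidef) {Λ₀ : ℝ} (hΛ₀ : IsHighestEigenvalue (pairMatrix W) Λ₀)
    {u : ℂ} (hu : 0 ≤ u.re) :
    ‖sourcedMoment W [] u 0 - ((Real.sqrt (2 * Real.pi) ^ N : ℝ) : ℂ)‖
      ≤ ‖u‖ * (N * Λ₀) / 8 * Real.sqrt (2 * Real.pi) ^ N := by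
  have hV := quarticForm_nonneg hsymm hpos hΛ₀
  have i0 := integrable_quarticForm_pow_mul_gaussian W 0
  have i1 := integrable_quarticForm_pow_mul_gaussian W 1
  simp only [pow_zero, one_mul, pow_one] at i0 i1
  have i2 := integrable_sourced_integrand hV [] hu 0
  have i3 : Integrable fun φ : Fin N → ℝ => (Real.exp (-(1 / 2) * ∑ i, φ i ^ 2) : ℂ) := i0.ofReal
  rw [← integral_gaussian_fields, ← integral_complex_ofReal, sourcedMoment, ← integral_sub i2 i3]
  have hle : ∀ φ : Fin N → ℝ, ‖(fieldMonomial [] φ : ℂ)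
      * exp (-(1 / 2) * ((∑ i, φ i ^ 2 : ℝ) : ℂ)
      - u / (Nat.factorial 4 : ℂ) * (quarticForm W φ : ℂ)
        + ((∑ i, (0 : Fin N → ℝ) i * φ i : ℝ) : ℂ))
      - (Real.exp (-(1 / 2) * ∑ i, φ i ^ 2) : ℂ)‖
      ≤ ‖u‖ / 24 * (quarticForm W φ * Real.exp (-(1 / 2) * ∑ i, φ i ^ 2)) := by
    intro φ
    have h1 : 0 ≤ (u * quarticForm W φ / 24).re := by
      rw [show (u * quarticForm W φ / 24) = ((quarticForm W φ / 24 : ℝ) : ℂ) * u by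
        push_cast; ring, re_ofReal_mul]
      exact mul_nonneg (div_nonneg (hV φ) (by norm_num)) hu
    have h2 := norm_exp_neg_sub_sum_le 1 h1
    have h3 : ‖u * quarticForm W φ / 24‖ = ‖u‖ / 24 * quarticForm W φ := by
      rw [norm_div, norm_mul, norm_real, Real.norm_of_nonneg (hV φ)]; norm_num; ring
    rw [h3] at h2
    simp only [Finset.range_one, Finset.sum_singleton, pow_zero, Nat.factorial_zero, Nat.cast_one,
      div_one, pow_one, Nat.factorial_one] at h2
    have e : (fieldMonomial [] φ : ℂ) * exp (-(1 / 2) * ((∑ i, φ i ^ 2 : ℝ) : ℂ)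
        - u / (Nat.factorial 4 : ℂ) * (quarticForm W φ : ℂ)
        + ((∑ i, (0 : Fin N → ℝ) i * φ i : ℝ) : ℂ))
        - (Real.exp (-(1 / 2) * ∑ i, φ i ^ 2) : ℂ)
        = (Real.exp (-(1 / 2) * ∑ i, φ i ^ 2) : ℂ) * (exp (-(u * quarticForm W φ / 24)) - 1) := by
      simp only [fieldMonomial_nil, ofReal_one, one_mul, Pi.zero_apply, zero_mul,
        Finset.sum_const_zero, ofReal_zero, add_zero]
      rw [sub_eq_add_neg (-(1 / 2) * ((∑ i, φ i ^ 2 : ℝ) : ℂ)), exp_add, exp_sum_sq_eq_ofReal,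
        show u / (Nat.factorial 4 : ℂ) * (quarticForm W φ : ℂ) = u * quarticForm W φ / 24 by
          norm_num [Nat.factorial]; ring]
      ring
    rw [e, norm_mul, norm_real, Real.norm_eq_abs, Real.abs_exp]
    calc _ ≤ Real.exp (-(1 / 2) * ∑ i, φ i ^ 2) * (‖u‖ / 24 * quarticForm W φ) := by gcongr
      _ = _ := by ring
  refine (norm_integral_le_of_norm_le (i1.const_mul _) (ae_of_all _ hle)).trans ?_
  rw [integral_const_mul, integral_gaussian_fields]
  calc _ ≤ ‖u‖ / 24 * (3 * (N * Λ₀) * Real.sqrt (2 * Real.pi) ^ N) := by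
        gcongr; exact integral_quarticForm_le hsymm hpos hΛ₀
    _ = _ := by ring

lemma le_partition_re {N : ℕ} {W : Tensor4 N} (hsymm : IsCompletelySymmetric W)
    (hpos : (pairMatrix W).PosSemidef) {Λ₀ : ℝ} (hΛ₀ : IsHighestEigenvalue (pairMatrix W) Λ₀)
    {u : ℂ} (hu : 0 ≤ u.re) :
    (1 - ‖u‖ * (N * Λ₀) / 8) * Real.sqrt (2 * Real.pi) ^ N ≤ (sourcedMoment W [] u 0).re := by
  have h1 := norm_partition_sub_le hsymm hpos hΛ₀ hu
  have h2 := (abs_le.1 (abs_re_le_norm (sourcedMoment W [] u 0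
    - ((Real.sqrt (2 * Real.pi) ^ N : ℝ) : ℂ)))).1
  rw [sub_re, ofReal_re] at h2
  linarith

lemma interior_cardioid_subset_slitPlane (r : ℝ) : interior (cardioid r) ⊆ slitPlane := by
  -- on the negative axis the boundary of the cardioid degenerates to the origin
  have hneg : ∀ x : ℝ, x < 0 → (x : ℂ) ∉ cardioid r := fun x hx h => by
    rw [cardioid, mem_ofPred_eq, arg_ofReal_of_neg hx, Real.cos_pi_div_two, norm_real] at h
    have : 0 < ‖x‖ := norm_pos_iff.2 hx.ne
    norm_num at h
    exact hx.ne h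
  intro u hu
  rw [mem_slitPlane_iff_arg]
  constructor
  · intro harg
    rw [arg_eq_pi_iff] at harg
    refine hneg u.re harg.1 ?_
    rw [show ((u.re : ℝ) : ℂ) = u from Complex.ext rfl harg.2.symm]
    exact interior_subset hu
  · rintro rfl
    have hc : Filter.Tendsto (fun x : ℝ => (x : ℂ)) (nhdsWithin 0 (Iio 0)) (nhds 0) := by
      simpa using (continuous_ofReal.tendsto (0 : ℝ)).mono_left nhdsWithin_le_nhds
    obtain ⟨x, hx, hx0⟩ := ((hc.eventually (mem_interior_iff_mem_nhds.1 hu)).and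
      self_mem_nhdsWithin).exists
    exact hneg x hx0 hx

/-- The polar equation of the cardioid, expressed through `a = (u / 3) ^ (-1 / 2)`. -/
lemma mul_le_rotation_re_sq {N : ℕ} {Λ₀ κ : ℝ} (hN : 0 < N * Λ₀) {u : ℂ} (hu : u ∈ slitPlane)
    (huc : u ∈ cardioid (6 / (N * Λ₀) * κ)) :
    N * Λ₀ ≤ 2 * κ * ((u / 3) ^ (-(1 / 2) : ℂ)).re ^ 2 := by
  have h0 := slitPlane_ne_zero hu
  have hn : 0 < ‖u‖ := norm_pos_iff.2 h0
  have h3 : u / 3 ≠ 0 := div_ne_zero h0 (by norm_num)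
  have hre : ((u / 3) ^ (-(1 / 2) : ℂ)).re ^ 2 = 3 / ‖u‖ * Real.cos (u.arg / 2) ^ 2 := by
    rw [cpow_def_of_ne_zero h3, exp_re, mul_pow]
    have harg : arg (u / 3) = arg u := by
      rw [show u / 3 = ((1 / 3 : ℝ) : ℂ) * u by push_cast; ring, arg_real_mul _ (by norm_num)]
    have e1 : log (u / 3) * (-(1 / 2) : ℂ) = log (u / 3) * ((-(1 / 2) : ℝ) : ℂ) := by push_cast; ring
    rw [e1, im_mul_ofReal, re_mul_ofReal, log_im, log_re, harg, ← Real.exp_nat_mul]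
    congr 1
    · rw [show ((2 : ℕ) : ℝ) * (Real.log ‖u / 3‖ * -(1 / 2)) = -Real.log ‖u / 3‖ by
        push_cast; ring, Real.exp_neg, Real.exp_log (norm_pos_iff.2 h3), norm_div]
      norm_num
    · rw [show arg u * -(1 / 2) = -(arg u / 2) by ring, Real.cos_neg]
  have hc : ‖u‖ ≤ 6 / (N * Λ₀) * κ * Real.cos (u.arg / 2) ^ 2 := huc
  rw [hre]
  have h4 : ‖u‖ * (N * Λ₀) ≤ 6 * κ * Real.cos (u.arg / 2) ^ 2 := by
    calc ‖u‖ * (N * Λ₀) ≤ (6 / (N * Λ₀) * κ * Real.cos (u.arg / 2) ^ 2) * (N * Λ₀) := by gcongr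
      _ = _ := by generalize (N : ℝ) * Λ₀ = x at *; field_simp
  rw [show 2 * κ * (3 / ‖u‖ * Real.cos (u.arg / 2) ^ 2)
    = (6 * κ * Real.cos (u.arg / 2) ^ 2) / ‖u‖ by ring, le_div_iff₀ hn]
  linarith

lemma rotation_sq_re_nonpos {u : ℂ} (hre : u.re ≤ 0) :
    (((u / 3) ^ (-(1 / 2) : ℂ)) ^ 2).re ≤ 0 := by
  rw [← cpow_nat_mul, show ((2 : ℕ) : ℂ) * -(1 / 2) = -1 by norm_num, cpow_neg_one, inv_re]
  refine div_nonpos_of_nonpos_of_nonneg ?_ (normSq_nonneg _)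
  rw [show u / 3 = ((1 / 3 : ℝ) : ℂ) * u by push_cast; ring, re_ofReal_mul]
  linarith

lemma partition_re_pos_of_mem_cardioid {N : ℕ} {W : Tensor4 N} (hsymm : IsCompletelySymmetric W)
    (hpos : (pairMatrix W).PosSemidef) {Λ₀ : ℝ} (hΛ₀ : IsHighestEigenvalue (pairMatrix W) Λ₀)
    (hN : 0 < N * Λ₀) {u : ℂ} (hre : 0 ≤ u.re)
    (huc : u ∈ cardioid (6 / (N * Λ₀) * Real.sqrt (Real.exp 1 / Real.pi))) :
    0 < (sourcedMoment W [] u 0).re := by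
  refine lt_of_lt_of_le ?_ (le_partition_re hsymm hpos hΛ₀ hre)
  have h1 : ‖u‖ * (N * Λ₀) ≤ 6 * Real.sqrt (Real.exp 1 / Real.pi) := by
    have hc : ‖u‖ ≤ 6 / (N * Λ₀) * Real.sqrt (Real.exp 1 / Real.pi)
      * Real.cos (u.arg / 2) ^ 2 := huc
    calc ‖u‖ * (N * Λ₀) ≤ (6 / (N * Λ₀) * Real.sqrt (Real.exp 1 / Real.pi) * 1) * (N * Λ₀) := by
          gcongr
          exact hc.trans (by gcongr; exact Real.cos_sq_le_one _)
      _ = _ := by rw [mul_one, mul_right_comm, div_mul_cancel₀ _ hN.ne']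
  have h2 := sqrt_exp_one_div_pi_lt
  have h3 : 0 < 1 - ‖u‖ * (N * Λ₀) / 8 := by linarith
  positivity

lemma continuedMoment_nil_ne_zero {N : ℕ} {W : Tensor4 N} (hsymm : IsCompletelySymmetric W)
    (hpos : (pairMatrix W).PosSemidef) {Λ₀ : ℝ} (hΛ₀ : IsHighestEigenvalue (pairMatrix W) Λ₀)
    (hN : 0 < N * Λ₀) {u : ℂ} (hu : u ∈ slitPlane)
    (huc : u ∈ cardioid (6 / (N * Λ₀) * Real.sqrt (Real.exp 1 / Real.pi))) :
    continuedMoment W [] u ≠ 0 := by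
  rcases le_total 0 u.re with hre | hre
  · rw [continuedMoment_eq (quarticForm_nonneg hsymm hpos hΛ₀) [] hre hu]
    intro h
    have := partition_re_pos_of_mem_cardioid hsymm hpos hΛ₀ hN hre huc
    rw [h, zero_re] at this
    exact lt_irrefl 0 this
  · refine mul_ne_zero (pow_ne_zero _ ?_) (rotatedMoment_nil_ne_zero hsymm hpos hΛ₀
      (rotation_re_pos hu) (rotation_sq_re_nonpos hre) (mul_le_rotation_re_sq hN hu huc))
    rw [Ne, cpow_eq_zero_iff]
    exact fun h => div_ne_zero (slitPlane_ne_zero hu) (by norm_num) h.1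

lemma differentiableOn_eval_momentPoly {N : ℕ} {M : List (Fin N) → ℂ → ℂ} {Ω : Set ℂ}
    (h : ∀ l, DifferentiableOn ℂ (M l) Ω) (h0 : ∀ u ∈ Ω, M [] u ≠ 0) (p : MomentPoly N) :
    DifferentiableOn ℂ (fun u => MvPolynomial.eval (momentPoint fun l => M l u) p) Ω := by
  induction p using MvPolynomial.induction_on with
  | C c => simp
  | add p q hp hq => simpa using hp.fun_add hq
  | mul_X p s hp =>
    cases s with
    | some l => simpa [momentPoint] using hp.fun_mul (h l)
    | none => simpa [momentPoint] using hp.fun_mul ((h []).fun_inv h0)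

/-- The connected correlation functions are polynomials in the moments and in the inverse of the
partition function. -/
lemma connectedCorrelation_eq_eval {N : ℕ} {W : Tensor4 N} (hV : ∀ φ, 0 ≤ quarticForm W φ)
    {u : ℂ} (hu : 0 ≤ u.re) {n : ℕ} (idx : Fin (n + 1) → Fin N)
    (hZ : 0 < (sourcedMoment W [] u 0).re) :
    connectedCorrelation W idx u = MvPolynomial.eval
      (momentPoint fun l => sourcedMoment W l u 0) (correlationPoly n idx) :=
  iteratedFDeriv_freeEnergy hV hu n idx (Or.inl hZ)

end QuarticVector

end

theorem mainTheorem3 (N : ℕ) (W : QuarticVector.Tensor4 N)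
    (hsymm : QuarticVector.IsCompletelySymmetric W)
    (hpos : (QuarticVector.pairMatrix W).PosSemidef) (hW : W ≠ 0)
    (Λ₀ : ℝ) (hΛ₀ : QuarticVector.IsHighestEigenvalue (QuarticVector.pairMatrix W) Λ₀)
    (n : ℕ) (hn : 1 ≤ n) (idx : Fin n → Fin N) :
    (∃ G : ℂ → ℂ,
      AnalyticOnNhd ℂ G (interior (QuarticVector.cardioid
        (6 / (N * Λ₀) * Real.sqrt (Real.exp 1 / Real.pi)))) ∧
      ∀ u ∈ interior (QuarticVector.cardioid
        (6 / (N * Λ₀) * Real.sqrt (Real.exp 1 / Real.pi))),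
        0 ≤ u.re → G u = QuarticVector.connectedCorrelation W idx u) ∧
    QuarticVector.BorelSummable (QuarticVector.connectedCorrelation W idx) := by
  open QuarticVector in
  obtain ⟨n, rfl⟩ : ∃ m, n = m + 1 := ⟨n - 1, by omega⟩
  have hN := mul_highestEigenvalue_pos hsymm hpos hW hΛ₀
  have hV := quarticForm_nonneg hsymm hpos hΛ₀
  refine ⟨⟨fun u => MvPolynomial.eval (momentPoint fun l => continuedMoment W l u)
    (correlationPoly n idx), ?_, fun u hu hre => ?_⟩, ?_⟩
  · have hsub := interior_cardioid_subset_slitPlane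
      (6 / (N * Λ₀) * Real.sqrt (Real.exp 1 / Real.pi))
    exact (differentiableOn_eval_momentPoly
      (fun l => (differentiableOn_continuedMoment hV l).mono hsub)
      (fun u hu => continuedMoment_nil_ne_zero hsymm hpos hΛ₀ hN (hsub hu) (interior_subset hu))
      _).analyticOnNhd isOpen_interior
  · rw [connectedCorrelation_eq_eval hV hre idx
      (partition_re_pos_of_mem_cardioid hsymm hpos hΛ₀ hN hre (interior_subset hu))]
    simp only
    congr 3
    ext l
    exact continuedMoment_eq hV l hre (interior_cardioid_subset_slitPlane _ hu)
  · -- in this disk the partition function is at least half of its free value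
    set R₀ : ℝ := 4 / (N * Λ₀) with hR₀
    have hR : 0 < R₀ := by positivity
    have hK : 0 < Real.sqrt (2 * Real.pi) ^ N := by positivity
    have hdisk : ∀ u ∈ tangentDisk R₀, 0 < u.re ∧ ‖u‖ < R₀ := fun u hu => by
      have h0 := ne_zero_of_mem_tangentDisk hR hu
      have hn : 0 < ‖u‖ := norm_pos_iff.2 h0
      have h1 : R₀⁻¹ < (u⁻¹).re := hu
      constructor
      · have h2 : 0 < (u⁻¹).re := (inv_pos.2 hR).trans h1
        rw [Complex.inv_re] at h2
        exact (div_pos_iff_of_pos_right (Complex.normSq_pos.2 h0)).1 h2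
      · have h2 := h1.trans_le ((le_abs_self _).trans (Complex.abs_re_le_norm _))
        rw [norm_inv] at h2
        exact (inv_lt_inv₀ hR hn).1 h2
    have hZ : ∀ u ∈ tangentDisk R₀,
        Real.sqrt (2 * Real.pi) ^ N / 2 ≤ (sourcedMoment W [] u 0).re := fun u hu => by
      obtain ⟨h1, h2⟩ := hdisk u hu
      refine le_trans ?_ (le_partition_re hsymm hpos hΛ₀ h1.le)
      have h3 : ‖u‖ * (N * Λ₀) ≤ 4 := by
        calc ‖u‖ * (N * Λ₀) ≤ R₀ * (N * Λ₀) := by gcongr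
          _ = 4 := div_mul_cancel₀ _ hN.ne'
      nlinarith
    have hZ0 : ∀ u ∈ tangentDisk R₀, 0 < (sourcedMoment W [] u 0).re := fun u hu =>
      lt_of_lt_of_le (by positivity) (hZ u hu)
    have hne : ∀ u ∈ tangentDisk R₀, sourcedMoment W [] u 0 ≠ 0 := fun u hu h => by
      have := hZ0 u hu
      rw [h, Complex.zero_re] at this
      exact lt_irrefl 0 this
    have heq : ∀ u ∈ tangentDisk R₀, connectedCorrelation W idx u = MvPolynomial.eval
        (momentPoint fun l => sourcedMoment W l u 0) (correlationPoly n idx) := fun u hu =>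
      connectedCorrelation_eq_eval hV (hdisk u hu).1.le idx (hZ0 u hu)
    obtain ⟨a, ha⟩ := exists_hasGevreyExpansion_eval (M := fun l u => sourcedMoment W l u 0)
      (fun l => (hasGevreyExpansion_sourcedMoment hV l).mono
        (Ω' := tangentDisk R₀) fun u hu => (hdisk u hu).1.le)
      (by rw [constantCoeff_momentCoeff_nil]; exact_mod_cast hK.ne')
      (C := (Real.sqrt (2 * Real.pi) ^ N / 2)⁻¹)
      (fun u hu => ⟨hne u hu, by
        rw [norm_inv]
        exact inv_anti₀ (by positivity)
          ((hZ u hu).trans ((le_abs_self _).trans (Complex.abs_re_le_norm _)))⟩)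
      (correlationPoly n idx)
    refine borelSummable_of_hasGevreyExpansion hR ?_ (ha.congr heq)
    refine (differentiableOn_eval_momentPoly (fun l => (differentiableOn_sourcedMoment hV l).mono
      fun u hu => (hdisk u hu).1) hne (correlationPoly n idx)).congr heq
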